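/- **Setting.** Let $p:\mathcal D\to\mathcal S$ be a bifibered category (fibered and opfibered) whose fibers $\mathcal D(S)$, $S\in\mathcal S$, have all small limits and colimits. For $f:S\to T$ in $\mathcal S$ let $f_\bullet:\mathcal D(S)\to\mathcal D(T)$ be the push-forward. Fix a full subcategory of $\mathcal D$ whose objects are called *finite*, and assume that push-forward preserves finiteness (if $a\to b$ is coCartesian and $a$ is finite, so is $b$). A *diagram* $(I,S)$ is a small category $I$ with a functor $S:I\to\mathcal S$. A *morphism* $(\alpha,\mu):(I,S)\to(J,T)$ is a functor $\alpha:I\to J$ with a natural transformation $\mu:T\alpha\Rightarrow S$. A *2-morphism* $(\alpha,\mu)\Rightarrow(\beta,\nu)$ is a natural transformation $\kappa:\alpha\Rightarrow\beta$ with $\nu\circ(T*\kappa)=\mu$. The category $\mathcal D(I,S)$ of $(I,S)$-*modules* has as objects the functors $M:I\to\mathcal D$ with $pM=S$, and as morphisms the natural transformations lying over $\mathrm{id}_S$. A module $M$ is *coCartesian* if every $M(\rho)$, $\rho\in\mathrm{Mor}(I)$, is a coCartesian morphism, and *finite* if every $M_i$ is finite; this gives full subcategories $\mathcal D(I,S)^{\mathrm{cocart}}$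 and $\mathcal D(I,S)^{\mathrm f,\mathrm{cocart}}$. The pull-back $(\alpha,\mu)^*:\mathcal D(J,T)\to\mathcal D(I,S)$ is given by $((\alpha,\mu)^*M)_i=\mu(i)_\bullet M_{\alpha(i)}$; it preserves both subcategories. The morphism $(\alpha,\mu)$ is *of descent* (resp. *of finite descent*) if $(\alpha,\mu)^*:\mathcal D(J,T)^{\mathrm{cocart}}\to\mathcal D(I,S)^{\mathrm{cocart}}$ (resp. $(\alpha,\mu)^*:\mathcal D(J,T)^{\mathrm f,\mathrm{cocart}}\to\mathcal D(I,S)^{\mathrm f,\mathrm{cocart}}$) is an equivalence of categories. We write $\cdot$ for the one-point category. **Proposition.** 1. If two of $\phi:(I,S)\to(J,T)$, $\psi:(J,T)\to(K,U)$ and $\psi\circ\phi$ are of descent (resp. of finite descent), so is the third. 2. Let $\phi:(I,S)\to(J,T)$ and $\psi:(J,T)\to(I,S)$ be morphisms such that $\psi\circ\phi$ is connected to $\mathrm{id}_{(I,S)}$, and $\phi\circ\psi$ to $\mathrm{id}_{(J,T)}$, by a finite zig-zag of 2-morphisms. Then $\phi$ and $\psi$ are of descent and of finite descent. 3. Let $(\alpha,\mu):(I,S)\to(J,T)$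 be a morphism. For $j\in J$ let $j\times_{/J}I$ be the category of pairs $(i,\nu)$ with $i\in I$ and $\nu:j\to\alpha(i)$. If for every $j\in J$ the morphism $(j\times_{/J}I,\mathrm{pr}_2^*S)\to(\cdot,T_j)$ given by the maps $\mu(i)\circ T(\nu):T_j\to T_{\alpha(i)}\to S_i$ is of descent (resp. of finite descent), then so is $(\alpha,\mu)$. If $\alpha$ is a Grothendieck fibration, the same holds with $j\times_{/J}I$ replaced by the fiber $j\times_JI$ of $\alpha$ over $j$. 4. Let $\alpha:I\to J$ be a functor between small categories and $S:J\to\mathcal S$ a functor. For $j\in J$ let $I\times_{/J}j$ be the category of pairs $(i,\nu)$ with $i\in I$ and $\nu:\alpha(i)\to j$. If for all $j,k\in J$ the morphism $(I\times_{/J}j,S_k)\to(\cdot,S_k)$ from the constant diagram with value $S_k$ is of descent (resp. of finite descent), then so is $(\alpha,\mathrm{id}):(I,\alpha^*S)\to(J,S)$. 5. Let $I$ be a small category and let $I\to I[\mathrm{Mor}(I)^{-1}]$ be the universal functor to a groupoid. For every $S\in\mathcal S$ the induced morphism of constant diagrams $(I,S)\to(I[\mathrm{Mor}(I)^{-1}],S)$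 is of descent and of finite descent; in particular $\mathcal D(I,S)^{\mathrm{cocart}}\simeq\mathcal D(I[\mathrm{Mor}(I)^{-1}],S)^{\mathrm{cocart}}$, and likewise for finite coCartesian modules. For any choice of a base point in every connected component of $I$, the groupoid $I[\mathrm{Mor}(I)^{-1}]$ is equivalent to the category whose set of objects is $\pi_0(I)$ and whose morphism sets are $\mathrm{Hom}(\xi,\xi')=\pi_1(I,\xi)$ if $\xi=\xi'$ and $\emptyset$ otherwise, where $\pi_1(I,\xi)$ is the fundamental group of the nerve of $I$ at the base point of $\xi$ (the group of closed edge paths modulo the relations given by the 2-simplices). If $\pi_0(I)$ consists of one point and $\pi_1(I,i)$ is trivial for all $i\in I$, then $(I,S)\to(\cdot,S)$ is of descent and of finite descent for every $S\in\mathcal S$. 6. Let $\Delta$ be the simplex category, with objects $[n]=\{0,\dots,n\}$ for $n\ge0$, let $\Delta^\circ$ be its subcategory of injective maps, and let $\delta_k^i:[k-1]\to[k]$ be the strictly increasing map omitting $i$. Let $S_\bullet$ be a cosimplicial object $\Delta\to\mathcal S$ or a cosemisimplicial object $\Delta^\circ\to\mathcal S$, and write $(\delta_k^i)^*=S(\delta_k^i)_\bullet$.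 Then $\mathcal D(\Delta,S_\bullet)^{\mathrm{cocart}}$, resp. $\mathcal D(\Delta^\circ,S_\bullet)^{\mathrm{cocart}}$, is equivalent to the category of classical descent data: its objects are pairs $(M,\rho)$ of an object $M\in\mathcal D(S_0)$ and an isomorphism $\rho:(\delta_1^0)^*M\to(\delta_1^1)^*M$ in $\mathcal D(S_1)$ such that $$(\delta_2^2)^*\rho\circ(\delta_2^0)^*\rho=(\delta_2^1)^*\rho$$ in $\mathcal D(S_2)$ (up to the canonical isomorphisms $(gf)_\bullet\cong g_\bullet f_\bullet$), and its morphisms are the morphisms $M\to M'$ in $\mathcal D(S_0)$ compatible with $\rho$ and $\rho'$. The equivalence sends a module $N$ to $N_0$ with the isomorphism $\rho$ obtained from the structure morphisms $(\delta_1^0)^*N_0\xrightarrow{\sim}N_1\xleftarrow{\sim}(\delta_1^1)^*N_0$. -/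

import Mathlib

open CategoryTheory Simplicial

universe w v₁ v₂ v₃ v₄ v₅ u₁ u₂ u₃ u₄ u₅

noncomputable section

namespace DiagramDescent

open CategoryTheory.Functor

/-! ### Bifibered categories and push-forward -/

section Bifibered

variable {𝒟 : Type u₁} [Category.{v₁} 𝒟] {𝒮 : Type u₂} [Category.{v₂} 𝒮]

/-- `p : 𝒟 ⥤ 𝒮` is opfibered: every morphism `p(a) ⟶ S` has a coCartesian lift with source `a`. -/
class IsOpfibered (p : 𝒟 ⥤ 𝒮) : Prop where
  exists_lift : ∀ {a : 𝒟} {S : 𝒮} (f : p.obj a ⟶ S),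
    ∃ (b : 𝒟) (φ : a ⟶ b), p.IsStronglyCocartesian f φ

/-- `p : 𝒟 ⥤ 𝒮` is bifibered: it is both fibered and opfibered. -/
class IsBifibered (p : 𝒟 ⥤ 𝒮) : Prop extends p.IsFibered, IsOpfibered p

/-- A property of objects of `𝒟` (a full subcategory) stable under push-forward, i.e. under
targets of coCartesian morphisms. -/
class IsPushforwardStable (p : 𝒟 ⥤ 𝒮) (P : ObjectProperty 𝒟) : Prop where
  prop_of_cocartesian : ∀ {R S : 𝒮} (f : R ⟶ S) {a b : 𝒟} (φ : a ⟶ b)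
    [p.IsStronglyCocartesian f φ], P a → P b

variable (p : 𝒟 ⥤ 𝒮) [IsOpfibered p]

lemma exists_cocartesian {a : 𝒟} {R S : 𝒮} (ha : p.obj a = R) (f : R ⟶ S) :
    ∃ (b : 𝒟) (φ : a ⟶ b), p.IsStronglyCocartesian f φ := by
  subst ha
  exact IsOpfibered.exists_lift f

/-- A chosen push-forward `f_• a` of an object `a` over `R` along `f : R ⟶ S`. -/
def pushObj {a : 𝒟} {R S : 𝒮} (ha : p.obj a = R) (f : R ⟶ S) : 𝒟 :=
  (exists_cocartesian p ha f).choose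

/-- The chosen coCartesian lift `a ⟶ f_• a` of `f`. -/
def pushLift {a : 𝒟} {R S : 𝒮} (ha : p.obj a = R) (f : R ⟶ S) : a ⟶ pushObj p ha f :=
  (exists_cocartesian p ha f).choose_spec.choose

instance pushLift_isStronglyCocartesian {a : 𝒟} {R S : 𝒮} (ha : p.obj a = R) (f : R ⟶ S) :
    p.IsStronglyCocartesian f (pushLift p ha f) :=
  (exists_cocartesian p ha f).choose_spec.choose_spec

lemma pushObj_proj {a : 𝒟} {R S : 𝒮} (ha : p.obj a = R) (f : R ⟶ S) :
    p.obj (pushObj p ha f) = S :=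
  IsHomLift.codomain_eq p f (pushLift p ha f)

/-- The morphism `f_• a ⟶ g_• b` over `k` induced by a morphism `φ : a ⟶ b` over `h`, for a
commutative square `f ≫ k = h ≫ g` in the base. -/
def pushMap {a b : 𝒟} {R S R' S' : 𝒮} (ha : p.obj a = R) (f : R ⟶ S) (hb : p.obj b = R')
    (g : R' ⟶ S') (h : R ⟶ R') (k : S ⟶ S') (w : h ≫ g = f ≫ k)
    (φ : a ⟶ b) [p.IsHomLift h φ] : pushObj p ha f ⟶ pushObj p hb g :=
  IsStronglyCocartesian.map p f (pushLift p ha f) w (φ ≫ pushLift p hb g)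

section

variable {a b : 𝒟} {R S R' S' : 𝒮} (ha : p.obj a = R) (f : R ⟶ S) (hb : p.obj b = R')
    (g : R' ⟶ S') (h : R ⟶ R') (k : S ⟶ S') (w : h ≫ g = f ≫ k)
    (φ : a ⟶ b) [p.IsHomLift h φ]

instance pushMap_isHomLift : p.IsHomLift k (pushMap p ha f hb g h k w φ) := by
  unfold pushMap
  infer_instance

lemma pushLift_pushMap :
    pushLift p ha f ≫ pushMap p ha f hb g h k w φ = φ ≫ pushLift p hb g :=
  IsStronglyCocartesian.fac p f _ w _

lemma pushMap_uniq (ψ : pushObj p ha f ⟶ pushObj p hb g) [p.IsHomLift k ψ]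
    (hψ : pushLift p ha f ≫ ψ = φ ≫ pushLift p hb g) : ψ = pushMap p ha f hb g h k w φ :=
  IsStronglyCocartesian.map_uniq p f _ w _ ψ hψ

end

lemma pushMap_id {a : 𝒟} {R S : 𝒮} (ha : p.obj a = R) (f : R ⟶ S) (h : R ⟶ R) (k : S ⟶ S)
    (hh : h = 𝟙 R) (hk : k = 𝟙 S) (φ : a ⟶ a) [p.IsHomLift h φ] (hφ : φ = 𝟙 a) :
    pushMap p ha f ha f h k (by rw [hh, hk, Category.id_comp, Category.comp_id]) φ = 𝟙 _ := by
  subst hh hk hφ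
  have : p.IsHomLift (𝟙 S) (𝟙 (pushObj p ha f)) := IsHomLift.id (pushObj_proj p ha f)
  exact (pushMap_uniq p ha f ha f (𝟙 R) (𝟙 S) (by simp) (𝟙 a) (𝟙 _) (by simp)).symm

lemma pushMap_comp {a b c : 𝒟} {R S R' S' R'' S'' : 𝒮} (ha : p.obj a = R) (f : R ⟶ S)
    (hb : p.obj b = R') (g : R' ⟶ S') (hc : p.obj c = R'') (l : R'' ⟶ S'')
    (h : R ⟶ R') (k : S ⟶ S') (w : h ≫ g = f ≫ k) (φ : a ⟶ b) [p.IsHomLift h φ]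
    (h' : R' ⟶ R'') (k' : S' ⟶ S'') (w' : h' ≫ l = g ≫ k') (ψ : b ⟶ c) [p.IsHomLift h' ψ]
    (h'' : R ⟶ R'') (k'' : S ⟶ S'') (w'' : h'' ≫ l = f ≫ k'') (χ : a ⟶ c) [p.IsHomLift h'' χ]
    (hk : k'' = k ≫ k') (hχ : χ = φ ≫ ψ) :
    pushMap p ha f hc l h'' k'' w'' χ =
      pushMap p ha f hb g h k w φ ≫ pushMap p hb g hc l h' k' w' ψ := by
  subst hk
  refine (pushMap_uniq p ha f hc l h'' (k ≫ k') w'' χ _ ?_).symm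
  rw [← Category.assoc, pushLift_pushMap, Category.assoc, pushLift_pushMap, hχ, Category.assoc]

/-- The canonical isomorphism `h_• a ≅ g_• f_• a` for a composition `f ≫ g = h`; it is the unique
morphism over the identity which is compatible with the chosen coCartesian lifts. -/
def pushCompIso {a : 𝒟} {R S T : 𝒮} (ha : p.obj a = R) (f : R ⟶ S) (g : S ⟶ T) (h : R ⟶ T)
    (w : f ≫ g = h) : pushObj p ha h ≅ pushObj p (pushObj_proj p ha f) g :=
  have : p.IsStronglyCocartesian h (pushLift p ha f ≫ pushLift p (pushObj_proj p ha f) g) := by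
    subst w
    infer_instance
  IsCocartesian.codomainUniqueUpToIso p h (pushLift p ha h)
    (pushLift p ha f ≫ pushLift p (pushObj_proj p ha f) g)

instance pushCompIso_hom_isHomLift {a : 𝒟} {R S T : 𝒮} (ha : p.obj a = R) (f : R ⟶ S)
    (g : S ⟶ T) (h : R ⟶ T) (w : f ≫ g = h) :
    p.IsHomLift (𝟙 T) (pushCompIso p ha f g h w).hom := by
  subst w
  exact IsCocartesian.map_isHomLift p (f ≫ g) _ _

/-- The category `𝒟(S)` of objects over `S` is `p.Fiber S`; this is the push-forward functor
`f_• : 𝒟(R) ⥤ 𝒟(S)` along `f : R ⟶ S`. -/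
def pushforward {R S : 𝒮} (f : R ⟶ S) : p.Fiber R ⥤ p.Fiber S where
  obj a := ⟨pushObj p a.2 f, pushObj_proj p a.2 f⟩
  map {a b} φ :=
    haveI := φ.2
    ⟨pushMap p a.2 f b.2 f (𝟙 R) (𝟙 S) (by simp) φ.1, inferInstance⟩
  map_id a := Subtype.ext
    (haveI : p.IsHomLift (𝟙 R) (𝟙 a.1) := IsHomLift.id a.2
    pushMap_id p a.2 f (𝟙 R) (𝟙 S) rfl rfl (𝟙 a.1) rfl)
  map_comp {a b c} φ ψ := Subtype.ext
    (haveI := φ.2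
    haveI := ψ.2
    pushMap_comp p a.2 f b.2 f c.2 f (𝟙 R) (𝟙 S) (by simp) φ.1 (𝟙 R) (𝟙 S) (by simp) ψ.1
      (𝟙 R) (𝟙 S) (by simp) (φ.1 ≫ ψ.1) (by simp) rfl)

/-- The canonical isomorphism `h_• a ≅ g_• f_• a` in the fiber, for a composition `f ≫ g = h`. -/
def pushComp {R S T : 𝒮} (f : R ⟶ S) (g : S ⟶ T) (h : R ⟶ T) (w : f ≫ g = h) (a : p.Fiber R) :
    (pushforward p h).obj a ≅ (pushforward p g).obj ((pushforward p f).obj a) where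
  hom := ⟨(pushCompIso p a.2 f g h w).hom, pushCompIso_hom_isHomLift p a.2 f g h w⟩
  inv := ⟨(pushCompIso p a.2 f g h w).inv,
    haveI := pushCompIso_hom_isHomLift p a.2 f g h w
    IsHomLift.lift_id_inv p T (pushCompIso p a.2 f g h w)⟩
  hom_inv_id := Subtype.ext (pushCompIso p a.2 f g h w).hom_inv_id
  inv_hom_id := Subtype.ext (pushCompIso p a.2 f g h w).inv_hom_id

end Bifibered

/-! ### Diagrams in `𝒮` and their morphisms

A diagram in `𝒮` is a pair `(I, S)` of a small category `I` and a functor `S : I ⥤ 𝒮`. -/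

section Diagrams

variable {𝒮 : Type u₂} [Category.{v₂} 𝒮]
  {I : Type u₃} [Category.{v₃} I] {J : Type u₄} [Category.{v₄} J] {K : Type u₅} [Category.{v₅} K]

/-- A morphism `(α, μ) : (I, S) ⟶ (J, T)` of diagrams: a functor `α : I ⥤ J` and a natural
transformation `μ : T ∘ α ⟶ S`. -/
structure DiaHom (S : I ⥤ 𝒮) (T : J ⥤ 𝒮) where
  functor : I ⥤ J
  trans : functor ⋙ T ⟶ S

namespace DiaHom

variable {S : I ⥤ 𝒮} {T : J ⥤ 𝒮} {U : K ⥤ 𝒮}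

/-- The component `μ(i) : T_{α(i)} ⟶ S_i`. -/
def app (φ : DiaHom S T) (i : I) : T.obj (φ.functor.obj i) ⟶ S.obj i := φ.trans.app i

lemma naturality (φ : DiaHom S T) {i j : I} (f : i ⟶ j) :
    T.map (φ.functor.map f) ≫ φ.app j = φ.app i ≫ S.map f :=
  φ.trans.naturality f

/-- A 2-morphism `(α, μ) ⟹ (β, ν)`: a natural transformation `κ : α ⟶ β` such that
`ν ∘ (T ∗ κ) = μ`. -/
@[ext]
structure TwoHom (φ ψ : DiaHom S T) where
  nat : φ.functor ⟶ ψ.functor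
  w : Functor.whiskerRight nat T ≫ ψ.trans = φ.trans

/-- The category of morphisms `(I, S) ⟶ (J, T)` and 2-morphisms between them. -/
instance : Category (DiaHom S T) where
  Hom := TwoHom
  id φ := ⟨𝟙 _, by ext; simp⟩
  comp κ l := ⟨κ.nat ≫ l.nat, by rw [Functor.whiskerRight_comp, Category.assoc, l.w, κ.w]⟩
  id_comp κ := TwoHom.ext (Category.id_comp _)
  comp_id κ := TwoHom.ext (Category.comp_id _)
  assoc κ l m := TwoHom.ext (Category.assoc _ _ _)

/-- The identity morphism of `(I, S)`. -/
def id (S : I ⥤ 𝒮) : DiaHom S S where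
  functor := 𝟭 I
  trans := { app := fun i => 𝟙 (S.obj i) }

/-- The composition `(β, ν) ∘ (α, μ) : (I, S) ⟶ (J, T) ⟶ (K, U)`. -/
def comp (φ : DiaHom S T) (ψ : DiaHom T U) : DiaHom S U where
  functor := φ.functor ⋙ ψ.functor
  trans :=
    { app := fun i => ψ.app (φ.functor.obj i) ≫ φ.app i
      naturality := fun i i' f => by
        change U.map (ψ.functor.map (φ.functor.map f)) ≫ ψ.app (φ.functor.obj i') ≫ φ.app i' =
          (ψ.app (φ.functor.obj i) ≫ φ.app i) ≫ S.map f
        rw [← Category.assoc, ψ.naturality, Category.assoc, φ.naturality, Category.assoc] }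

/-- The morphism of pure diagram type `(α, id) : (I, α^* T) ⟶ (J, T)`. -/
def pure (α : I ⥤ J) (T : J ⥤ 𝒮) : DiaHom (α ⋙ T) T where
  functor := α
  trans := 𝟙 _

/-- The morphism of constant diagrams `(I, X) ⟶ (J, X)` induced by a functor `I ⥤ J`. -/
def const (α : I ⥤ J) (X : 𝒮) :
    DiaHom ((Functor.const I).obj X) ((Functor.const J).obj X) where
  functor := α
  trans := { app := fun _ => 𝟙 X }

variable (I) in
/-- The morphism `(I, X) ⟶ (·, X)` from a constant diagram to the one-point diagram. -/
def constToPoint (X : 𝒮) :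
    DiaHom ((Functor.const I).obj X) ((Functor.const (Discrete PUnit.{1})).obj X) :=
  const ((Functor.const I).obj ⟨PUnit.unit⟩) X

/-- For `j : J`, the morphism `(j ×_{/J} I, pr₂^* S) ⟶ (j, T_j)`. An object of the slice category
`j ×_{/J} I` is a pair `(i, ν)` with `ν : j ⟶ α(i)`, and the morphism is
`T_j ⟶ T_{α(i)} ⟶ S_i` at `(i, ν)`. -/
def slice (φ : DiaHom S T) (j : J) :
    DiaHom (StructuredArrow.proj j φ.functor ⋙ S)
      ((Functor.const (Discrete PUnit.{1})).obj (T.obj j)) where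
  functor := (Functor.const _).obj ⟨PUnit.unit⟩
  trans :=
    { app := fun x => T.map x.hom ≫ φ.app x.right
      naturality := fun x y f => by
        change 𝟙 (T.obj j) ≫ T.map y.hom ≫ φ.app y.right =
          (T.map x.hom ≫ φ.app x.right) ≫ S.map f.right
        rw [Category.assoc, ← φ.naturality, ← Category.assoc (T.map x.hom), ← T.map_comp,
          StructuredArrow.w f, Category.id_comp] }

/-- For `j : J`, the morphism `(j ×_J I, S) ⟶ (j, T_j)` from the fiber of `α` over `j`. The
morphism is `T_j = T_{α(i)} ⟶ S_i` at an object `i` of the fiber. -/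
def fiber (φ : DiaHom S T) (j : J) :
    DiaHom ((Fiber.fiberInclusion : φ.functor.Fiber j ⥤ I) ⋙ S)
      ((Functor.const (Discrete PUnit.{1})).obj (T.obj j)) where
  functor := (Functor.const _).obj ⟨PUnit.unit⟩
  trans :=
    { app := fun x => T.map (eqToHom x.2.symm) ≫ φ.app x.1
      naturality := fun x y f => by
        have := f.2
        change 𝟙 (T.obj j) ≫ T.map (eqToHom y.2.symm) ≫ φ.app y.1 =
          (T.map (eqToHom x.2.symm) ≫ φ.app x.1) ≫ S.map f.1
        rw [Category.assoc, ← φ.naturality, ← Category.assoc (T.map (eqToHom x.2.symm)),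
          ← T.map_comp, IsHomLift.fac' φ.functor (𝟙 j) f.1]
        simp }

end DiaHom

end Diagrams

/-! ### Modules over diagrams and morphisms of (finite) descent -/

section Modules

variable {𝒟 : Type u₁} [Category.{v₁} 𝒟] {𝒮 : Type u₂} [Category.{v₂} 𝒮] (p : 𝒟 ⥤ 𝒮)
  {I : Type u₃} [Category.{v₃} I] {J : Type u₄} [Category.{v₄} J]

/-- An `(I, S)`-module: a functor `M : I ⥤ 𝒟` which lifts `S` along `p`. -/
structure DiaMod (S : I ⥤ 𝒮) where
  functor : I ⥤ 𝒟
  isHomLift : ∀ {i j : I} (f : i ⟶ j), p.IsHomLift (S.map f) (functor.map f)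

attribute [instance] DiaMod.isHomLift

namespace DiaMod

variable {p} {S : I ⥤ 𝒮} {T : J ⥤ 𝒮}

lemma proj_obj (M : DiaMod p S) (i : I) : p.obj (M.functor.obj i) = S.obj i :=
  IsHomLift.domain_eq p (S.map (𝟙 i)) (M.functor.map (𝟙 i))

/-- A morphism of `(I, S)`-modules: a natural transformation over the identity of `S`. -/
@[ext]
structure Hom (M N : DiaMod p S) where
  nat : M.functor ⟶ N.functor
  isHomLift : ∀ i : I, p.IsHomLift (𝟙 (S.obj i)) (nat.app i)

attribute [instance] Hom.isHomLift

/-- The category `𝒟(I, S)` of `(I, S)`-modules. -/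
instance : Category (DiaMod p S) where
  Hom := Hom
  id M := ⟨𝟙 _, fun i => IsHomLift.id (M.proj_obj i)⟩
  comp f g := ⟨f.nat ≫ g.nat, fun i => by
    rw [NatTrans.comp_app]
    infer_instance⟩
  id_comp f := Hom.ext (Category.id_comp _)
  comp_id f := Hom.ext (Category.comp_id _)
  assoc f g h := Hom.ext (Category.assoc _ _ _)

@[simp]
lemma id_nat (M : DiaMod p S) : Hom.nat (𝟙 M) = 𝟙 M.functor := rfl

@[simp]
lemma comp_nat {M N L : DiaMod p S} (f : M ⟶ N) (g : N ⟶ L) :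
    Hom.nat (f ≫ g) = Hom.nat f ≫ Hom.nat g := rfl

variable (p S) in
/-- The coCartesian modules: all the morphisms `M(ρ)` are coCartesian. -/
def IsCocart : ObjectProperty (DiaMod p S) :=
  fun M => ∀ ⦃i j : I⦄ (f : i ⟶ j), p.IsStronglyCocartesian (S.map f) (M.functor.map f)

variable (p S) in
/-- The point-wise finite coCartesian modules, where the finite objects of `𝒟` are those
satisfying `P`. -/
def IsFiniteCocart (P : ObjectProperty 𝒟) : ObjectProperty (DiaMod p S) :=
  fun M => IsCocart p S M ∧ ∀ i : I, P (M.functor.obj i)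

/-- Evaluation at `i`, as a functor to the fiber over `S_i`. -/
def eval (p : 𝒟 ⥤ 𝒮) (S : I ⥤ 𝒮) (i : I) : DiaMod p S ⥤ p.Fiber (S.obj i) where
  obj M := ⟨M.functor.obj i, M.proj_obj i⟩
  map f := ⟨(Hom.nat f).app i, Hom.isHomLift f i⟩

/-- The restriction `M ∘ α` of a `(J, T)`-module `M` along a functor `α : I ⥤ J`. -/
def restrict (p : 𝒟 ⥤ 𝒮) (α : I ⥤ J) (T : J ⥤ 𝒮) : DiaMod p T ⥤ DiaMod p (α ⋙ T) where
  obj M := ⟨α ⋙ M.functor, fun f => M.isHomLift (α.map f)⟩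
  map f := ⟨Functor.whiskerLeft α (Hom.nat f), fun i => Hom.isHomLift f (α.obj i)⟩

/-- The morphism `S(f)_• M_i ⟶ M_j` over the identity of `S_j` induced by `M(f) : M_i ⟶ M_j`. -/
def strHom [IsOpfibered p] (M : DiaMod p S) {i j : I} (f : i ⟶ j) :
    pushObj p (M.proj_obj i) (S.map f) ⟶ M.functor.obj j :=
  IsCocartesian.map p (S.map f) (pushLift p (M.proj_obj i) (S.map f)) (M.functor.map f)

instance strHom_isHomLift [IsOpfibered p] (M : DiaMod p S) {i j : I} (f : i ⟶ j) :
    p.IsHomLift (𝟙 (S.obj j)) (M.strHom f) :=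
  IsCocartesian.map_isHomLift p _ _ _

/-- The structure morphism `S(f)_• M_i ⟶ M_j` of a module `M`, as a morphism in `𝒟(S_j)`. -/
def str [IsOpfibered p] (M : DiaMod p S) {i j : I} (f : i ⟶ j) :
    (pushforward p (S.map f)).obj ((eval p S i).obj M) ⟶ (eval p S j).obj M :=
  ⟨M.strHom f, M.strHom_isHomLift f⟩

section Pullback

variable [IsOpfibered p] (φ : DiaHom S T)

/-- The pull-back `(α, μ)^* M`, given by `((α, μ)^* M)_i = μ(i)_• M_{α(i)}`. -/
def pullbackObj (M : DiaMod p T) : DiaMod p S where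
  functor :=
    { obj := fun i => pushObj p (M.proj_obj (φ.functor.obj i)) (φ.app i)
      map := fun {i j} f =>
        pushMap p (M.proj_obj (φ.functor.obj i)) (φ.app i) (M.proj_obj (φ.functor.obj j))
          (φ.app j) (T.map (φ.functor.map f)) (S.map f) (φ.naturality f)
          (M.functor.map (φ.functor.map f))
      map_id := fun i =>
        pushMap_id p (M.proj_obj (φ.functor.obj i)) (φ.app i) _ _ (by simp) (by simp) _
          (by simp)
      map_comp := fun {i j k} f g =>
        pushMap_comp p (M.proj_obj (φ.functor.obj i)) (φ.app i)
          (M.proj_obj (φ.functor.obj j)) (φ.app j) (M.proj_obj (φ.functor.obj k))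
          (φ.app k) _ _ (φ.naturality f) _ _ _ (φ.naturality g) _ _ _
          (φ.naturality (f ≫ g)) _ (by simp) (by simp) }
  isHomLift {i j} f :=
    pushMap_isHomLift p (M.proj_obj (φ.functor.obj i)) (φ.app i)
      (M.proj_obj (φ.functor.obj j)) (φ.app j) (T.map (φ.functor.map f)) (S.map f)
      (φ.naturality f) (M.functor.map (φ.functor.map f))

/-- The pull-back functor `(α, μ)^* : 𝒟(J, T) ⥤ 𝒟(I, S)`. -/
def pullback : DiaMod p T ⥤ DiaMod p S where
  obj := pullbackObj φ
  map {M N} f :=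
    { nat :=
        { app := fun i =>
            pushMap p (M.proj_obj (φ.functor.obj i)) (φ.app i)
              (N.proj_obj (φ.functor.obj i)) (φ.app i) (𝟙 _) (𝟙 _) (by simp)
              ((Hom.nat f).app (φ.functor.obj i))
          naturality := fun i j u => by
            have e := (Hom.nat f).naturality (φ.functor.map u)
            have h₁ := (M.isHomLift (φ.functor.map u))
            have h₂ := (N.isHomLift (φ.functor.map u))
            have h₃ : p.IsHomLift (T.map (φ.functor.map u))
                (M.functor.map (φ.functor.map u) ≫ (Hom.nat f).app (φ.functor.obj j)) :=
              inferInstance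
            exact (pushMap_comp p (M.proj_obj (φ.functor.obj i)) (φ.app i)
              (M.proj_obj (φ.functor.obj j)) (φ.app j) (N.proj_obj (φ.functor.obj j))
              (φ.app j) _ _ (φ.naturality u) (M.functor.map (φ.functor.map u))
              (𝟙 _) (𝟙 _) (by simp) ((Hom.nat f).app (φ.functor.obj j)) _ _
              (φ.naturality u) _ (by simp) rfl).symm.trans
              (pushMap_comp p (M.proj_obj (φ.functor.obj i)) (φ.app i)
              (N.proj_obj (φ.functor.obj i)) (φ.app i) (N.proj_obj (φ.functor.obj j))
              (φ.app j) (𝟙 _) (𝟙 _) (by simp) ((Hom.nat f).app (φ.functor.obj i))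
              _ _ (φ.naturality u) (N.functor.map (φ.functor.map u)) _ _
              (φ.naturality u) _ (by simp) e) }
      isHomLift := fun i =>
        pushMap_isHomLift p (M.proj_obj (φ.functor.obj i)) (φ.app i)
          (N.proj_obj (φ.functor.obj i)) (φ.app i) (𝟙 _) (𝟙 _) (by simp)
          ((Hom.nat f).app (φ.functor.obj i)) }
  map_id M := Hom.ext (NatTrans.ext (funext fun i =>
    haveI : p.IsHomLift (𝟙 (T.obj (φ.functor.obj i))) (𝟙 (M.functor.obj (φ.functor.obj i))) :=
      IsHomLift.id (M.proj_obj _)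
    pushMap_id p (M.proj_obj (φ.functor.obj i)) (φ.app i) (𝟙 _) (𝟙 _) rfl rfl (𝟙 _) rfl))
  map_comp {M N L} f g := Hom.ext (NatTrans.ext (funext fun i =>
    pushMap_comp p (M.proj_obj (φ.functor.obj i)) (φ.app i)
      (N.proj_obj (φ.functor.obj i)) (φ.app i) (L.proj_obj (φ.functor.obj i))
      (φ.app i) (𝟙 _) (𝟙 _) (by simp) ((Hom.nat f).app (φ.functor.obj i))
      (𝟙 _) (𝟙 _) (by simp) ((Hom.nat g).app (φ.functor.obj i)) (𝟙 _) (𝟙 _) (by simp)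
      ((Hom.nat f).app (φ.functor.obj i) ≫ (Hom.nat g).app (φ.functor.obj i)) (by simp) rfl))

lemma pullback_isCocart (M : DiaMod p T) (hM : IsCocart p T M) :
    IsCocart p S ((pullback φ).obj M) := by
  intro i j f
  have h₁ := hM (φ.functor.map f)
  have h₂ : p.IsStronglyCocartesian (φ.app i ≫ S.map f)
      (pushLift p (M.proj_obj (φ.functor.obj i)) (φ.app i) ≫
        pushMap p (M.proj_obj (φ.functor.obj i)) (φ.app i) (M.proj_obj (φ.functor.obj j))
          (φ.app j) (T.map (φ.functor.map f)) (S.map f) (φ.naturality f)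
          (M.functor.map (φ.functor.map f))) := by
    rw [pushLift_pushMap, ← φ.naturality f]
    exact IsStronglyCocartesian.comp p
  exact IsStronglyCocartesian.of_comp p (f := φ.app i) (g := S.map f)
    (φ := pushLift p (M.proj_obj (φ.functor.obj i)) (φ.app i))
    (ψ := pushMap p (M.proj_obj (φ.functor.obj i)) (φ.app i)
      (M.proj_obj (φ.functor.obj j)) (φ.app j) (T.map (φ.functor.map f)) (S.map f)
      (φ.naturality f) (M.functor.map (φ.functor.map f)))

lemma pullback_isFiniteCocart (P : ObjectProperty 𝒟) [IsPushforwardStable p P] (M : DiaMod p T)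
    (hM : IsFiniteCocart p T P M) : IsFiniteCocart p S P ((pullback φ).obj M) :=
  ⟨pullback_isCocart φ M hM.1, fun i => by
    change P (pushObj p (M.proj_obj (φ.functor.obj i)) (φ.app i))
    exact IsPushforwardStable.prop_of_cocartesian (p := p) (φ.app i)
      (pushLift p (M.proj_obj (φ.functor.obj i)) (φ.app i)) (hM.2 _)⟩

/-- The pull-back functor `(α, μ)^* : 𝒟(J, T)^cocart ⥤ 𝒟(I, S)^cocart`. -/
def pullbackCocart : (IsCocart p T).FullSubcategory ⥤ (IsCocart p S).FullSubcategory :=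
  (IsCocart p S).lift ((IsCocart p T).ι ⋙ pullback φ)
    (fun M => pullback_isCocart φ M.obj M.property)

/-- The pull-back functor `(α, μ)^* : 𝒟(J, T)^{f, cocart} ⥤ 𝒟(I, S)^{f, cocart}`. -/
def pullbackFiniteCocart (P : ObjectProperty 𝒟) [IsPushforwardStable p P] :
    (IsFiniteCocart p T P).FullSubcategory ⥤ (IsFiniteCocart p S P).FullSubcategory :=
  (IsFiniteCocart p S P).lift ((IsFiniteCocart p T P).ι ⋙ pullback φ)
    (fun M => pullback_isFiniteCocart φ P M.obj M.property)

end Pullback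

end DiaMod

variable [IsOpfibered p] {S : I ⥤ 𝒮} {T : J ⥤ 𝒮}

/-- `(α, μ)` is of descent if `(α, μ)^*` is an equivalence on coCartesian modules. -/
def IsOfDescent (φ : DiaHom S T) : Prop :=
  (DiaMod.pullbackCocart (p := p) φ).IsEquivalence

/-- `(α, μ)` is of finite descent if `(α, μ)^*` is an equivalence on finite coCartesian modules. -/
def IsOfFiniteDescent (P : ObjectProperty 𝒟) [IsPushforwardStable p P] (φ : DiaHom S T) : Prop :=
  (DiaMod.pullbackFiniteCocart (p := p) φ P).IsEquivalence

end Modules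

/-! ### The fundamental group of a small category -/

section FundamentalGroup

/-- The vertices of a simplicial set, as the objects of the quiver of its edges. -/
structure EdgeQuiver (X : SSet.{w}) where
  vertex : X _⦋0⦌

instance (X : SSet.{w}) : Quiver (EdgeQuiver X) where
  Hom x y := SSet.Edge x.vertex y.vertex

/-- The relation on edge paths (words in edges and formal inverses of edges) given by the
2-simplices: the composite of the faces `01` and `12` is identified with the face `02`. -/
inductive edgePathRel (X : SSet.{w}) : HomRel (Quiver.FreeGroupoid (EdgeQuiver X)) where
  | triangle {x y z : EdgeQuiver X} (e₀₁ : x ⟶ y) (e₁₂ : y ⟶ z) (e₀₂ : x ⟶ z)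
      (h : SSet.Edge.CompStruct e₀₁ e₁₂ e₀₂) :
      edgePathRel X
        ((Quiver.FreeGroupoid.of _).map e₀₁ ≫ (Quiver.FreeGroupoid.of _).map e₁₂)
        ((Quiver.FreeGroupoid.of _).map e₀₂)

/-- The fundamental groupoid of a simplicial set: its objects are the vertices, its morphisms are
the homotopy classes of edge paths. -/
def EdgePathGroupoid (X : SSet.{w}) := CategoryTheory.Quotient (edgePathRel X)

instance (X : SSet.{w}) : Groupoid (EdgePathGroupoid X) :=
  CategoryTheory.Quotient.groupoid (edgePathRel X)

/-- A vertex of `X` as an object of the fundamental groupoid. -/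
def EdgePathGroupoid.mk {X : SSet.{w}} (x : X _⦋0⦌) : EdgePathGroupoid X :=
  (CategoryTheory.Quotient.functor (edgePathRel X)).obj ((Quiver.FreeGroupoid.of _).obj ⟨x⟩)

/-- The fundamental group `π₁(I, i)` of a category `I` at an object `i`: the edge path group of
the nerve of `I`, i.e. the group of homotopy classes of closed edge paths at `i`. -/
def PiOne (I : Type u₃) [Category.{v₃} I] (i : I) :=
  EdgePathGroupoid.mk (X := nerve I) (nerveEquiv.symm i) ⟶
    EdgePathGroupoid.mk (X := nerve I) (nerveEquiv.symm i)

instance (I : Type u₃) [Category.{v₃} I] (i : I) : Group (PiOne I i) :=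
  inferInstanceAs (Group (EdgePathGroupoid.mk (X := nerve I) (nerveEquiv.symm i) ⟶
    EdgePathGroupoid.mk (X := nerve I) (nerveEquiv.symm i)))

end FundamentalGroup

/-! ### Classical descent data -/

section DescentData

variable {𝒟 : Type u₁} [Category.{v₁} 𝒟] {𝒮 : Type u₂} [Category.{v₂} 𝒮] (p : 𝒟 ⥤ 𝒮)

/-- The strictly increasing map `δ^i : [n] ⟶ [n + 1]` omitting `i`, in the category of finite
ordinals and strictly increasing maps. -/
def coface (n : ℕ) (i : Fin (n + 2)) : (⦋n⦌ₛ : SemiSimplexCategory) ⟶ ⦋n + 1⦌ₛ :=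
  SemiSimplexCategory.homEquiv.symm (Fin.succAboveOrderEmb i)

/-- The morphism `[0] ⟶ [2]` with image `k`. -/
def vertexOfTwo (k : Fin 3) : (⦋0⦌ₛ : SemiSimplexCategory) ⟶ ⦋2⦌ₛ :=
  SemiSimplexCategory.homEquiv.symm
    (OrderEmbedding.ofStrictMono (fun _ => k) (fun a b h => by
      have ha : a.val < 1 := a.isLt
      have hb : b.val < 1 := b.isLt
      have hab : a.val < b.val := h
      omega))

lemma coface_coface (i : Fin 2) (j k : Fin 3) (h : j.succAbove (i.succAbove 0) = k) :
    coface 0 i ≫ coface 1 j = vertexOfTwo k := by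
  subst h
  apply SemiSimplexCategory.hom_ext
  ext x
  obtain rfl : x = 0 := Subsingleton.elim (α := Fin 1) _ _
  rfl

variable [IsOpfibered p]

/-- For `ρ : f_• M ⟶ g_• M` in `𝒟(S)` and `d : S ⟶ T`, the morphism `d_• ρ` in `𝒟(T)`, transported
along `d_• f_• M ≅ a_• M` and `d_• g_• M ≅ b_• M`, where `a = d ∘ f` and `b = d ∘ g`. -/
def pushHom {R S T : 𝒮} {M : p.Fiber R} {f g : R ⟶ S}
    (ρ : (pushforward p f).obj M ⟶ (pushforward p g).obj M) (d : S ⟶ T) (a b : R ⟶ T)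
    (ha : f ≫ d = a) (hb : g ≫ d = b) :
    (pushforward p a).obj M ⟶ (pushforward p b).obj M :=
  (pushComp p f d a ha M).hom ≫ (pushforward p d).map ρ ≫ (pushComp p g d b hb M).inv

variable (S : SemiSimplexCategory ⥤ 𝒮)

lemma map_coface_coface (i : Fin 2) (j k : Fin 3) (h : j.succAbove (i.succAbove 0) = k) :
    S.map (coface 0 i) ≫ S.map (coface 1 j) = S.map (vertexOfTwo k) := by
  rw [← S.map_comp, coface_coface i j k h]

/-- Classical descent data for a cosemisimplicial object `S`: an object `M` over `S_0` together
with an isomorphism `ρ : (δ^0)_• M ⟶ (δ^1)_• M` over `S_1` such that, over `S_2`,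
`(δ^2)_• ρ ∘ (δ^0)_• ρ = (δ^1)_• ρ`. -/
structure DescentDatum where
  obj : p.Fiber (S.obj ⦋0⦌ₛ)
  iso : (pushforward p (S.map (coface 0 0))).obj obj ≅
    (pushforward p (S.map (coface 0 1))).obj obj
  cocycle :
    pushHom p iso.hom (S.map (coface 1 0)) (S.map (vertexOfTwo 2)) (S.map (vertexOfTwo 1))
        (map_coface_coface S 0 0 2 rfl) (map_coface_coface S 1 0 1 rfl) ≫
      pushHom p iso.hom (S.map (coface 1 2)) (S.map (vertexOfTwo 1)) (S.map (vertexOfTwo 0))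
        (map_coface_coface S 0 2 1 rfl) (map_coface_coface S 1 2 0 rfl) =
    pushHom p iso.hom (S.map (coface 1 1)) (S.map (vertexOfTwo 2)) (S.map (vertexOfTwo 0))
      (map_coface_coface S 0 1 2 rfl) (map_coface_coface S 1 1 0 rfl)

namespace DescentDatum

variable {p S}

/-- A morphism of descent data: a morphism over `S_0` compatible with the isomorphisms `ρ`. -/
@[ext]
structure Hom (X Y : DescentDatum p S) where
  hom : X.obj ⟶ Y.obj
  w : X.iso.hom ≫ (pushforward p (S.map (coface 0 1))).map hom =
    (pushforward p (S.map (coface 0 0))).map hom ≫ Y.iso.hom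

/-- The category of classical descent data. -/
instance : Category (DescentDatum p S) where
  Hom := Hom
  id X := ⟨𝟙 _, by simp⟩
  comp f g := ⟨f.hom ≫ g.hom, by
    rw [Functor.map_comp, Functor.map_comp, ← Category.assoc, f.w, Category.assoc, g.w,
      Category.assoc]⟩
  id_comp f := Hom.ext (Category.id_comp _)
  comp_id f := Hom.ext (Category.comp_id _)
  assoc f g h := Hom.ext (Category.assoc _ _ _)

variable (p S) in
/-- The functor sending `(M, ρ)` to `M`. -/
def forget : DescentDatum p S ⥤ p.Fiber (S.obj ⦋0⦌ₛ) where
  obj X := X.obj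
  map f := Hom.hom f

/-- `θ : X ≅ M_0` exhibits `X = (X, ρ)` as the descent datum of the module `M`: under `θ`, the
isomorphism `ρ` is the composition `(δ^0)_• M_0 ⟶ M_1 ⟵ (δ^1)_• M_0` of the structure morphisms,
i.e. the composition of `ρ` with the second one is the first one. -/
def IsDatumOf (X : DescentDatum p S) (M : DiaMod p S)
    (θ : X.obj ≅ (DiaMod.eval p S ⦋0⦌ₛ).obj M) : Prop :=
  X.iso.hom ≫ (pushforward p (S.map (coface 0 1))).map θ.hom ≫ M.str (coface 0 1) =
    (pushforward p (S.map (coface 0 0))).map θ.hom ≫ M.str (coface 0 0)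

end DescentDatum

end DescentData

end DiagramDescent

end

open DiagramDescent

noncomputable section

namespace DiagramDescent

open CategoryTheory.Functor

/-! ### Elementary facts on coCartesian morphisms -/

section Cocartesian

variable {𝒟 : Type u₁} [Category.{v₁} 𝒟] {𝒮 : Type u₂} [Category.{v₂} 𝒮] {p : 𝒟 ⥤ 𝒮}
  {R S T : 𝒮} {a b c : 𝒟} {f : R ⟶ S} {g : S ⟶ T} {k : R ⟶ T} {φ : a ⟶ b}

/-! Chosen push-forwards are eliminated at the outset. A module `N` is a pull-back of `M` along `φ =
(α, μ)` as soon as there is a natural family of coCartesian arrows `M_{α(i)} ⟶ N_i` over `μ(i)` (a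
`Lifting`), and such an `N` is unique up to unique isomorphism. Descent then says that every `N`
receives a lifting and that morphisms descend uniquely along liftings (`HasDescentOn`,
`pullbackOn_isEquivalence_iff`). Plain descent is the case `P = ⊤` of finite descent, so each
criterion is proved once, for a general `P`.

Two out of three and homotopy invariance follow from functoriality of pull-back up to isomorphism,
together with the fact that a 2-morphism `κ` changes the pull-back of a coCartesian `M` only by an
isomorphism, because `M(κ_i)` is coCartesian.

For the slice criterion, descent at `j` produces an object `M_j` with a coCartesian cone to `N`. An
arrow over `j ⟶ j'` compatible with two such cones is unique, and this uniqueness makes the `M_j`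
into a functor (`isOfFiniteDescent_of_hasSliceDescent`). For pure diagram type the picture is dual:
`M_j` is the vertex of a coCartesian cocone from `N` over the coslice, and arrows over `j ⟶ k` are
compared in the fiber over `S_k`; hence the hypothesis for all pairs `(j, k)`
(`isOfFiniteDescent_pure`).

Over a constant diagram coCartesian arrows are invertible, so a coCartesian module is a functor to
the core of a fiber and extends to the free groupoid. That groupoid is the edge path groupoid of the
nerve, since the two have inverse universal maps (`freeGroupoidEquivalence`).

A coCartesian module over a cosemisimplicial object is governed by vertices: `M_n` is the
push-forward of `M_0` along the vertex `0` of `[n]`, the other vertices are reached along edges, and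
triangles impose exactly the cocycle condition (`exists_module_of_isCocycle`). Cosimplicial objects
reduce to this case by the pure criterion, because the category of simplices of `[n]` and injections
contracts to the vertex `0` by a cone construction (`zigzag_simplices`). -/

lemma isHomLift_comp {ψ : b ⟶ c} (hφ : p.IsHomLift f φ) (hψ : p.IsHomLift g ψ)
    (w : f ≫ g = k) : p.IsHomLift k (φ ≫ ψ) := by
  subst w
  infer_instance

lemma cocart_exists (hφ : p.IsStronglyCocartesian f φ) {χ : a ⟶ c} (hχ : p.IsHomLift k χ)
    (w : f ≫ g = k) : ∃ ψ : b ⟶ c, p.IsHomLift g ψ ∧ φ ≫ ψ = χ :=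
  (IsStronglyCocartesian.universal_property p f φ g k w.symm χ).exists

lemma cocart_ext (hφ : p.IsStronglyCocartesian f φ) {ψ ψ' : b ⟶ c} (hψ : p.IsHomLift g ψ)
    (hψ' : p.IsHomLift g ψ') (h : φ ≫ ψ = φ ≫ ψ') : ψ = ψ' :=
  IsStronglyCocartesian.ext p f φ g h

lemma cocart_comp {ψ : b ⟶ c} (hφ : p.IsStronglyCocartesian f φ)
    (hψ : p.IsStronglyCocartesian g ψ) (w : f ≫ g = k) :
    p.IsStronglyCocartesian k (φ ≫ ψ) := by
  subst w
  infer_instance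

lemma cocart_of_comp {ψ : b ⟶ c} {χ : a ⟶ c} (hφ : p.IsStronglyCocartesian f φ)
    (hχ : p.IsStronglyCocartesian k χ) (hψ : p.IsHomLift g ψ) (w : f ≫ g = k)
    (h : φ ≫ ψ = χ) : p.IsStronglyCocartesian g ψ := by
  subst w h
  exact IsStronglyCocartesian.of_comp p (f := f) (φ := φ)

lemma cocart_isHomLift (hφ : p.IsStronglyCocartesian f φ) : p.IsHomLift f φ := inferInstance

lemma cocart_of_isIso (hφ : p.IsHomLift f φ) (h : IsIso φ) : p.IsStronglyCocartesian f φ :=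
  inferInstance

lemma isIso_of_cocart_id {f : R ⟶ R} (hφ : p.IsStronglyCocartesian f φ) (hf : f = 𝟙 R) :
    IsIso φ := by
  subst hf
  exact IsStronglyCocartesian.isIso_of_base_isIso p (𝟙 R) φ

lemma isHomLift_inv (hφ : p.IsHomLift (𝟙 R) φ) [IsIso φ] : p.IsHomLift (𝟙 R) (inv φ) :=
  inferInstance

lemma cocart_id (ha : p.obj a = R) : p.IsStronglyCocartesian (𝟙 R) (𝟙 a) :=
  cocart_of_isIso (IsHomLift.id ha) inferInstance

/-- Two coCartesian lifts of the same morphism with the same source have isomorphic targets. -/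
lemma isIso_of_cocart_of_cocart {φ' : a ⟶ c} {ψ : b ⟶ c} (hφ : p.IsStronglyCocartesian f φ)
    (hφ' : p.IsStronglyCocartesian f φ') (hψ : p.IsHomLift (𝟙 S) ψ) (h : φ ≫ ψ = φ') :
    IsIso ψ :=
  isIso_of_cocart_id (cocart_of_comp hφ hφ' hψ (Category.comp_id f) h) rfl

end Cocartesian

/-! ### Modules, liftings and descent in terms of liftings -/

section Liftings

variable {𝒟 : Type u₁} [Category.{v₁} 𝒟] {𝒮 : Type u₂} [Category.{v₂} 𝒮] {p : 𝒟 ⥤ 𝒮}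
  {I : Type u₃} [Category.{v₃} I] {J : Type u₄} [Category.{v₄} J] {K : Type u₅} [Category.{v₅} K]
  {S : I ⥤ 𝒮} {T : J ⥤ 𝒮} {U : K ⥤ 𝒮}

namespace DiaMod

/-- The component at `i` of a morphism of modules. -/
def homApp {M N : DiaMod p S} (f : M ⟶ N) (i : I) : M.functor.obj i ⟶ N.functor.obj i :=
  (Hom.nat f).app i

lemma homApp_isHomLift {M N : DiaMod p S} (f : M ⟶ N) (i : I) :
    p.IsHomLift (𝟙 (S.obj i)) (homApp f i) :=
  Hom.isHomLift f i

@[simp]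
lemma homApp_id (M : DiaMod p S) (i : I) : homApp (𝟙 M) i = 𝟙 (M.functor.obj i) := rfl

@[simp]
lemma homApp_comp {M N L : DiaMod p S} (f : M ⟶ N) (g : N ⟶ L) (i : I) :
    homApp (f ≫ g) i = homApp f i ≫ homApp g i := rfl

lemma homApp_naturality {M N : DiaMod p S} (f : M ⟶ N) {i j : I} (u : i ⟶ j) :
    M.functor.map u ≫ homApp f j = homApp f i ≫ N.functor.map u :=
  (Hom.nat f).naturality u

lemma hom_ext_app {M N : DiaMod p S} {f g : M ⟶ N} (h : ∀ i, homApp f i = homApp g i) : f = g :=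
  Hom.ext (NatTrans.ext (funext h))

/-- Constructor for morphisms of modules. -/
def mkHom {M N : DiaMod p S} (app : ∀ i, M.functor.obj i ⟶ N.functor.obj i)
    (lift : ∀ i, p.IsHomLift (𝟙 (S.obj i)) (app i))
    (nat : ∀ {i j : I} (u : i ⟶ j), M.functor.map u ≫ app j = app i ≫ N.functor.map u) : M ⟶ N :=
  Hom.mk { app := app, naturality := fun _ _ u => nat u } lift

@[simp]
lemma homApp_mkHom {M N : DiaMod p S} (app : ∀ i, M.functor.obj i ⟶ N.functor.obj i)
    (lift : ∀ i, p.IsHomLift (𝟙 (S.obj i)) (app i))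
    (nat : ∀ {i j : I} (u : i ⟶ j), M.functor.map u ≫ app j = app i ≫ N.functor.map u) (i : I) :
    homApp (mkHom app lift nat) i = app i := rfl

/-- A morphism of modules all of whose components are isomorphisms is an isomorphism. -/
def mkIso {M N : DiaMod p S} (f : M ⟶ N) (h : ∀ i, IsIso (homApp f i)) : M ≅ N where
  hom := f
  inv := mkHom (fun i => inv (homApp f i))
    (fun i => isHomLift_inv (homApp_isHomLift f i))
    (fun {i j} u => by
      rw [IsIso.comp_inv_eq, Category.assoc, IsIso.eq_inv_comp, homApp_naturality])
  hom_inv_id := hom_ext_app fun i => by simp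
  inv_hom_id := hom_ext_app fun i => by simp

end DiaMod

open DiaMod

/-- A lifting of `φ = (α, μ)`: a natural family of coCartesian morphisms `M_{α(i)} ⟶ N_i` over
`μ(i)`. It exhibits `N` as the pull-back of `M` along `φ`. -/
structure Lifting (φ : DiaHom S T) (M : DiaMod p T) (N : DiaMod p S) where
  app (i : I) : M.functor.obj (φ.functor.obj i) ⟶ N.functor.obj i
  naturality {i j : I} (u : i ⟶ j) :
    M.functor.map (φ.functor.map u) ≫ app j = app i ≫ N.functor.map u
  cocart (i : I) : p.IsStronglyCocartesian (φ.app i) (app i)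

namespace Lifting

variable {φ : DiaHom S T}

/-- Each component comes from the universal property of the coCartesian arrow `l.app i`; naturality
is checked after composing with that arrow. -/
lemma exists_map {M M' : DiaMod p T} {N N' : DiaMod p S} (l : Lifting φ M N)
    (l' : Lifting φ M' N') (f : M ⟶ M') :
    ∃ g : N ⟶ N', ∀ i, l.app i ≫ homApp g i = homApp f (φ.functor.obj i) ≫ l'.app i := by
  have h (i : I) := cocart_exists (g := 𝟙 (S.obj i)) (l.cocart i)
    (isHomLift_comp (homApp_isHomLift f (φ.functor.obj i)) (cocart_isHomLift (l'.cocart i))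
      (Category.id_comp _)) (Category.comp_id _)
  choose g hg hg' using h
  refine ⟨mkHom g hg fun {i j} u => ?_, hg'⟩
  refine cocart_ext (l.cocart i) (isHomLift_comp (N.isHomLift u) (hg j) (Category.comp_id _))
    (isHomLift_comp (hg i) (N'.isHomLift u) (Category.id_comp _)) ?_
  rw [← Category.assoc, ← l.naturality, Category.assoc, hg', ← Category.assoc, homApp_naturality,
    ← Category.assoc, hg', Category.assoc, Category.assoc, l'.naturality]

lemma hom_ext {M : DiaMod p T} {N N' : DiaMod p S} (l : Lifting φ M N) {f g : N ⟶ N'}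
    (h : ∀ i, l.app i ≫ homApp f i = l.app i ≫ homApp g i) : f = g :=
  hom_ext_app fun i =>
    cocart_ext (l.cocart i) (homApp_isHomLift f i) (homApp_isHomLift g i) (h i)

/-- Both liftings are coCartesian over the same arrows with the same sources, so the comparison
induced by `𝟙 M` is invertible componentwise. -/
lemma exists_iso {M : DiaMod p T} {N N' : DiaMod p S} (l : Lifting φ M N)
    (l' : Lifting φ M N') : ∃ e : N ≅ N', ∀ i, l.app i ≫ homApp e.hom i = l'.app i := by
  obtain ⟨g, hg⟩ := l.exists_map l' (𝟙 M)
  refine ⟨mkIso g fun i => ?_, fun i => ?_⟩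
  · refine isIso_of_cocart_of_cocart (l.cocart i) (l'.cocart i) (homApp_isHomLift g i) ?_
    simpa using hg i
  · simpa [mkIso] using hg i

/-- The lifting composed with an isomorphism of its target. -/
def compIso {M : DiaMod p T} {N N' : DiaMod p S} (l : Lifting φ M N) (e : N ≅ N') :
    Lifting φ M N' where
  app i := l.app i ≫ homApp e.hom i
  naturality u := by
    rw [← Category.assoc, l.naturality, Category.assoc, Category.assoc, homApp_naturality]
  cocart i := by
    have h₁ : IsIso (homApp e.hom i) := ⟨homApp e.inv i, by
      rw [← homApp_comp, e.hom_inv_id, homApp_id], by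
      rw [← homApp_comp, e.inv_hom_id, homApp_id]⟩
    exact cocart_comp (l.cocart i) (cocart_of_isIso (homApp_isHomLift e.hom i) h₁)
      (Category.comp_id _)

/-- The composition of liftings. -/
def comp {ψ : DiaHom T U} {L : DiaMod p U} {M : DiaMod p T} {N : DiaMod p S}
    (l' : Lifting ψ L M) (l : Lifting φ M N) : Lifting (φ.comp ψ) L N where
  app i := l'.app (φ.functor.obj i) ≫ l.app i
  naturality {i j} u := by
    change L.functor.map (ψ.functor.map (φ.functor.map u)) ≫
      l'.app (φ.functor.obj j) ≫ l.app j = (l'.app (φ.functor.obj i) ≫ l.app i) ≫ N.functor.map u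
    rw [Category.assoc, ← l.naturality u, ← Category.assoc, ← Category.assoc,
      ← l'.naturality (φ.functor.map u)]
  cocart i := cocart_comp (l'.cocart _) (l.cocart i) rfl

/-- The tautological lifting of the identity. -/
def id (M : DiaMod p S) : Lifting (DiaHom.id S) M M where
  app i := 𝟙 (M.functor.obj i)
  naturality _ := (Category.comp_id _).trans (Category.id_comp _).symm
  cocart i := cocart_id (M.proj_obj i)

/-- A 2-morphism transports liftings of coCartesian modules. -/
def ofTwoHom {φ ψ : DiaHom S T} (κ : φ ⟶ ψ) {M : DiaMod p T} {N : DiaMod p S}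
    (hM : IsCocart p T M) (l : Lifting ψ M N) : Lifting φ M N where
  app i := M.functor.map ((DiaHom.TwoHom.nat κ).app i) ≫ l.app i
  naturality {i j} u := by
    rw [Category.assoc, ← l.naturality u, ← Category.assoc, ← Category.assoc, ← M.functor.map_comp,
      ← M.functor.map_comp, (DiaHom.TwoHom.nat κ).naturality u]
  cocart i := cocart_comp (hM _) (l.cocart i) (NatTrans.congr_app (DiaHom.TwoHom.w κ) i)

end Lifting

/-- Descent along `φ` for the modules satisfying `Q` on the target and `Q'` on the source, in
terms of liftings. -/
structure HasDescentOn (Q : ObjectProperty (DiaMod p T)) (Q' : ObjectProperty (DiaMod p S))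
    (φ : DiaHom S T) : Prop where
  existsUnique_hom : ∀ ⦃M M' : DiaMod p T⦄, Q M → Q M' → ∀ ⦃N N' : DiaMod p S⦄
    (l : Lifting φ M N) (l' : Lifting φ M' N') (g : N ⟶ N'),
    ∃! f : M ⟶ M', ∀ i, l.app i ≫ homApp g i = homApp f (φ.functor.obj i) ≫ l'.app i
  exists_lifting : ∀ ⦃N : DiaMod p S⦄, Q' N → ∃ M, Q M ∧ Nonempty (Lifting φ M N)

section

variable [IsOpfibered p]

/-- The lifting exhibiting `φ^* M` as the pull-back of `M`. -/
def pullbackLifting (φ : DiaHom S T) (M : DiaMod p T) : Lifting φ M ((pullback φ).obj M) where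
  app i := pushLift p (M.proj_obj (φ.functor.obj i)) (φ.app i)
  naturality {i j} u :=
    (pushLift_pushMap p (M.proj_obj (φ.functor.obj i)) (φ.app i)
          (M.proj_obj (φ.functor.obj j)) (φ.app j) _ _ (φ.naturality u)
          (M.functor.map (φ.functor.map u))).symm
  cocart i := pushLift_isStronglyCocartesian p (M.proj_obj (φ.functor.obj i)) (φ.app i)

lemma pullbackLifting_map (φ : DiaHom S T) {M N : DiaMod p T} (f : M ⟶ N) (i : I) :
    (pullbackLifting φ M).app i ≫ homApp ((pullback φ).map f) i =
      homApp f (φ.functor.obj i) ≫ (pullbackLifting φ N).app i :=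
  pushLift_pushMap p (M.proj_obj (φ.functor.obj i)) (φ.app i) (N.proj_obj (φ.functor.obj i))
    (φ.app i) (𝟙 _) (𝟙 _) (by simp) ((Hom.nat f).app (φ.functor.obj i))

/-- The pull-back functor between full subcategories of modules. -/
abbrev pullbackOn {Q : ObjectProperty (DiaMod p T)} {Q' : ObjectProperty (DiaMod p S)}
    (φ : DiaHom S T) (h : ∀ M : Q.FullSubcategory, Q' ((pullback φ).obj M.obj)) :
    Q.FullSubcategory ⥤ Q'.FullSubcategory :=
  Q'.lift (Q.ι ⋙ pullback φ) h

/-- Any lifting differs from `pullbackLifting` by an isomorphism of targets, so full faithfulness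
and essential surjectivity can be tested on arbitrary liftings. No condition on `N` and `N'` is
needed in the morphism part, since they are isomorphic to pull-backs of `M` and `M'`. -/
lemma pullbackOn_isEquivalence_iff {Q : ObjectProperty (DiaMod p T)}
    {Q' : ObjectProperty (DiaMod p S)} (φ : DiaHom S T)
    (h : ∀ M : Q.FullSubcategory, Q' ((pullback φ).obj M.obj)) :
    (pullbackOn φ h).IsEquivalence ↔ HasDescentOn Q Q' φ := by
  constructor
  · intro hF
    refine ⟨fun M M' hM hM' N N' l l' g => ?_, fun N hN => ?_⟩
    · obtain ⟨e, he⟩ := (pullbackLifting φ M).exists_iso l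
      obtain ⟨e', he'⟩ := (pullbackLifting φ M').exists_iso l'
      -- Transporting `g` along `e` and `e'` turns compatibility with the given liftings into an
      -- equation for the pull-back functor.
      have key (f : M ⟶ M') : (∀ i, l.app i ≫ homApp g i =
          homApp f (φ.functor.obj i) ≫ l'.app i) ↔
          (pullback φ).map f = e.hom ≫ g ≫ e'.inv := by
        rw [← Category.assoc, Iso.eq_comp_inv]
        refine ⟨fun hf => (pullbackLifting φ M).hom_ext fun i => ?_, fun hf i => ?_⟩
        · rw [homApp_comp, homApp_comp, ← Category.assoc, ← Category.assoc, pullbackLifting_map,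
            he, hf, Category.assoc, he']
        · rw [← he, Category.assoc, ← homApp_comp, ← hf, homApp_comp, ← Category.assoc,
            pullbackLifting_map, Category.assoc, he']
      let X : Q.FullSubcategory := ⟨M, hM⟩
      let X' : Q.FullSubcategory := ⟨M', hM'⟩
      obtain ⟨f, hf⟩ := (pullbackOn φ h).map_surjective (X := X) (Y := X')
        (ObjectProperty.homMk (e.hom ≫ g ≫ e'.inv))
      have hf₁ := congrArg InducedCategory.Hom.hom hf
      refine ⟨f.hom, (key _).2 hf₁, fun f' hf' => ?_⟩
      have : (pullbackOn φ h).map (X := X) (Y := X') (ObjectProperty.homMk f') =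
          (pullbackOn φ h).map f := by
        rw [hf]
        exact congrArg ObjectProperty.homMk ((key f').1 hf')
      exact congrArg InducedCategory.Hom.hom ((pullbackOn φ h).map_injective this)
    · let Y : Q'.FullSubcategory := ⟨N, hN⟩
      let e := (pullbackOn φ h).objObjPreimageIso Y
      exact ⟨_, ((pullbackOn φ h).objPreimage Y).property,
        ⟨(pullbackLifting φ _).compIso (Q'.ι.mapIso e)⟩⟩
  · intro H
    have key {M M' : Q.FullSubcategory} (f : M ⟶ M') (g) : (pullbackOn φ h).map f = g ↔
        ∀ i, (pullbackLifting φ M.obj).app i ≫ homApp g.hom i =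
          homApp f.hom (φ.functor.obj i) ≫ (pullbackLifting φ M'.obj).app i := by
      constructor
      · rintro rfl i
        exact pullbackLifting_map φ f.hom i
      · intro hf
        refine InducedCategory.hom_ext ((pullbackLifting φ M.obj).hom_ext fun i => ?_)
        rw [hf]
        exact pullbackLifting_map φ f.hom i
    refine { faithful := ⟨?_⟩, full := ⟨?_⟩, essSurj := ⟨?_⟩ }
    · intro M M' f f' hf
      obtain ⟨f₀, -, h₀⟩ := H.existsUnique_hom M.property M'.property (pullbackLifting φ M.obj)
        (pullbackLifting φ M'.obj) ((pullbackOn φ h).map f').hom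
      exact InducedCategory.hom_ext ((h₀ _ ((key f _).1 hf)).trans (h₀ _ ((key f' _).1 rfl)).symm)
    · intro M M' g
      obtain ⟨f, hf, -⟩ := H.existsUnique_hom M.property M'.property (pullbackLifting φ M.obj)
        (pullbackLifting φ M'.obj) g.hom
      exact ⟨ObjectProperty.homMk f, (key _ _).2 hf⟩
    · intro N
      obtain ⟨M, hM, ⟨l⟩⟩ := H.exists_lifting N.property
      obtain ⟨e, -⟩ := (pullbackLifting φ M).exists_iso l
      exact ⟨⟨M, hM⟩, ⟨Q'.isoMk e⟩⟩

variable (p) in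
lemma isOfDescent_iff_hasDescentOn (φ : DiaHom S T) :
    IsOfDescent p φ ↔ HasDescentOn (IsCocart p T) (IsCocart p S) φ :=
  pullbackOn_isEquivalence_iff φ _

variable (p) in
lemma isOfFiniteDescent_iff (P : ObjectProperty 𝒟) [IsPushforwardStable p P] (φ : DiaHom S T) :
    IsOfFiniteDescent p P φ ↔ HasDescentOn (IsFiniteCocart p T P) (IsFiniteCocart p S P) φ :=
  pullbackOn_isEquivalence_iff φ _

end

/-- With `⊤` as the class of finite objects the finiteness condition is vacuous, so results on
finite descent specialize to plain descent. -/
instance : IsPushforwardStable p (⊤ : ObjectProperty 𝒟) := ⟨fun _ _ _ _ _ _ => trivial⟩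

lemma isCocart_eq_isFiniteCocart_top : IsCocart p S = IsFiniteCocart p S ⊤ :=
  funext fun _ => propext ⟨fun h => ⟨h, fun _ => trivial⟩, fun h => h.1⟩

variable (p) in
/-- Descent is finite descent for the property satisfied by all objects. -/
lemma isOfDescent_iff_isOfFiniteDescent_top [IsOpfibered p] (φ : DiaHom S T) :
    IsOfDescent p φ ↔ IsOfFiniteDescent p ⊤ φ := by
  rw [isOfDescent_iff_hasDescentOn, isOfFiniteDescent_iff, isCocart_eq_isFiniteCocart_top,
    isCocart_eq_isFiniteCocart_top]

end Liftings

end DiagramDescent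

namespace DiagramDescent

open CategoryTheory.Functor

/-! ### Composition of morphisms and 2-morphisms -/

section Composition

open DiaMod

variable {𝒟 : Type u₁} [Category.{v₁} 𝒟] {𝒮 : Type u₂} [Category.{v₂} 𝒮] {p : 𝒟 ⥤ 𝒮}
  {I : Type u₃} [Category.{v₃} I] {J : Type u₄} [Category.{v₄} J] {K : Type u₅} [Category.{v₅} K]
  {S : I ⥤ 𝒮} {T : J ⥤ 𝒮} {U : K ⥤ 𝒮}

/-- Two functors which are both pull-backs of the same functor along `φ` are isomorphic. -/
lemma nonempty_iso_of_liftings {C : Type*} [Category* C] {φ : DiaHom S T}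
    {Q' : ObjectProperty (DiaMod p S)} {F G : C ⥤ Q'.FullSubcategory} (H : C ⥤ DiaMod p T)
    (l : ∀ X, Lifting φ (H.obj X) (F.obj X).obj) (l' : ∀ X, Lifting φ (H.obj X) (G.obj X).obj)
    (hl : ∀ {X Y : C} (f : X ⟶ Y) (i : I), (l X).app i ≫ homApp (F.map f).hom i =
      homApp (H.map f) (φ.functor.obj i) ≫ (l Y).app i)
    (hl' : ∀ {X Y : C} (f : X ⟶ Y) (i : I), (l' X).app i ≫ homApp (G.map f).hom i =
      homApp (H.map f) (φ.functor.obj i) ≫ (l' Y).app i) : Nonempty (F ≅ G) := by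
  choose e he using fun X => (l X).exists_iso (l' X)
  refine ⟨NatIso.ofComponents (fun X => Q'.isoMk (e X)) fun {X Y} f => ?_⟩
  refine InducedCategory.hom_ext ((l X).hom_ext fun i => ?_)
  change (l X).app i ≫ homApp (F.map f).hom i ≫ homApp (e Y).hom i =
    (l X).app i ≫ homApp (e X).hom i ≫ homApp (G.map f).hom i
  rw [← Category.assoc, hl, Category.assoc, he, ← Category.assoc, he, hl']

variable [IsOpfibered p]

/-- A composite of coCartesian lifts is a coCartesian lift of the composite, so both functors are
pull-backs along `φ.comp ψ`. -/
lemma pullbackOn_comp_nonempty_iso {Q : ObjectProperty (DiaMod p S)}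
    {Q' : ObjectProperty (DiaMod p T)} {Q'' : ObjectProperty (DiaMod p U)}
    (φ : DiaHom S T) (ψ : DiaHom T U)
    (h : ∀ M : Q'.FullSubcategory, Q ((pullback φ).obj M.obj))
    (h' : ∀ M : Q''.FullSubcategory, Q' ((pullback ψ).obj M.obj))
    (h'' : ∀ M : Q''.FullSubcategory, Q ((pullback (φ.comp ψ)).obj M.obj)) :
    Nonempty (pullbackOn ψ h' ⋙ pullbackOn φ h ≅ pullbackOn (φ.comp ψ) h'') := by
  refine nonempty_iso_of_liftings (φ := φ.comp ψ) Q''.ι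
    (fun M => (pullbackLifting ψ M.obj).comp (pullbackLifting φ ((pullback ψ).obj M.obj)))
    (fun M => pullbackLifting (φ.comp ψ) M.obj) (fun {M M'} f i => ?_)
    (fun f i => pullbackLifting_map (φ.comp ψ) f.hom i)
  have h₁ := pullbackLifting_map φ ((pullback ψ).map f.hom) i
  have h₂ := pullbackLifting_map ψ f.hom (φ.functor.obj i)
  change ((pullbackLifting ψ M.obj).app (φ.functor.obj i) ≫
    (pullbackLifting φ ((pullback ψ).obj M.obj)).app i) ≫
      homApp ((pullback φ).map ((pullback ψ).map f.hom)) i =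
    homApp f.hom (ψ.functor.obj (φ.functor.obj i)) ≫
      (pullbackLifting ψ M'.obj).app (φ.functor.obj i) ≫
        (pullbackLifting φ ((pullback ψ).obj M'.obj)).app i
  rw [Category.assoc, h₁, ← Category.assoc, h₂, Category.assoc]

/-- This is where coCartesian modules matter: `M(κ_i)` is coCartesian, so composing with it turns a
lifting of `ψ` into a lifting of `φ` with the same target. -/
lemma pullbackOn_nonempty_iso_of_hom {Q : ObjectProperty (DiaMod p S)}
    {Q' : ObjectProperty (DiaMod p T)} (hQ' : Q' ≤ IsCocart p T) {φ ψ : DiaHom S T} (κ : φ ⟶ ψ)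
    (h : ∀ M : Q'.FullSubcategory, Q ((pullback φ).obj M.obj))
    (h' : ∀ M : Q'.FullSubcategory, Q ((pullback ψ).obj M.obj)) :
    Nonempty (pullbackOn φ h ≅ pullbackOn ψ h') := by
  refine nonempty_iso_of_liftings (φ := φ) Q'.ι (fun M => pullbackLifting φ M.obj)
    (fun M => (pullbackLifting ψ M.obj).ofTwoHom κ (hQ' _ M.property))
    (fun f i => pullbackLifting_map φ f.hom i) (fun {M M'} f i => ?_)
  have h₁ := pullbackLifting_map ψ f.hom i
  have h₂ := homApp_naturality f.hom ((DiaHom.TwoHom.nat κ).app i)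
  change (M.obj.functor.map ((DiaHom.TwoHom.nat κ).app i) ≫ (pullbackLifting ψ M.obj).app i) ≫
      homApp ((pullback ψ).map f.hom) i =
    homApp f.hom (φ.functor.obj i) ≫ M'.obj.functor.map ((DiaHom.TwoHom.nat κ).app i) ≫
      (pullbackLifting ψ M'.obj).app i
  rw [Category.assoc, h₁, ← Category.assoc, h₂, Category.assoc]

lemma pullbackOn_id_nonempty_iso {Q : ObjectProperty (DiaMod p S)}
    (h : ∀ M : Q.FullSubcategory, Q ((pullback (DiaHom.id S)).obj M.obj)) :
    Nonempty (pullbackOn (DiaHom.id S) h ≅ 𝟭 _) := by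
  refine nonempty_iso_of_liftings (φ := DiaHom.id S) Q.ι
    (fun M => pullbackLifting (DiaHom.id S) M.obj) (fun M => Lifting.id M.obj)
    (fun f i => pullbackLifting_map (DiaHom.id S) f.hom i) (fun f i => ?_)
  exact (Category.id_comp _).trans (Category.comp_id _).symm

variable (P : ObjectProperty 𝒟) [IsPushforwardStable p P]

variable (p) in
lemma pullbackFiniteCocart_comp_nonempty_iso (φ : DiaHom S T) (ψ : DiaHom T U) :
    Nonempty (pullbackFiniteCocart (p := p) ψ P ⋙ pullbackFiniteCocart φ P ≅
      pullbackFiniteCocart (φ.comp ψ) P) :=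
  pullbackOn_comp_nonempty_iso φ ψ _ _ _

namespace IsOfFiniteDescent

variable {P} {φ : DiaHom S T} {ψ : DiaHom T U}

lemma comp (h : IsOfFiniteDescent p P φ) (h' : IsOfFiniteDescent p P ψ) :
    IsOfFiniteDescent p P (φ.comp ψ) := by
  obtain ⟨e⟩ := pullbackFiniteCocart_comp_nonempty_iso p P φ ψ
  have : (pullbackFiniteCocart (p := p) φ P).IsEquivalence := h
  have : (pullbackFiniteCocart (p := p) ψ P).IsEquivalence := h'
  exact isEquivalence_of_iso (F := pullbackFiniteCocart ψ P ⋙ pullbackFiniteCocart φ P) e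

lemma of_comp_left (h : IsOfFiniteDescent p P φ) (h' : IsOfFiniteDescent p P (φ.comp ψ)) :
    IsOfFiniteDescent p P ψ := by
  obtain ⟨e⟩ := pullbackFiniteCocart_comp_nonempty_iso p P φ ψ
  have : (pullbackFiniteCocart (p := p) φ P).IsEquivalence := h
  have : (pullbackFiniteCocart (p := p) (φ.comp ψ) P).IsEquivalence := h'
  have : (pullbackFiniteCocart (p := p) ψ P ⋙ pullbackFiniteCocart φ P).IsEquivalence :=
    isEquivalence_of_iso (F := pullbackFiniteCocart (φ.comp ψ) P) e.symm
  exact isEquivalence_of_comp_right (pullbackFiniteCocart ψ P) (pullbackFiniteCocart φ P)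

lemma of_comp_right (h : IsOfFiniteDescent p P ψ) (h' : IsOfFiniteDescent p P (φ.comp ψ)) :
    IsOfFiniteDescent p P φ := by
  obtain ⟨e⟩ := pullbackFiniteCocart_comp_nonempty_iso p P φ ψ
  have : (pullbackFiniteCocart (p := p) ψ P).IsEquivalence := h
  have : (pullbackFiniteCocart (p := p) (φ.comp ψ) P).IsEquivalence := h'
  have : (pullbackFiniteCocart (p := p) ψ P ⋙ pullbackFiniteCocart φ P).IsEquivalence :=
    isEquivalence_of_iso (F := pullbackFiniteCocart (φ.comp ψ) P) e.symm
  exact isEquivalence_of_comp_left (pullbackFiniteCocart ψ P) (pullbackFiniteCocart φ P)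

end IsOfFiniteDescent

variable (p) in
lemma pullbackFiniteCocart_nonempty_iso_of_zigzag {φ ψ : DiaHom S T} (h : Zigzag φ ψ) :
    Nonempty (pullbackFiniteCocart (p := p) φ P ≅ pullbackFiniteCocart ψ P) := by
  have hom {φ ψ : DiaHom S T} (κ : φ ⟶ ψ) :
      Nonempty (pullbackFiniteCocart (p := p) φ P ≅ pullbackFiniteCocart ψ P) :=
    pullbackOn_nonempty_iso_of_hom (fun _ h => h.1) κ _ _
  induction h with
  | refl => exact ⟨Iso.refl _⟩
  | tail _ h ih =>
    obtain ⟨e⟩ := ih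
    rcases h with ⟨⟨κ⟩⟩ | ⟨⟨κ⟩⟩
    · exact (hom κ).map fun e' => e ≪≫ e'
    · exact (hom κ).map fun e' => e ≪≫ e'.symm

variable (p) in
lemma pullbackFiniteCocart_comp_nonempty_iso_id (φ : DiaHom S T) (ψ : DiaHom T S)
    (h : Zigzag (φ.comp ψ) (DiaHom.id S)) :
    Nonempty (pullbackFiniteCocart (p := p) ψ P ⋙ pullbackFiniteCocart φ P ≅ 𝟭 _) := by
  obtain ⟨e⟩ := pullbackFiniteCocart_comp_nonempty_iso p P φ ψ
  obtain ⟨e'⟩ := pullbackFiniteCocart_nonempty_iso_of_zigzag p P h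
  obtain ⟨e''⟩ := pullbackOn_id_nonempty_iso
    (fun M => pullback_isFiniteCocart (p := p) (DiaHom.id S) P M.obj M.property)
  exact ⟨e ≪≫ e' ≪≫ e''⟩

/-- Morphisms which are inverse to each other up to zig-zags of 2-morphisms are of descent. -/
lemma isOfFiniteDescent_of_zigzag (φ : DiaHom S T) (ψ : DiaHom T S)
    (h : Zigzag (φ.comp ψ) (DiaHom.id S)) (h' : Zigzag (ψ.comp φ) (DiaHom.id T)) :
    IsOfFiniteDescent p P φ ∧ IsOfFiniteDescent p P ψ := by
  obtain ⟨e⟩ := pullbackFiniteCocart_comp_nonempty_iso_id p P φ ψ h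
  obtain ⟨e'⟩ := pullbackFiniteCocart_comp_nonempty_iso_id p P ψ φ h'
  let E : (IsFiniteCocart p T P).FullSubcategory ≌ (IsFiniteCocart p S P).FullSubcategory :=
    CategoryTheory.Equivalence.mk (pullbackFiniteCocart φ P) (pullbackFiniteCocart ψ P) e'.symm e
  exact ⟨E.isEquivalence_functor, E.isEquivalence_inverse⟩

end Composition

end DiagramDescent

namespace DiagramDescent

open CategoryTheory.Functor DiaMod

/-! ### Descent over the one-point diagram -/

section Point

variable {𝒟 : Type u₁} [Category.{v₁} 𝒟] {𝒮 : Type u₂} [Category.{v₂} 𝒮] {p : 𝒟 ⥤ 𝒮}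
  {K : Type u₃} [Category.{v₃} K] {S : K ⥤ 𝒮} {X : 𝒮}

/-- The module over the one-point diagram given by an object over `X`. -/
def pointMod (a : 𝒟) (ha : p.obj a = X) :
    DiaMod p ((Functor.const (Discrete PUnit.{1})).obj X) where
  functor := (Functor.const _).obj a
  isHomLift _ := IsHomLift.id ha

lemma pointMod_isFiniteCocart {P : ObjectProperty 𝒟} {a : 𝒟} (ha : p.obj a = X) (h : P a) :
    IsFiniteCocart p _ P (pointMod a ha) :=
  ⟨fun _ _ _ => cocart_id ha, fun _ => h⟩

variable {φ : DiaHom S ((Functor.const (Discrete PUnit.{1})).obj X)}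

/-- A natural family of coCartesian morphisms `a ⟶ N_k` over the components `X ⟶ S_k` of a
morphism of diagrams to `(·, X)`. -/
structure CocartCone (φ : DiaHom S ((Functor.const (Discrete PUnit.{1})).obj X)) (a : 𝒟)
    (N : DiaMod p S) where
  app (k : K) : a ⟶ N.functor.obj k
  naturality {k l : K} (u : k ⟶ l) : app k ≫ N.functor.map u = app l
  cocart (k : K) : p.IsStronglyCocartesian (φ.app k) (app k)

/-- A coCartesian cone as a lifting. -/
def CocartCone.toLifting {a : 𝒟} {N : DiaMod p S} (c : CocartCone φ a N) (ha : p.obj a = X) :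
    Lifting φ (pointMod a ha) N where
  app := c.app
  naturality u := (Category.id_comp _).trans (c.naturality u).symm
  cocart := c.cocart

/-- A lifting from the one-point diagram as a coCartesian cone. -/
def CocartCone.ofLifting {M : DiaMod p ((Functor.const (Discrete PUnit.{1})).obj X)}
    {N : DiaMod p S} (l : Lifting φ M N) : CocartCone φ (M.functor.obj ⟨PUnit.unit⟩) N where
  -- The object `φ.functor.obj k` of the one-point category is identified with the chosen point by
  -- `eqToHom`, whose image under `M` is an isomorphism over the identity.
  app k := M.functor.map (eqToHom (Subsingleton.elim _ _)) ≫ l.app k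
  naturality {k k'} u := by
    rw [Category.assoc, ← l.naturality u, ← Category.assoc, ← M.functor.map_comp]
    congr 2
  cocart k := cocart_comp
    (cocart_of_isIso (M.isHomLift (eqToHom (Subsingleton.elim _ _))) inferInstance) (l.cocart k)
    (Category.id_comp _)

variable [IsOpfibered p] {P : ObjectProperty 𝒟} [IsPushforwardStable p P]

lemma IsOfFiniteDescent.existsUnique_of_cocartCone (h : IsOfFiniteDescent p P φ) {a b : 𝒟}
    (ha : p.obj a = X) (hb : p.obj b = X) (hPa : P a) (hPb : P b) {N N' : DiaMod p S}
    (c : CocartCone φ a N) (c' : CocartCone φ b N') (g : N ⟶ N') :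
    ∃! f : a ⟶ b, p.IsHomLift (𝟙 X) f ∧ ∀ k, c.app k ≫ homApp g k = f ≫ c'.app k := by
  obtain ⟨f, hf, hf'⟩ := ((isOfFiniteDescent_iff p P φ).1 h).existsUnique_hom
    (pointMod_isFiniteCocart ha hPa) (pointMod_isFiniteCocart hb hPb) (c.toLifting ha)
    (c'.toLifting hb) g
  refine ⟨homApp f ⟨PUnit.unit⟩, ⟨homApp_isHomLift f _, hf⟩, fun f₁ hf₁ => ?_⟩
  let F : pointMod (p := p) a ha ⟶ pointMod b hb := mkHom (fun _ => f₁) (fun _ => hf₁.1)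
    (fun _ => (Category.id_comp f₁).trans (Category.comp_id f₁).symm)
  exact congrArg (fun t : pointMod (p := p) a ha ⟶ pointMod b hb => homApp t ⟨PUnit.unit⟩)
    (hf' F hf₁.2)

lemma IsOfFiniteDescent.exists_cocartCone (h : IsOfFiniteDescent p P φ) {N : DiaMod p S}
    (hN : IsFiniteCocart p S P N) :
    ∃ a : 𝒟, p.obj a = X ∧ P a ∧ Nonempty (CocartCone φ a N) := by
  obtain ⟨M, hM, ⟨l⟩⟩ := ((isOfFiniteDescent_iff p P φ).1 h).exists_lifting hN
  exact ⟨_, M.proj_obj ⟨PUnit.unit⟩, hM.2 _, ⟨CocartCone.ofLifting l⟩⟩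

end Point

/-! ### Descent on the slices -/

section Slices

variable {𝒟 : Type u₁} [Category.{v₁} 𝒟] {𝒮 : Type u₂} [Category.{v₂} 𝒮] {p : 𝒟 ⥤ 𝒮}
  {I : Type u₃} [Category.{v₃} I] {J : Type u₄} [Category.{v₄} J]
  {S : I ⥤ 𝒮} {T : J ⥤ 𝒮}

/-- A natural family of coCartesian morphisms `a ⟶ N_i` over `T_j ⟶ T_{α(i)} ⟶ S_i`, indexed by
the objects `(i, ν : j ⟶ α(i))` of the slice category. -/
structure SliceCone (φ : DiaHom S T) (N : DiaMod p S) (j : J) (a : 𝒟) where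
  app (i : I) (ν : j ⟶ φ.functor.obj i) : a ⟶ N.functor.obj i
  naturality {i i' : I} (u : i ⟶ i') (ν : j ⟶ φ.functor.obj i) :
    app i ν ≫ N.functor.map u = app i' (ν ≫ φ.functor.map u)
  cocart (i : I) (ν : j ⟶ φ.functor.obj i) :
    p.IsStronglyCocartesian (T.map ν ≫ φ.app i) (app i ν)

/-- Descent on the slice at `j`, for the restrictions of modules on `(I, S)`. -/
structure HasSliceDescent (P : ObjectProperty 𝒟) (p : 𝒟 ⥤ 𝒮) (φ : DiaHom S T) (j : J) :
    Prop where
  existsUnique_hom {a b : 𝒟} (ha : p.obj a = T.obj j) (hb : p.obj b = T.obj j) (hPa : P a)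
    (hPb : P b) {N N' : DiaMod p S} (c : SliceCone φ N j a) (c' : SliceCone φ N' j b)
    (g : N ⟶ N') : ∃! f : a ⟶ b, p.IsHomLift (𝟙 (T.obj j)) f ∧
      ∀ i ν, c.app i ν ≫ homApp g i = f ≫ c'.app i ν
  exists_cone {N : DiaMod p S} (hN : IsFiniteCocart p S P N) :
    ∃ a : 𝒟, p.obj a = T.obj j ∧ P a ∧ Nonempty (SliceCone φ N j a)

variable {φ : DiaHom S T} {P : ObjectProperty 𝒟}

section

variable {j : J} {a : 𝒟} {N : DiaMod p S}

/-- A slice cone as a cone over the slice category. -/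
def SliceCone.toSlice (c : SliceCone φ N j a) :
    CocartCone (φ.slice j) a ((restrict p (StructuredArrow.proj j φ.functor) S).obj N) where
  app x := c.app x.right x.hom
  naturality {x y} u :=
    (c.naturality u.right x.hom).trans (by rw [StructuredArrow.w u])
  cocart x := c.cocart x.right x.hom

/-- A cone over the slice category as a slice cone. -/
def SliceCone.ofSlice
    (c : CocartCone (φ.slice j) a ((restrict p (StructuredArrow.proj j φ.functor) S).obj N)) :
    SliceCone φ N j a where
  app _ ν := c.app (StructuredArrow.mk ν)
  naturality u ν := c.naturality (StructuredArrow.homMk u rfl :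
    StructuredArrow.mk ν ⟶ StructuredArrow.mk (ν ≫ φ.functor.map u))
  cocart _ ν := c.cocart (StructuredArrow.mk ν)

lemma eqToHom_comp_map_of_fiber {x y : φ.functor.Fiber j} (u : x ⟶ y) :
    eqToHom x.2.symm ≫ φ.functor.map u.1 = eqToHom y.2.symm := by
  have := u.2
  rw [IsHomLift.fac' φ.functor (𝟙 j) u.1]
  simp

/-- The restriction of a slice cone to the fiber. -/
def SliceCone.toFiber (c : SliceCone φ N j a) :
    CocartCone (φ.fiber j) a
      ((restrict p (Fiber.fiberInclusion : φ.functor.Fiber j ⥤ I) S).obj N) where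
  app x := c.app x.1 (eqToHom x.2.symm)
  naturality {x y} u :=
    (c.naturality u.1 (eqToHom x.2.symm)).trans (by rw [eqToHom_comp_map_of_fiber])
  cocart x := c.cocart x.1 (eqToHom x.2.symm)

/-- A cartesian lift of `ν` refines the slice object `(i, ν)` by an object of the fiber; cones over
the fiber therefore control cones over the slice. -/
lemma exists_cartesian_of_slice [φ.functor.IsFibered] {i : I} (ν : j ⟶ φ.functor.obj i) :
    ∃ (x : φ.functor.Fiber j) (χ : x.1 ⟶ i), φ.functor.IsCartesian ν χ ∧
      eqToHom x.2.symm ≫ φ.functor.map χ = ν := by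
  obtain ⟨x, χ, hχ⟩ := IsPreFibered.exists_isCartesian φ.functor rfl ν
  refine ⟨⟨x, IsHomLift.domain_eq φ.functor ν χ⟩, χ, hχ, ?_⟩
  rw [IsHomLift.fac' φ.functor ν χ]
  simp

/-- For a Grothendieck fibration, cones over the fibers extend to slice cones. -/
lemma nonempty_sliceCone_of_fiber [φ.functor.IsFibered] (hN : IsCocart p S N)
    (c : CocartCone (φ.fiber j) a
      ((restrict p (Fiber.fiberInclusion : φ.functor.Fiber j ⥤ I) S).obj N)) :
    Nonempty (SliceCone φ N j a) := by
  choose x χ hχ hχ' using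
    fun (i : I) (ν : j ⟶ φ.functor.obj i) => exists_cartesian_of_slice ν
  let capp (x : φ.functor.Fiber j) : a ⟶ N.functor.obj x.1 := c.app x
  have ccocart (x : φ.functor.Fiber j) : p.IsStronglyCocartesian
    (T.map (eqToHom x.2.symm) ≫ φ.app x.1) (capp x) := c.cocart x
  refine ⟨⟨fun i ν => capp (x _ ν) ≫ N.functor.map (χ _ ν), fun {i i'} u ν => ?_, fun i ν => ?_⟩⟩
  · have h₁ := hχ _ (ν ≫ φ.functor.map u)
    have h₂ := hχ _ ν
    have h₃ : φ.functor.IsHomLift (ν ≫ φ.functor.map u) (χ _ ν ≫ u) := inferInstance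
    -- The chosen cartesian lifts need not be compatible with `u`. The arrow `v` of the fiber
    -- corrects this, and the given cone is natural along `v`.
    let v : x _ ν ⟶ x _ (ν ≫ φ.functor.map u) :=
      ⟨IsCartesian.map φ.functor (ν ≫ φ.functor.map u) (χ _ (ν ≫ φ.functor.map u)) (χ _ ν ≫ u),
        inferInstance⟩
    have hv : v.1 ≫ χ _ (ν ≫ φ.functor.map u) = χ _ ν ≫ u :=
      IsCartesian.fac φ.functor (ν ≫ φ.functor.map u) _ _
    have hc : capp (x _ ν) ≫ N.functor.map v.1 = capp (x _ (ν ≫ φ.functor.map u)) := c.naturality v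
    rw [Category.assoc, ← N.functor.map_comp, ← hv, N.functor.map_comp, ← Category.assoc, hc]
  · refine cocart_comp (ccocart (x _ ν)) (hN (χ _ ν)) ?_
    rw [Category.assoc, ← φ.naturality, ← Category.assoc, ← T.map_comp, hχ']

end

section

variable [IsOpfibered p] [IsPushforwardStable p P] {j : J}

lemma hasSliceDescent_of_slice (h : IsOfFiniteDescent p P (φ.slice j)) :
    HasSliceDescent P p φ j where
  existsUnique_hom {a b} ha hb hPa hPb {N N'} c c' g := by
    obtain ⟨f, ⟨hf, hf'⟩, huniq⟩ := h.existsUnique_of_cocartCone ha hb hPa hPb c.toSlice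
      c'.toSlice ((restrict p (StructuredArrow.proj j φ.functor) S).map g)
    exact ⟨f, ⟨hf, fun i ν => hf' (StructuredArrow.mk ν)⟩,
      fun f₁ hf₁ => huniq f₁ ⟨hf₁.1, fun x => hf₁.2 x.right x.hom⟩⟩
  exists_cone {N} hN := by
    obtain ⟨a, ha, hPa, ⟨c⟩⟩ := h.exists_cocartCone
      (N := (restrict p (StructuredArrow.proj j φ.functor) S).obj N)
      ⟨fun _ _ u => hN.1 u.right, fun x => hN.2 x.right⟩
    exact ⟨a, ha, hPa, ⟨SliceCone.ofSlice c⟩⟩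

/-- Compatibility at `(i, ν)` follows from compatibility at a fiber object mapping to it by a
cartesian arrow, because the components of a slice cone are natural. -/
lemma hasSliceDescent_of_fiber [φ.functor.IsFibered] (h : IsOfFiniteDescent p P (φ.fiber j)) :
    HasSliceDescent P p φ j where
  existsUnique_hom {a b} ha hb hPa hPb {N N'} c c' g := by
    obtain ⟨f, ⟨hf, hf'⟩, huniq⟩ := h.existsUnique_of_cocartCone ha hb hPa hPb c.toFiber
      c'.toFiber ((restrict p (Fiber.fiberInclusion : φ.functor.Fiber j ⥤ I) S).map g)
    refine ⟨f, ⟨hf, fun i ν => ?_⟩, fun f₁ hf₁ => huniq f₁ ⟨hf₁.1, fun x => hf₁.2 x.1 _⟩⟩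
    obtain ⟨x, χ, -, hχ⟩ := exists_cartesian_of_slice ν
    have hx : c.app x.1 (eqToHom x.2.symm) ≫ homApp g x.1 =
      f ≫ c'.app x.1 (eqToHom x.2.symm) := hf' x
    rw [← hχ, ← c.naturality, ← c'.naturality, Category.assoc, homApp_naturality,
      ← Category.assoc, hx, Category.assoc]
  exists_cone {N} hN := by
    obtain ⟨a, ha, hPa, ⟨c⟩⟩ := h.exists_cocartCone
      (N := (restrict p (Fiber.fiberInclusion : φ.functor.Fiber j ⥤ I) S).obj N)
      ⟨fun _ _ u => hN.1 u.1, fun x => hN.2 x.1⟩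
    exact ⟨a, ha, hPa, nonempty_sliceCone_of_fiber hN.1 c⟩

end

section

variable {j j' : J} {a b : 𝒟} {N N' : DiaMod p S}

/-- The push-forward of a slice cone along a morphism of `J`. -/
lemma SliceCone.exists_push (c : SliceCone φ N j a) (f : j ⟶ j') {lam : a ⟶ b}
    (hlam : p.IsStronglyCocartesian (T.map f) lam) :
    ∃ d : SliceCone φ N j' b, ∀ i ν, lam ≫ d.app i ν = c.app i (f ≫ ν) := by
  have w {i : I} (ν : j' ⟶ φ.functor.obj i) :
      T.map f ≫ T.map ν ≫ φ.app i = T.map (f ≫ ν) ≫ φ.app i := by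
    rw [T.map_comp, Category.assoc]
  choose d hd hd' using fun i (ν : j' ⟶ φ.functor.obj i) =>
    cocart_exists hlam (cocart_isHomLift (c.cocart i (f ≫ ν))) (w ν)
  refine ⟨⟨d, fun {i i'} u ν => ?_, fun i ν => ?_⟩, hd'⟩
  · refine cocart_ext hlam (isHomLift_comp (hd i ν) (N.isHomLift u) ?_)
      (hd i' (ν ≫ φ.functor.map u)) ?_
    · rw [T.map_comp, Category.assoc, Category.assoc, φ.naturality]
    · rw [← Category.assoc, hd', hd', c.naturality, Category.assoc]
  · exact cocart_of_comp hlam (c.cocart i (f ≫ ν)) (hd i ν) (w ν) (hd' i ν)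

variable [IsOpfibered p] [IsPushforwardStable p P]

/-- An arrow over `T(f)` factors through the coCartesian arrow `lam`, and the cone on `a` pushes
forward to its target. Descent at `j'` then determines the remaining vertical factor. -/
lemma HasSliceDescent.existsUnique_over (h : HasSliceDescent P p φ j') (ha : p.obj a = T.obj j)
    (hb : p.obj b = T.obj j') (hPa : P a) (hPb : P b) (c : SliceCone φ N j a)
    (c' : SliceCone φ N' j' b) (f : j ⟶ j') (g : N ⟶ N') :
    ∃! m : a ⟶ b, p.IsHomLift (T.map f) m ∧
      ∀ i ν, c.app i (f ≫ ν) ≫ homApp g i = m ≫ c'.app i ν := by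
  obtain ⟨a', lam, hlam⟩ := exists_cocartesian p ha (T.map f)
  obtain ⟨d, hd⟩ := c.exists_push f hlam
  obtain ⟨m, ⟨hm, hm'⟩, huniq⟩ := h.existsUnique_hom (IsHomLift.codomain_eq p (T.map f) lam) hb
    (IsPushforwardStable.prop_of_cocartesian (p := p) (T.map f) lam hPa) hPb d c' g
  refine ⟨lam ≫ m, ⟨isHomLift_comp (cocart_isHomLift hlam) hm (Category.comp_id _),
    fun i ν => ?_⟩, fun m₁ hm₁ => ?_⟩
  · rw [← hd, Category.assoc, hm', Category.assoc]
  · obtain ⟨m₂, hm₂, hm₂'⟩ := cocart_exists hlam hm₁.1 (Category.comp_id _)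
    rw [← hm₂']
    congr 1
    refine huniq m₂ ⟨hm₂, fun i ν => cocart_ext hlam
      (isHomLift_comp (cocart_isHomLift (d.cocart i ν)) (homApp_isHomLift g i)
        (Category.comp_id _))
      (isHomLift_comp hm₂ (cocart_isHomLift (c'.cocart i ν)) (Category.id_comp _)) ?_⟩
    rw [← Category.assoc, hd, hm₁.2, ← Category.assoc, hm₂']

/-- The pushed-forward cone and the cone on `b` both lie over the slice at `j'` and have the same
module `N` as target. Descent gives vertical arrows both ways, inverse to each other by uniqueness,
so `lam` followed by an isomorphism remains coCartesian. -/
lemma HasSliceDescent.exists_cocart (h : HasSliceDescent P p φ j') (ha : p.obj a = T.obj j)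
    (hb : p.obj b = T.obj j') (hPa : P a) (hPb : P b) (c : SliceCone φ N j a)
    (c' : SliceCone φ N j' b) (f : j ⟶ j') :
    ∃ m : a ⟶ b, p.IsStronglyCocartesian (T.map f) m ∧
      ∀ i ν, c.app i (f ≫ ν) = m ≫ c'.app i ν := by
  obtain ⟨a', lam, hlam⟩ := exists_cocartesian p ha (T.map f)
  obtain ⟨d, hd⟩ := c.exists_push f hlam
  have ha' : p.obj a' = T.obj j' := IsHomLift.codomain_eq p (T.map f) lam
  have hPa' : P a' := IsPushforwardStable.prop_of_cocartesian (p := p) (T.map f) lam hPa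
  obtain ⟨m, ⟨hm, hm'⟩, -⟩ := h.existsUnique_hom ha' hb hPa' hPb d c' (𝟙 N)
  obtain ⟨n, ⟨hn, hn'⟩, -⟩ := h.existsUnique_hom hb ha' hPb hPa' c' d (𝟙 N)
  simp only [homApp_id, Category.comp_id] at hm' hn'
  have h₁ : m ≫ n = 𝟙 a' := (h.existsUnique_hom ha' ha' hPa' hPa' d d (𝟙 N)).unique
    ⟨isHomLift_comp hm hn (Category.comp_id _), fun i ν => by
      rw [Category.assoc, ← hn', ← hm', homApp_id, Category.comp_id]⟩
    ⟨IsHomLift.id ha', fun i ν => by simp⟩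
  have h₂ : n ≫ m = 𝟙 b := (h.existsUnique_hom hb hb hPb hPb c' c' (𝟙 N)).unique
    ⟨isHomLift_comp hn hm (Category.comp_id _), fun i ν => by
      rw [Category.assoc, ← hm', ← hn', homApp_id, Category.comp_id]⟩
    ⟨IsHomLift.id hb, fun i ν => by simp⟩
  refine ⟨lam ≫ m, cocart_comp hlam (cocart_of_isIso hm ⟨n, h₁, h₂⟩) (Category.comp_id _),
    fun i ν => ?_⟩
  rw [Category.assoc, ← hm', hd]

end

variable [IsOpfibered p] [IsPushforwardStable p P]

/-- The cone given by a lifting on the slice at `j`. -/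
def Lifting.sliceCone {M : DiaMod p T} {N : DiaMod p S} (l : Lifting φ M N)
    (hM : IsCocart p T M) (j : J) : SliceCone φ N j (M.functor.obj j) where
  app i ν := M.functor.map ν ≫ l.app i
  naturality u ν := by
    rw [Category.assoc, ← l.naturality, ← Category.assoc, ← M.functor.map_comp]
  cocart i ν := cocart_comp (hM ν) (l.cocart i) rfl

/-- Descent on all the slices implies descent. -/
lemma isOfFiniteDescent_of_hasSliceDescent (h : ∀ j, HasSliceDescent P p φ j) :
    IsOfFiniteDescent p P φ := by
  rw [isOfFiniteDescent_iff]
  refine ⟨fun M M' hM hM' N N' l l' g => ?_, fun N hN => ?_⟩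
  · choose m hm huniq using fun j => (h j).existsUnique_hom (M.proj_obj j) (M'.proj_obj j)
      (hM.2 j) (hM'.2 j) (l.sliceCone hM.1 j) (l'.sliceCone hM'.1 j) g
    -- Both composites lie over `T(f)` and are compatible with the cones at `j` and `j'`, so
    -- uniqueness over `f` identifies them.
    have hnat {j j' : J} (f : j ⟶ j') :
        M.functor.map f ≫ m j' = m j ≫ M'.functor.map f := by
      refine ((h j').existsUnique_over (M.proj_obj j) (M'.proj_obj j') (hM.2 j) (hM'.2 j')
        (l.sliceCone hM.1 j) (l'.sliceCone hM'.1 j') f g).unique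
        ⟨isHomLift_comp (M.isHomLift f) (hm j').1 (Category.comp_id _), fun i ν => ?_⟩
        ⟨isHomLift_comp (hm j).1 (M'.isHomLift f) (Category.id_comp _), fun i ν => ?_⟩
      · rw [Category.assoc, ← (hm j').2]
        simp [Lifting.sliceCone]
      · rw [(hm j).2]
        simp [Lifting.sliceCone]
    refine ⟨mkHom m (fun j => (hm j).1) hnat, fun i => ?_, fun f hf => hom_ext_app fun j => ?_⟩
    · simpa [Lifting.sliceCone] using (hm (φ.functor.obj i)).2 i (𝟙 _)
    · refine huniq j (homApp f j) ⟨homApp_isHomLift f j, fun i ν => ?_⟩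
      simp only [Lifting.sliceCone]
      rw [Category.assoc, hf, ← Category.assoc, homApp_naturality, Category.assoc]
  · choose a ha hPa c using fun j => (h j).exists_cone hN
    choose m hm hm' using fun j j' (f : j ⟶ j') => (h j').exists_cocart (ha j) (ha j') (hPa j)
      (hPa j') (c j).some (c j').some f
    -- The objects `a j` were chosen independently; uniqueness of cone-compatible arrows is what
    -- yields the identity and composition laws.
    have huniq {j j' : J} (f : j ⟶ j') {m₁ m₂ : a j ⟶ a j'} (h₁ : p.IsHomLift (T.map f) m₁)
        (h₂ : p.IsHomLift (T.map f) m₂)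
        (e₁ : ∀ i ν, (c j).some.app i (f ≫ ν) = m₁ ≫ (c j').some.app i ν)
        (e₂ : ∀ i ν, (c j).some.app i (f ≫ ν) = m₂ ≫ (c j').some.app i ν) : m₁ = m₂ :=
      ((h j').existsUnique_over (ha j) (ha j') (hPa j) (hPa j') (c j).some (c j').some f
        (𝟙 N)).unique ⟨h₁, by simpa using e₁⟩ ⟨h₂, by simpa using e₂⟩
    let M : DiaMod p T :=
      { functor :=
          { obj := a
            map := fun {j j'} f => m j j' f
            map_id := fun j => huniq (𝟙 j) (cocart_isHomLift (hm j j (𝟙 j)))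
              (by rw [T.map_id]; exact IsHomLift.id (ha j)) (hm' j j (𝟙 j)) (by simp)
            map_comp := fun {j j' j''} f g => huniq (f ≫ g) (cocart_isHomLift (hm _ _ _))
              (isHomLift_comp (cocart_isHomLift (hm _ _ f)) (cocart_isHomLift (hm _ _ g))
                (T.map_comp f g).symm) (hm' _ _ _) (fun i ν => by
                  rw [Category.assoc, Category.assoc, ← hm', ← hm']) }
        isHomLift := fun f => cocart_isHomLift (hm _ _ f) }
    -- The lifting is read off from the cones at the slice objects `(i, 𝟙)` over `α(i)`.
    refine ⟨M, ⟨fun j j' f => hm j j' f, hPa⟩,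
      ⟨⟨fun i => (c (φ.functor.obj i)).some.app i (𝟙 _), fun {i i'} u => ?_, fun i => ?_⟩⟩⟩
    · change m _ _ (φ.functor.map u) ≫ (c (φ.functor.obj i')).some.app i' (𝟙 _) =
        (c (φ.functor.obj i)).some.app i (𝟙 _) ≫ N.functor.map u
      rw [← hm', SliceCone.naturality, Category.id_comp, Category.comp_id]
    · simpa using (c (φ.functor.obj i)).some.cocart i (𝟙 _)

end Slices

end DiagramDescent

namespace DiagramDescent

open CategoryTheory.Functor DiaMod

/-! ### Descent for constant diagrams -/

section Constant

variable {𝒟 : Type u₁} [Category.{v₁} 𝒟] {𝒮 : Type u₂} [Category.{v₂} 𝒮] {p : 𝒟 ⥤ 𝒮}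
  {K : Type u₃} [Category.{v₃} K] {X : 𝒮} [IsOpfibered p] {P : ObjectProperty 𝒟}
  [IsPushforwardStable p P]

/-- The constant module. -/
def constMod (K : Type u₃) [Category.{v₃} K] (a : 𝒟) (ha : p.obj a = X) :
    DiaMod p ((Functor.const K).obj X) where
  functor := (Functor.const K).obj a
  isHomLift _ := IsHomLift.id ha

/-- The identity cone of a constant module. -/
def constCone (K : Type u₃) [Category.{v₃} K] (a : 𝒟) (ha : p.obj a = X) :
    CocartCone (DiaHom.constToPoint K X) a (constMod (p := p) K a ha) where
  app _ := 𝟙 a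
  naturality _ := Category.id_comp _
  cocart _ := cocart_id ha

/-- A family of vertical arrows `a ⟶ b` that is constant along the arrows of `K` is a morphism of
constant modules, and descent replaces it by one arrow. -/
lemma IsOfFiniteDescent.existsUnique_of_const
    (h : IsOfFiniteDescent p P (DiaHom.constToPoint K X)) {a b : 𝒟} (ha : p.obj a = X)
    (hb : p.obj b = X) (hPa : P a) (hPb : P b) (t : K → (a ⟶ b))
    (ht : ∀ k, p.IsHomLift (𝟙 X) (t k)) (htn : ∀ {k l : K} (_ : k ⟶ l), t k = t l) :
    ∃! f : a ⟶ b, p.IsHomLift (𝟙 X) f ∧ ∀ k, t k = f := by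
  let g : constMod (p := p) K a ha ⟶ constMod K b hb := mkHom t ht
    (fun u => (Category.id_comp _).trans ((htn u).symm.trans (Category.comp_id _).symm))
  obtain ⟨f, ⟨hf, hf'⟩, huniq⟩ := h.existsUnique_of_cocartCone ha hb hPa hPb
    (constCone K a ha) (constCone K b hb) g
  exact ⟨f, ⟨hf, fun k => (Category.id_comp _).symm.trans ((hf' k).trans (Category.comp_id _))⟩,
    fun f₁ hf₁ => huniq f₁ ⟨hf₁.1, fun k =>
      (Category.id_comp _).trans ((hf₁.2 k).trans (Category.comp_id _).symm)⟩⟩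

/-- For nonempty `K` this is immediate from a single component. The argument by descending the
inverses is needed because `K` may be empty, where descent alone forces the conclusion. -/
lemma IsOfFiniteDescent.isIso_of_const
    (h : IsOfFiniteDescent p P (DiaHom.constToPoint K X)) {a b : 𝒟} (ha : p.obj a = X)
    (hb : p.obj b = X) (hPa : P a) (hPb : P b) (t : K → (a ⟶ b))
    (ht : ∀ k, p.IsHomLift (𝟙 X) (t k)) (htn : ∀ {k l : K} (_ : k ⟶ l), t k = t l)
    (hti : ∀ k, IsIso (t k)) {f : a ⟶ b} (hf : p.IsHomLift (𝟙 X) f) (hf' : ∀ k, t k = f) :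
    IsIso f := by
  obtain ⟨f', ⟨hf₁, hf₂⟩, -⟩ := h.existsUnique_of_const hb ha hPb hPa (fun k => inv (t k))
    (fun k => isHomLift_inv (ht k)) (fun u => by simp [htn u])
  refine ⟨f', (h.existsUnique_of_const ha ha hPa hPa (fun _ => 𝟙 a) (fun _ => IsHomLift.id ha)
    (fun _ => rfl)).unique ⟨isHomLift_comp hf hf₁ (Category.comp_id _), fun k => ?_⟩
    ⟨IsHomLift.id ha, fun _ => rfl⟩, (h.existsUnique_of_const hb hb hPb hPb (fun _ => 𝟙 b)
    (fun _ => IsHomLift.id hb) (fun _ => rfl)).unique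
    ⟨isHomLift_comp hf₁ hf (Category.comp_id _), fun k => ?_⟩ ⟨IsHomLift.id hb, fun _ => rfl⟩⟩
  · rw [← hf₂ k, ← hf' k, IsIso.hom_inv_id]
  · rw [← hf₂ k, ← hf' k, IsIso.inv_hom_id]

end Constant

/-! ### Morphisms of pure diagram type -/

section Pure

variable {𝒟 : Type u₁} [Category.{v₁} 𝒟] {𝒮 : Type u₂} [Category.{v₂} 𝒮] {p : 𝒟 ⥤ 𝒮}
  {I : Type u₃} [Category.{v₃} I] {J : Type u₄} [Category.{v₄} J] {α : I ⥤ J} {S : J ⥤ 𝒮}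

/-- A natural family of morphisms `N_i ⟶ a` over `S(ν ≫ f)`, indexed by the objects
`(i, ν : α(i) ⟶ j)` of the coslice category. -/
structure Cocone (N : DiaMod p (α ⋙ S)) {j j' : J} (f : j ⟶ j') (a : 𝒟) where
  app (i : I) (ν : α.obj i ⟶ j) : N.functor.obj i ⟶ a
  naturality {i i' : I} (u : i ⟶ i') (ν : α.obj i' ⟶ j) :
    N.functor.map u ≫ app i' ν = app i (α.map u ≫ ν)
  isHomLift (i : I) (ν : α.obj i ⟶ j) : p.IsHomLift (S.map (ν ≫ f)) (app i ν)

/-- A cocone all of whose components are coCartesian. -/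
def Cocone.IsCocart {N : DiaMod p (α ⋙ S)} {j j' : J} {f : j ⟶ j'} {a : 𝒟}
    (c : Cocone N f a) : Prop :=
  ∀ (i : I) (ν : α.obj i ⟶ j), p.IsStronglyCocartesian (S.map (ν ≫ f)) (c.app i ν)

/-- The restriction of a cocone along `f : j ⟶ j'`. -/
def Cocone.precomp {N : DiaMod p (α ⋙ S)} {j j' : J} {a : 𝒟}
    (c : Cocone N (𝟙 j') a) (f : j ⟶ j') : Cocone N f a where
  app i ν := c.app i (ν ≫ f)
  naturality u ν := by rw [c.naturality, Category.assoc]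
  isHomLift i ν := by simpa using c.isHomLift i (ν ≫ f)

lemma Cocone.precomp_isCocart {N : DiaMod p (α ⋙ S)} {j j' : J} {a : 𝒟}
    {c : Cocone N (𝟙 j') a} (hc : c.IsCocart) (f : j ⟶ j') : (c.precomp f).IsCocart :=
  fun i ν => by simpa [Cocone.precomp] using hc i (ν ≫ f)

/-- The components of a lifting of a morphism of pure diagram type, as isomorphisms. -/
lemma Lifting.exists_pure_iso {M : DiaMod p S} {N : DiaMod p (α ⋙ S)}
    (l : Lifting (DiaHom.pure α S) M N) :
    ∃ e : ∀ i, M.functor.obj (α.obj i) ≅ N.functor.obj i, (∀ i, (e i).hom = l.app i) ∧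
      (∀ i, p.IsStronglyCocartesian (𝟙 (S.obj (α.obj i))) (e i).inv) ∧
      ∀ {i i' : I} (u : i ⟶ i'),
        N.functor.map u ≫ (e i').inv = (e i).inv ≫ M.functor.map (α.map u) := by
  let m (i : I) : M.functor.obj (α.obj i) ⟶ N.functor.obj i := l.app i
  have hm (i : I) : IsIso (m i) := isIso_of_cocart_id (l.cocart i) rfl
  have hml (i : I) : p.IsHomLift (𝟙 (S.obj (α.obj i))) (m i) := cocart_isHomLift (l.cocart i)
  refine ⟨fun i => asIso (m i), fun _ => rfl, fun i => cocart_of_isIso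
    (isHomLift_inv (hml i)) inferInstance, fun {i i'} u => ?_⟩
  rw [Iso.comp_inv_eq, Category.assoc, Iso.eq_inv_comp]
  exact (l.naturality u).symm

/-- The cocone given by a morphism to a module of the form `α^* M`. -/
lemma exists_cocone_of_lifting {M : DiaMod p S} {N N' : DiaMod p (α ⋙ S)}
    {r : ∀ i, N.functor.obj i ⟶ M.functor.obj (α.obj i)}
    (hr : ∀ i, p.IsStronglyCocartesian (𝟙 (S.obj (α.obj i))) (r i))
    (hrn : ∀ {i i' : I} (u : i ⟶ i'), N.functor.map u ≫ r i' = r i ≫ M.functor.map (α.map u))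
    (g : N' ⟶ N) (j : J) :
    ∃ c : Cocone N' (𝟙 j) (M.functor.obj j),
      ∀ i ν, c.app i ν = homApp g i ≫ r i ≫ M.functor.map ν := by
  refine ⟨⟨fun i ν => homApp g i ≫ r i ≫ M.functor.map ν, fun {i i'} u ν => ?_,
    fun i ν => ?_⟩, fun _ _ => rfl⟩
  · rw [← Category.assoc, homApp_naturality, Category.assoc, ← Category.assoc (N.functor.map u),
      hrn, M.functor.map_comp, Category.assoc]
  · rw [Category.comp_id]
    exact isHomLift_comp (homApp_isHomLift g i) (isHomLift_comp (cocart_isHomLift (hr i))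
      (M.isHomLift ν) (Category.id_comp _)) (Category.id_comp _)

variable [IsOpfibered p] {P : ObjectProperty 𝒟} [IsPushforwardStable p P]

section

variable {N : DiaMod p (α ⋙ S)} {j j' : J} {a b : 𝒟}

/-- After push-forward of `a` along `f` the legs of `c` become coCartesian over `S(ν ≫ f)`, so each
leg of `d` factors through a vertical arrow over `S_{j'}`. These arrows are constant along the
coslice at `j`, and descent for the constant diagram with value `S_{j'}` glues them. This is the
origin of the mixed pairs of indices. -/
lemma Cocone.existsUnique_hom
    (h : IsOfFiniteDescent p P (DiaHom.constToPoint (CostructuredArrow α j) (S.obj j')))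
    (ha : p.obj a = S.obj j) (hb : p.obj b = S.obj j') (hPa : P a) (hPb : P b)
    (c : Cocone N (𝟙 j) a) (hc : c.IsCocart) (f : j ⟶ j') (d : Cocone N f b) :
    ∃! m : a ⟶ b, p.IsHomLift (S.map f) m ∧
      ∀ i ν, c.app i ν ≫ m = d.app i ν := by
  obtain ⟨a', lam, hlam⟩ := exists_cocartesian p ha (S.map f)
  have hcl (i : I) (ν : α.obj i ⟶ j) :
      p.IsStronglyCocartesian (S.map (ν ≫ f)) (c.app i ν ≫ lam) :=
    cocart_comp (hc i ν) hlam (by rw [← S.map_comp, Category.comp_id])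
  choose t ht ht' using fun i (ν : α.obj i ⟶ j) =>
    cocart_exists (g := 𝟙 _) (hcl i ν) (d.isHomLift i ν) (Category.comp_id _)
  have htn {i i' : I} (u : i ⟶ i') (ν : α.obj i' ⟶ j) : t i (α.map u ≫ ν) = t i' ν := by
    refine cocart_ext (hcl i (α.map u ≫ ν)) (ht _ _) (ht _ _) ?_
    rw [ht', ← c.naturality, ← d.naturality, Category.assoc, Category.assoc,
      ← Category.assoc (c.app i' ν), ht']
  obtain ⟨m, ⟨hm, hm'⟩, huniq⟩ := h.existsUnique_of_const
    (IsHomLift.codomain_eq p (S.map f) lam) hb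
    (IsPushforwardStable.prop_of_cocartesian (p := p) (S.map f) lam hPa) hPb
    (fun x => t x.left x.hom) (fun x => ht x.left x.hom)
    (fun {x y} u => by rw [← CostructuredArrow.w u, htn])
  refine ⟨lam ≫ m, ⟨isHomLift_comp (cocart_isHomLift hlam) hm (Category.comp_id _),
    fun i ν => ?_⟩, fun m₁ hm₁ => ?_⟩
  · rw [← hm' (CostructuredArrow.mk ν), ← Category.assoc]
    exact ht' i ν
  · obtain ⟨m₂, hm₂, hm₂'⟩ := cocart_exists hlam hm₁.1 (Category.comp_id _)
    rw [← hm₂']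
    congr 1
    refine huniq m₂ ⟨hm₂, fun x => cocart_ext (hcl x.left x.hom) (ht _ _) hm₂ ?_⟩
    rw [ht', Category.assoc, hm₂', hm₁.2]

/-- The vertical factor of the induced arrow is a comparison of coCartesian legs, hence invertible
at every coslice object; `isIso_of_const` covers an empty coslice as well. -/
lemma Cocone.exists_cocart_hom
    (h : IsOfFiniteDescent p P (DiaHom.constToPoint (CostructuredArrow α j) (S.obj j')))
    (ha : p.obj a = S.obj j) (hb : p.obj b = S.obj j') (hPa : P a) (hPb : P b)
    (c : Cocone N (𝟙 j) a) (hc : c.IsCocart) (f : j ⟶ j') (d : Cocone N f b)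
    (hd : d.IsCocart) :
    ∃ m : a ⟶ b, p.IsStronglyCocartesian (S.map f) m ∧ ∀ i ν, c.app i ν ≫ m = d.app i ν := by
  obtain ⟨m, ⟨hm, hm'⟩, -⟩ := c.existsUnique_hom h ha hb hPa hPb hc f d
  refine ⟨m, ?_, hm'⟩
  obtain ⟨a', lam, hlam⟩ := exists_cocartesian p ha (S.map f)
  obtain ⟨n, hn, rfl⟩ := cocart_exists (g := 𝟙 _) hlam hm (Category.comp_id _)
  have hti (i : I) (ν : α.obj i ⟶ j) : IsIso n := by
    refine isIso_of_cocart_of_cocart (φ := c.app i ν ≫ lam) (cocart_comp (hc i ν) hlam ?_)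
      (hd i ν) hn (by rw [Category.assoc, hm'])
    rw [← S.map_comp, Category.comp_id]
  exact cocart_comp hlam (cocart_of_isIso hn (h.isIso_of_const
    (IsHomLift.codomain_eq p (S.map f) lam) hb
    (IsPushforwardStable.prop_of_cocartesian (p := p) (S.map f) lam hPa) hPb (fun _ => n)
    (fun _ => hn) (fun _ => rfl) (fun x => hti x.left x.hom) hn (fun _ => rfl)))
    (Category.comp_id _)

variable (α S j) in
/-- The morphism `(I ×_{/J} j, S_j) ⟶ (I, α^* S)`, given by `S(ν)` at `(i, ν)`. -/
def cosliceHom : DiaHom ((Functor.const (CostructuredArrow α j)).obj (S.obj j)) (α ⋙ S) where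
  functor := CostructuredArrow.proj α j
  trans :=
    { app := fun x => S.map x.hom
      naturality := fun x y u => by
        change S.map (α.map u.left) ≫ S.map y.hom = S.map x.hom ≫ 𝟙 _
        rw [← S.map_comp, CostructuredArrow.w, Category.comp_id] }

/-- Pulling `N` back to the coslice gives a coCartesian module over a constant diagram, which
descends to an object `a`. The resulting cone points from `a` to the module, but its legs lie over
identities, so they can be inverted to form a cocone. -/
lemma exists_cocone
    (h : IsOfFiniteDescent p P (DiaHom.constToPoint (CostructuredArrow α j) (S.obj j)))
    (hN : IsFiniteCocart p (α ⋙ S) P N) :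
    ∃ a : 𝒟, p.obj a = S.obj j ∧ P a ∧ ∃ c : Cocone N (𝟙 j) a, c.IsCocart := by
  obtain ⟨a, ha, hPa, ⟨c⟩⟩ := h.exists_cocartCone
    (pullback_isFiniteCocart (cosliceHom α S j) P N hN)
  let l := pullbackLifting (cosliceHom α S j) N
  have hc (x : CostructuredArrow α j) : IsIso (c.app x) := isIso_of_cocart_id (c.cocart x) rfl
  have hl (x : CostructuredArrow α j) :
      p.IsStronglyCocartesian (S.map (x.hom ≫ 𝟙 j)) (l.app x ≫ inv (c.app x)) := by
    rw [Category.comp_id]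
    exact cocart_comp (g := 𝟙 _) (l.cocart x)
      (cocart_of_isIso (isHomLift_inv (cocart_isHomLift (c.cocart x))) inferInstance)
      (Category.comp_id _)
  refine ⟨a, ha, hPa, ⟨fun i ν => l.app (CostructuredArrow.mk ν) ≫
    inv (c.app (CostructuredArrow.mk ν)), fun {i i'} u ν => ?_,
    fun i ν => cocart_isHomLift (hl (CostructuredArrow.mk ν))⟩,
    fun i ν => hl (CostructuredArrow.mk ν)⟩
  let v : CostructuredArrow.mk (α.map u ≫ ν) ⟶ CostructuredArrow.mk ν :=
    CostructuredArrow.homMk u rfl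
  let E := (pullback (cosliceHom α S j)).obj N
  let lam {i : I} (ν : α.obj i ⟶ j) : N.functor.obj i ⟶ E.functor.obj (.mk ν) := l.app (.mk ν)
  change N.functor.map u ≫ lam ν ≫ inv (c.app (.mk ν)) =
    lam (α.map u ≫ ν) ≫ inv (c.app (.mk (α.map u ≫ ν)))
  have h₁ : N.functor.map u ≫ lam ν = lam (α.map u ≫ ν) ≫ E.functor.map v := l.naturality v
  rw [← Category.assoc, h₁, IsIso.comp_inv_eq, Category.assoc]
  congr 1
  rw [IsIso.eq_inv_comp]
  exact c.naturality v

end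

/-- A functor all of whose coslices are of descent, for constant diagrams, is of descent. -/
lemma isOfFiniteDescent_pure (h : ∀ j k : J,
    IsOfFiniteDescent p P (DiaHom.constToPoint (CostructuredArrow α j) (S.obj k))) :
    IsOfFiniteDescent p P (DiaHom.pure α S) := by
  rw [isOfFiniteDescent_iff]
  refine ⟨fun M M' hM hM' N N' l l' g => ?_, fun N hN => ?_⟩
  · obtain ⟨e, he, hr, hrn⟩ := l.exists_pure_iso
    obtain ⟨e', he', hr', hrn'⟩ := l'.exists_pure_iso
    choose c hc using exists_cocone_of_lifting hr hrn (𝟙 N)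
    choose d hd using exists_cocone_of_lifting hr' hrn' g
    simp only [homApp_id, Category.id_comp] at hc
    have hcc (j) : (c j).IsCocart := fun i ν => by
      rw [hc, Category.comp_id]
      exact cocart_comp (hr i) (hM.1 ν) (Category.id_comp _)
    have key (j) := (c j).existsUnique_hom (h j j) (M.proj_obj j) (M'.proj_obj j) (hM.2 j)
      (hM'.2 j) (hcc j) (𝟙 j) (d j)
    simp only [S.map_id] at key
    choose m hm huniq using key
    -- Both composites extend the cocone `d j'` restricted along `f`; their equality uses descent
    -- for the coslice at `j` with value `S_{j'}`.
    have hnat {j j' : J} (f : j ⟶ j') :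
        M.functor.map f ≫ m j' = m j ≫ M'.functor.map f := by
      refine ((c j).existsUnique_hom (h j j') (M.proj_obj j) (M'.proj_obj j') (hM.2 j)
        (hM'.2 j') (hcc j) f ((d j').precomp f)).unique
        ⟨isHomLift_comp (M.isHomLift f) (hm j').1 (Category.comp_id _), fun i ν => ?_⟩
        ⟨isHomLift_comp (hm j).1 (M'.isHomLift f) (Category.id_comp _), fun i ν => ?_⟩
      · rw [← Category.assoc, hc, Category.assoc, Category.assoc,
          ← Category.assoc (M.functor.map ν),
          ← M.functor.map_comp, ← Category.assoc, ← hc, (hm j').2]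
        rfl
      · rw [← Category.assoc, (hm j).2, hd]
        simp [Cocone.precomp, hd]
    have hlr (f : M ⟶ M') (i : I) : (l.app i ≫ homApp g i =
        homApp f ((DiaHom.pure α S).functor.obj i) ≫ l'.app i) ↔
          (e i).inv ≫ homApp f (α.obj i) = homApp g i ≫ (e' i).inv := by
      rw [← he, ← he', Iso.inv_comp_eq, ← Category.assoc, Iso.eq_comp_inv]
      exact eq_comm
    refine ⟨mkHom m (fun j => (hm j).1) hnat, fun i => ?_, fun f hf => hom_ext_app fun j => ?_⟩
    · have h₁ := (hm (α.obj i)).2 i (𝟙 _)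
      rw [hc, hd, M.functor.map_id, M'.functor.map_id, Category.comp_id, Category.comp_id] at h₁
      exact (hlr _ i).2 h₁
    · refine huniq j (homApp f j) ⟨homApp_isHomLift f j, fun i ν => ?_⟩
      rw [hc, hd, Category.assoc, homApp_naturality, ← Category.assoc, (hlr f i).1 (hf i),
        Category.assoc]
  · choose a ha hPa c hc using fun j => exists_cocone (h j j) hN
    choose m hm hm' using fun j j' (f : j ⟶ j') => (c j).exists_cocart_hom (h j j') (ha j) (ha j')
      (hPa j) (hPa j') (hc j) f ((c j').precomp f) (Cocone.precomp_isCocart (hc j') f)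
    have huniq {j j' : J} (f : j ⟶ j') {m₁ m₂ : a j ⟶ a j'} (h₁ : p.IsHomLift (S.map f) m₁)
        (h₂ : p.IsHomLift (S.map f) m₂)
        (e₁ : ∀ i ν, (c j).app i ν ≫ m₁ = (c j').app i (ν ≫ f))
        (e₂ : ∀ i ν, (c j).app i ν ≫ m₂ = (c j').app i (ν ≫ f)) : m₁ = m₂ :=
      ((c j).existsUnique_hom (h j j') (ha j) (ha j') (hPa j) (hPa j') (hc j) f
        ((c j').precomp f)).unique ⟨h₁, e₁⟩ ⟨h₂, e₂⟩
    let M : DiaMod p S :=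
      { functor :=
          { obj := a
            map := fun {j j'} f => m j j' f
            map_id := fun j => huniq (𝟙 j) (cocart_isHomLift (hm j j (𝟙 j)))
              (by rw [S.map_id]; exact IsHomLift.id (ha j)) (hm' j j (𝟙 j)) (by simp)
            map_comp := fun {j j' j''} f g => huniq (f ≫ g) (cocart_isHomLift (hm _ _ _))
              (isHomLift_comp (cocart_isHomLift (hm _ _ f)) (cocart_isHomLift (hm _ _ g))
                (S.map_comp f g).symm) (hm' _ _ _) (fun i ν => by
                  rw [← Category.assoc, hm']
                  simp [Cocone.precomp, hm']) }
        isHomLift := fun f => cocart_isHomLift (hm _ _ f) }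
    have hci (i : I) : p.IsStronglyCocartesian (𝟙 (S.obj (α.obj i)))
        ((c (α.obj i)).app i (𝟙 _)) := by simpa using hc (α.obj i) i (𝟙 _)
    -- At `(i, 𝟙)` the cocone lies over an identity, so its leg `N_i ⟶ a (α i)` is invertible, and
    -- the inverse points in the direction required of a lifting.
    have hiso (i : I) : IsIso ((c (α.obj i)).app i (𝟙 _)) := isIso_of_cocart_id (hci i) rfl
    have hinv (i : I) : p.IsStronglyCocartesian (𝟙 (S.obj (α.obj i)))
        (inv ((c (α.obj i)).app i (𝟙 _))) :=
      cocart_of_isIso (isHomLift_inv (cocart_isHomLift (hci i))) inferInstance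
    let n (i : I) : a (α.obj i) ⟶ N.functor.obj i := inv ((c (α.obj i)).app i (𝟙 _))
    refine ⟨M, ⟨fun j j' f => hm j j' f, hPa⟩,
      ⟨⟨n, fun {i i'} u => ?_, hinv⟩⟩⟩
    change m _ _ (α.map u) ≫ inv ((c (α.obj i')).app i' (𝟙 _)) =
      inv ((c (α.obj i)).app i (𝟙 _)) ≫ N.functor.map u
    rw [IsIso.comp_inv_eq, Category.assoc, IsIso.eq_inv_comp, hm', (c (α.obj i')).naturality]
    simp [Cocone.precomp]

end Pure

end DiagramDescent

namespace DiagramDescent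

open CategoryTheory.Functor DiaMod

/-! ### Contractible index categories -/

section Contractible

variable {𝒟 : Type u₁} [Category.{v₁} 𝒟] {𝒮 : Type u₂} [Category.{v₂} 𝒮] {p : 𝒟 ⥤ 𝒮}
  {I : Type u₃} [Category.{v₃} I] {J : Type u₄} [Category.{v₄} J] {S : I ⥤ 𝒮} {T : J ⥤ 𝒮}
  [IsOpfibered p] {P : ObjectProperty 𝒟} [IsPushforwardStable p P]

lemma IsOfFiniteDescent.of_zigzag {φ ψ : DiaHom S T} (h : IsOfFiniteDescent p P φ)
    (z : Zigzag φ ψ) : IsOfFiniteDescent p P ψ := by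
  obtain ⟨e⟩ := pullbackFiniteCocart_nonempty_iso_of_zigzag p P z
  have : (pullbackFiniteCocart (p := p) φ P).IsEquivalence := h
  exact isEquivalence_of_iso e

/-- A natural transformation of functors induces a 2-morphism of constant diagrams. -/
def DiaHom.constFunctor (I : Type u₃) [Category.{v₃} I] (J : Type u₄) [Category.{v₄} J]
    (X : 𝒮) : (I ⥤ J) ⥤ DiaHom ((Functor.const I).obj X) ((Functor.const J).obj X) where
  obj α := DiaHom.const α X
  map κ := ⟨κ, by ext; exact Category.id_comp _⟩
  map_id _ := rfl
  map_comp _ _ := rfl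

/-- If the identity of `I` is connected to a constant functor by a zig-zag of natural
transformations, then `(I, X) ⟶ (·, X)` is of descent. -/
lemma isOfFiniteDescent_constToPoint_of_zigzag (i₀ : I)
    (h : Zigzag (𝟭 I) ((Functor.const I).obj i₀)) (X : 𝒮) :
    IsOfFiniteDescent p P (DiaHom.constToPoint I X) := by
  let ψ := DiaHom.const ((Functor.const (Discrete PUnit.{1})).obj i₀) X
  refine (isOfFiniteDescent_of_zigzag P (DiaHom.constToPoint I X) ψ ?_ ?_).1
  · have h₁ := zigzag_obj_of_zigzag (DiaHom.constFunctor I I X) h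
    -- The 2-morphisms `κ` and `κ'` have identity components; they only reconcile two presentations
    -- of the same morphism of diagrams.
    have κ : (DiaHom.constFunctor I I X).obj ((Functor.const I).obj i₀) ⟶
        (DiaHom.constToPoint I X).comp ψ :=
      ⟨{ app := fun _ => 𝟙 i₀ }, by
        ext i
        exact (Category.id_comp _).trans (Category.id_comp _)⟩
    have κ' : DiaHom.id ((Functor.const I).obj X) ⟶ (DiaHom.constFunctor I I X).obj (𝟭 I) :=
      ⟨𝟙 _, by
        ext i
        exact (Category.id_comp _)⟩
    exact ((Zigzag.of_hom κ').trans (h₁.trans (Zigzag.of_hom κ))).symm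
  · refine Zigzag.of_hom (?_ : ψ.comp (DiaHom.constToPoint I X) ⟶ DiaHom.id _)
    exact ⟨{ app := fun _ => eqToHom (Subsingleton.elim _ _) }, by
      ext i
      exact (Category.id_comp (𝟙 X)).trans (Category.id_comp (𝟙 X)).symm⟩

end Contractible

/-! ### The free groupoid -/

section FreeGroupoid

variable {𝒟 : Type u₁} [Category.{v₁} 𝒟] {𝒮 : Type u₂} [Category.{v₂} 𝒮] {p : 𝒟 ⥤ 𝒮}
  {I : Type u₃} [Category.{v₃} I] {X : 𝒮}

/-- A coCartesian arrow over an identity is invertible. Hence coCartesian modules over a constant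
diagram see only the groupoid generated by `I`. -/
lemma isIso_map_of_isCocart_const {N : DiaMod p ((Functor.const I).obj X)}
    (hN : IsCocart p _ N) {i j : I} (u : i ⟶ j) : IsIso (N.functor.map u) :=
  isIso_of_cocart_id (hN u) rfl

/-- A coCartesian module over a constant diagram as a functor to the groupoid of isomorphisms of
the fiber. -/
def toCoreFiber (N : DiaMod p ((Functor.const I).obj X)) (hN : IsCocart p _ N) :
    I ⥤ Core (p.Fiber X) where
  obj i := ⟨⟨N.functor.obj i, N.proj_obj i⟩⟩
  map u :=
    haveI := isIso_map_of_isCocart_const hN u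
    ⟨{  hom := ⟨N.functor.map u, N.isHomLift u⟩
        inv := ⟨inv (N.functor.map u), isHomLift_inv (N.isHomLift u)⟩
        hom_inv_id := Subtype.ext (IsIso.hom_inv_id (N.functor.map u))
        inv_hom_id := Subtype.ext (IsIso.inv_hom_id (N.functor.map u)) }⟩
  map_id i := CoreHom.ext (Iso.ext (Subtype.ext (N.functor.map_id i)))
  map_comp u v := CoreHom.ext (Iso.ext (Subtype.ext (N.functor.map_comp u v)))

/-- The extension of a coCartesian module over a constant diagram to the free groupoid. -/
def extendToFreeGroupoid (N : DiaMod p ((Functor.const I).obj X)) (hN : IsCocart p _ N) :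
    DiaMod p ((Functor.const (FreeGroupoid I)).obj X) where
  functor := FreeGroupoid.lift (toCoreFiber N hN) ⋙ Core.inclusion _ ⋙ Fiber.fiberInclusion
  isHomLift u := ((Core.inclusion _).map ((FreeGroupoid.lift (toCoreFiber N hN)).map u)).2

lemma extendToFreeGroupoid_map (N : DiaMod p ((Functor.const I).obj X)) (hN : IsCocart p _ N)
    {i j : I} (u : i ⟶ j) :
    (extendToFreeGroupoid N hN).functor.map ((FreeGroupoid.of I).map u) = N.functor.map u := by
  change Fiber.fiberInclusion.map ((Core.inclusion _).map
    ((FreeGroupoid.lift (toCoreFiber N hN)).map (FreeGroupoid.homMk u))) = _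
  rw [FreeGroupoid.lift_map_homMk]
  rfl

variable [IsOpfibered p] {P : ObjectProperty 𝒟} [IsPushforwardStable p P]

/-- For constant diagrams, the universal functor to a groupoid is of descent. -/
lemma isOfFiniteDescent_freeGroupoid (I : Type u₃) [Category.{v₃} I] (X : 𝒮) :
    IsOfFiniteDescent p P (DiaHom.const (FreeGroupoid.of I) X) := by
  rw [isOfFiniteDescent_iff]
  refine ⟨fun M M' hM hM' N N' l l' g => ?_, fun N hN => ?_⟩
  · let m (i : I) : M.functor.obj ((FreeGroupoid.of I).obj i) ⟶ N.functor.obj i := l.app i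
    let m' (i : I) : M'.functor.obj ((FreeGroupoid.of I).obj i) ⟶ N'.functor.obj i := l'.app i
    have hmc (i : I) : p.IsStronglyCocartesian (𝟙 X) (m' i) := l'.cocart i
    have hm' (i : I) : IsIso (m' i) := isIso_of_cocart_id (l'.cocart i) rfl
    have hmn {i j : I} (u : i ⟶ j) : M.functor.map ((FreeGroupoid.of I).map u) ≫ m j =
      m i ≫ N.functor.map u := l.naturality u
    have hmn' {i j : I} (u : i ⟶ j) : M'.functor.map ((FreeGroupoid.of I).map u) ≫ m' j =
      m' i ≫ N'.functor.map u := l'.naturality u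
    let t : FreeGroupoid.of I ⋙ M.functor ⟶ FreeGroupoid.of I ⋙ M'.functor :=
      { app := fun i => m i ≫ homApp g i ≫ inv (m' i)
        naturality := fun i j u => by
          change M.functor.map ((FreeGroupoid.of I).map u) ≫ m j ≫ homApp g j ≫ inv (m' j) =
            (m i ≫ homApp g i ≫ inv (m' i)) ≫ M'.functor.map ((FreeGroupoid.of I).map u)
          rw [← Category.assoc, hmn, Category.assoc, ← Category.assoc (N.functor.map u),
            homApp_naturality, Category.assoc, Category.assoc, Category.assoc]
          congr 2
          rw [IsIso.comp_inv_eq, Category.assoc, IsIso.eq_inv_comp, hmn'] }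
    let W : MorphismProperty I := ⊤
    -- `FreeGroupoid.of I` is the localization at all morphisms, so restriction along it is fully
    -- faithful; this gives existence and uniqueness of the extension of `t` at once.
    have hff : ((whiskeringLeft I (FreeGroupoid I) 𝒟).obj (FreeGroupoid.of I)).FullyFaithful :=
      Localization.fullyFaithfulWhiskeringLeft (FreeGroupoid.of I) W 𝒟
    have hτ (i : I) : (hff.preimage t).app ((FreeGroupoid.of I).obj i) = t.app i :=
      NatTrans.congr_app (hff.map_preimage t) i
    have ht (i : I) : p.IsHomLift (𝟙 X) (t.app i) :=
      isHomLift_comp (cocart_isHomLift (l.cocart i)) (isHomLift_comp (homApp_isHomLift g i)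
        (isHomLift_inv (cocart_isHomLift (hmc i))) (Category.id_comp _)) (Category.id_comp _)
    refine ⟨⟨hff.preimage t, fun x => ?_⟩, fun i => ?_, fun f hf => hom_ext_app fun x => ?_⟩
    · obtain ⟨i, rfl⟩ := FreeGroupoid.of_obj_bijective.surjective x
      rw [hτ]
      exact ht i
    · change m i ≫ homApp g i = (hff.preimage t).app ((FreeGroupoid.of I).obj i) ≫ m' i
      rw [hτ]
      simp [t]
    · obtain ⟨i, rfl⟩ := FreeGroupoid.of_obj_bijective.surjective x
      have hfi : m i ≫ homApp g i = homApp f ((FreeGroupoid.of I).obj i) ≫ m' i := hf i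
      refine Eq.trans ?_ (hτ i).symm
      change homApp f ((FreeGroupoid.of I).obj i) = m i ≫ homApp g i ≫ inv (m' i)
      rw [← Category.assoc, IsIso.eq_comp_inv, hfi]
  -- The extension restricts to `N` with identity comparison maps, and it is coCartesian because
  -- functors send all arrows of a groupoid to isomorphisms.
  · refine ⟨extendToFreeGroupoid N hN.1, ⟨fun x y u => cocart_of_isIso
      ((extendToFreeGroupoid N hN.1).isHomLift u) inferInstance, fun x => hN.2 x.as.as⟩,
      ⟨⟨fun i => 𝟙 (N.functor.obj i), fun {i j} u => ?_, fun i => cocart_id (N.proj_obj i)⟩⟩⟩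
    exact (Category.comp_id _).trans ((extendToFreeGroupoid_map N hN.1 u).trans
      (Category.id_comp _).symm)

end FreeGroupoid

/-! ### The fundamental groupoid -/

section FundamentalGroupoid

lemma nonempty_hom_of_zigzag {G : Type u₁} [Groupoid.{v₁} G] {x y : G} (h : Zigzag x y) :
    Nonempty (x ⟶ y) := by
  induction h with
  | refl => exact ⟨𝟙 _⟩
  | tail _ h ih =>
    obtain ⟨f⟩ := ih
    rcases h with ⟨⟨g⟩⟩ | ⟨⟨g⟩⟩
    · exact ⟨f ≫ g⟩
    · exact ⟨f ≫ Groupoid.inv g⟩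

/-- A groupoid is equivalent to the disjoint union of the vertex groups at representatives of
its connected components. -/
lemma nonempty_equivalence_sigma_singleObj {G : Type u₁} [Groupoid.{v₁} G] {Ω : Type u₂}
    (x : Ω → G) (hx : ∀ y : G, ∃ ω, Nonempty (x ω ⟶ y))
    (hx' : ∀ ω ω', (x ω ⟶ x ω') → ω = ω') :
    Nonempty (G ≌ Σ ω : Ω, SingleObj (x ω ⟶ x ω)) := by
  let F : (Σ ω : Ω, SingleObj (x ω ⟶ x ω)) ⥤ G := Sigma.desc fun ω =>
    { obj := fun _ => x ω
      -- Composition in `SingleObj` is multiplication in the opposite order, so inversion makes the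
      -- assignment covariant.
      map := fun g => Groupoid.inv (show x ω ⟶ x ω from g)
      map_id := fun _ => by
        change Groupoid.inv (𝟙 (x ω)) = _
        simp
      map_comp := fun f g => by
        change Groupoid.inv ((show x ω ⟶ x ω from g) ≫ (show x ω ⟶ x ω from f)) = _
        simp }
  have hF : F.Full := ⟨by
    rintro ⟨ω, _⟩ ⟨ω', _⟩ f
    obtain rfl := hx' ω ω' f
    refine ⟨Sigma.SigmaHom.mk (Groupoid.inv (show x ω ⟶ x ω from f)), ?_⟩
    have h (g : x ω ⟶ x ω) : Groupoid.inv (Groupoid.inv g) = g := by simp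
    exact h f⟩
  have hF' : F.Faithful := ⟨by
    rintro ⟨ω, _⟩ ⟨ω', _⟩ ⟨f⟩ ⟨g⟩ h
    congr 1
    have h' (f g : x ω ⟶ x ω) (h : Groupoid.inv f = Groupoid.inv g) : f = g := by
      simpa using congrArg Groupoid.inv h
    exact h' f g h⟩
  have hF'' : F.EssSurj := ⟨fun y => by
    obtain ⟨ω, ⟨f⟩⟩ := hx y
    exact ⟨⟨ω, SingleObj.star _⟩, ⟨(Groupoid.isoEquivHom _ _).symm f⟩⟩⟩
  have : F.IsEquivalence := { }
  exact ⟨F.asEquivalence.symm⟩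

variable (I : Type u₃) [Category.{v₃} I]

variable {I} in
/-- The class in the fundamental groupoid of the edge of the nerve given by a morphism. -/
def edgePathOfHom {i j : I} (f : i ⟶ j) :
    EdgePathGroupoid.mk (X := nerve I) (nerveEquiv.symm i) ⟶
      EdgePathGroupoid.mk (X := nerve I) (nerveEquiv.symm j) :=
  (CategoryTheory.Quotient.functor (edgePathRel (nerve I))).map
    ((Quiver.FreeGroupoid.of (EdgeQuiver (nerve I))).map
      (show (⟨nerveEquiv.symm i⟩ : EdgeQuiver (nerve I)) ⟶ ⟨nerveEquiv.symm j⟩ from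
        nerve.edgeMk f))

variable {I} in
-- A composable pair is a 2-simplex of the nerve, and the triangle relation for it is the claim.
lemma edgePathOfHom_comp {i j k : I} (f : i ⟶ j) (g : j ⟶ k) :
    edgePathOfHom (f ≫ g) = edgePathOfHom f ≫ edgePathOfHom g := by
  obtain ⟨h⟩ := (nerve.nonempty_compStruct_iff f g (f ≫ g)).2 rfl
  refine Eq.trans ?_ (Functor.map_comp _ _ _)
  exact (CategoryTheory.Quotient.sound _ (edgePathRel.triangle (X := nerve I)
    (x := ⟨nerveEquiv.symm i⟩) (y := ⟨nerveEquiv.symm j⟩) (z := ⟨nerveEquiv.symm k⟩)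
    (nerve.edgeMk f) (nerve.edgeMk g) (nerve.edgeMk (f ≫ g)) h)).symm

/-- The canonical functor from a category to the fundamental groupoid of its nerve. -/
def toEdgePathGroupoid : I ⥤ EdgePathGroupoid (nerve I) where
  obj i := EdgePathGroupoid.mk (nerveEquiv.symm i)
  map f := edgePathOfHom f
  map_id i := by
    -- No relation mentions degenerate edges explicitly: the class of `𝟙 i` is idempotent, hence an
    -- identity by cancellation in a groupoid.
    have h := edgePathOfHom_comp (𝟙 i) (𝟙 i)
    rw [Category.comp_id] at h
    exact ((cancel_epi (edgePathOfHom (𝟙 i))).1 ((Category.comp_id _).trans h)).symm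
  map_comp f g := edgePathOfHom_comp f g

/-- The prefunctor sending an edge of the nerve of `I` to the corresponding morphism. -/
def edgePrefunctor : EdgeQuiver (nerve I) ⥤q FreeGroupoid I where
  obj x := (FreeGroupoid.of I).obj (nerveEquiv x.vertex)
  map e := (FreeGroupoid.of I).map (nerve.homEquiv e)

lemma lift_edgePrefunctor_map {x y : EdgeQuiver (nerve I)} (e : x ⟶ y) :
    (Quiver.FreeGroupoid.lift (edgePrefunctor I)).map
      ((Quiver.FreeGroupoid.of (EdgeQuiver (nerve I))).map e) =
        (FreeGroupoid.of I).map (nerve.homEquiv e) := by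
  simpa using! Prefunctor.congr_hom (Quiver.FreeGroupoid.lift_spec (edgePrefunctor I)) e

/-- The functor from the fundamental groupoid of the nerve of `I` to the free groupoid. -/
def ofEdgePathGroupoid : EdgePathGroupoid (nerve I) ⥤ FreeGroupoid I :=
  CategoryTheory.Quotient.lift _ (Quiver.FreeGroupoid.lift (edgePrefunctor I)) (by
    rintro _ _ _ _ ⟨e₀₁, e₁₂, e₀₂, h⟩
    rw [Functor.map_comp, lift_edgePrefunctor_map, lift_edgePrefunctor_map,
      lift_edgePrefunctor_map]
    exact ((FreeGroupoid.of I).map_comp _ _).symm.trans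
      (congrArg (FreeGroupoid.of I).map (nerve.homEquiv_comp h)))

lemma ofEdgePathGroupoid_map {i j : I} (f : i ⟶ j) :
    (ofEdgePathGroupoid I).map (edgePathOfHom f) = (FreeGroupoid.of I).map f :=
  (lift_edgePrefunctor_map I _).trans
    (congrArg (FreeGroupoid.of I).map (nerve.homEquiv_edgeMk f))

/-- A functor out of the free groupoid is determined by its restriction along `FreeGroupoid.of I`,
where the composite is visibly the inclusion. -/
lemma lift_comp_ofEdgePathGroupoid :
    FreeGroupoid.lift (toEdgePathGroupoid I) ⋙ ofEdgePathGroupoid I = 𝟭 _ := by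
  have h : FreeGroupoid.of I ⋙ FreeGroupoid.lift (toEdgePathGroupoid I) ⋙ ofEdgePathGroupoid I =
      FreeGroupoid.of I := by
    refine CategoryTheory.Functor.ext (fun _ => rfl) fun i j f => ?_
    have h₁ : (ofEdgePathGroupoid I).map ((FreeGroupoid.lift (toEdgePathGroupoid I)).map
        (FreeGroupoid.homMk f)) = (FreeGroupoid.of I).map f := by
      rw [FreeGroupoid.lift_map_homMk]
      exact ofEdgePathGroupoid_map I f
    simpa using! h₁
  rw [FreeGroupoid.lift_unique _ _ h, FreeGroupoid.lift_unique (FreeGroupoid.of I) (𝟭 _) rfl]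

/-- Uniqueness for the quotient and then for the free groupoid on a quiver reduces the claim to
single edges, and every edge of the nerve comes from a morphism. -/
lemma ofEdgePathGroupoid_comp_lift :
    ofEdgePathGroupoid I ⋙ FreeGroupoid.lift (toEdgePathGroupoid I) = 𝟭 _ := by
  apply CategoryTheory.Quotient.lift_unique'
  refine (Quiver.FreeGroupoid.lift_unique
    (Quiver.FreeGroupoid.of _ ⋙q (CategoryTheory.Quotient.functor _).toPrefunctor) _ ?_).trans
    (Quiver.FreeGroupoid.lift_unique _ _ rfl).symm
  refine Prefunctor.ext ?_ ?_
  · rintro ⟨x⟩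
    obtain ⟨i, rfl⟩ := nerveEquiv.symm.surjective x
    rfl
  · rintro ⟨x⟩ ⟨y⟩ e
    obtain ⟨i, rfl⟩ := nerveEquiv.symm.surjective x
    obtain ⟨j, rfl⟩ := nerveEquiv.symm.surjective y
    obtain ⟨f, rfl⟩ := nerve.edgeMk_surjective e
    have h₁ : (FreeGroupoid.lift (toEdgePathGroupoid I)).map
        ((ofEdgePathGroupoid I).map (edgePathOfHom f)) = edgePathOfHom f := by
      rw [ofEdgePathGroupoid_map]
      exact FreeGroupoid.lift_map_homMk (toEdgePathGroupoid I) f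
    exact h₁

/-- The free groupoid of a category is the fundamental groupoid of its nerve. -/
def freeGroupoidEquivalence : FreeGroupoid I ≌ EdgePathGroupoid (nerve I) :=
  CategoryTheory.Equivalence.mk (FreeGroupoid.lift (toEdgePathGroupoid I)) (ofEdgePathGroupoid I)
    (eqToIso (lift_comp_ofEdgePathGroupoid I).symm) (eqToIso (ofEdgePathGroupoid_comp_lift I))

/-- The free groupoid is the disjoint union of the fundamental groups. -/
lemma freeGroupoid_nonempty_equivalence_sigma (b : CategoryTheory.ConnectedComponents I → I)
    (hb : ∀ ξ, CategoryTheory.ConnectedComponents.mk (b ξ) = ξ) :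
    Nonempty (FreeGroupoid I ≌
      Σ ξ : CategoryTheory.ConnectedComponents I, SingleObj (PiOne I (b ξ))) := by
  have h₁ (y : EdgePathGroupoid (nerve I)) :
      ∃ ξ, Nonempty ((toEdgePathGroupoid I).obj (b ξ) ⟶ y) := by
    obtain ⟨i, hi⟩ := nerveEquiv.symm.surjective y.as.as.vertex
    have hy : y = (toEdgePathGroupoid I).obj i :=
      congrArg (EdgePathGroupoid.mk (X := nerve I)) hi.symm
    have z : Zigzag (b (.mk i)) i := Quotient.exact (hb (.mk i))
    have z' := zigzag_obj_of_zigzag (toEdgePathGroupoid I) z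
    rw [← hy] at z'
    exact ⟨_, nonempty_hom_of_zigzag z'⟩
  have h₂ (ξ ξ' : CategoryTheory.ConnectedComponents I)
      (f : (toEdgePathGroupoid I).obj (b ξ) ⟶ (toEdgePathGroupoid I).obj (b ξ')) : ξ = ξ' := by
    let g : (FreeGroupoid.of I).obj (b ξ) ⟶ (FreeGroupoid.of I).obj (b ξ') :=
      (ofEdgePathGroupoid I).map f
    -- Connected components form a discrete category receiving `I`, hence the free groupoid; an
    -- arrow between base points forces their components to agree.
    let q : FreeGroupoid I ⥤ Discrete (CategoryTheory.ConnectedComponents I) :=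
      FreeGroupoid.lift (ConnectedComponents.functorToDiscrete _ id)
    rw [← hb ξ, ← hb ξ']
    exact Discrete.eq_of_hom (q.map g)
  obtain ⟨e⟩ := nonempty_equivalence_sigma_singleObj _ h₁ h₂
  exact ⟨(freeGroupoidEquivalence I).trans e⟩

/-- A category with one connected component and trivial fundamental groups has trivial free
groupoid. -/
lemma subsingleton_hom_freeGroupoid (h : ∀ i : I, Subsingleton (PiOne I i))
    (x y : FreeGroupoid I) : Subsingleton (x ⟶ y) := by
  refine ⟨fun f g => ?_⟩
  let B := (freeGroupoidEquivalence I).functor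
  -- Two parallel arrows differ by a loop, whose image lies in a trivial fundamental group;
  -- faithfulness of `B` then gives `f = g`.
  have h₁ : B.map (f ≫ Groupoid.inv g) = B.map (𝟙 x) := by
    obtain ⟨i, rfl⟩ := FreeGroupoid.of_obj_bijective.surjective x
    exact (h i).elim _ _
  have h₂ : f ≫ Groupoid.inv g = 𝟙 x := B.map_injective h₁
  rw [Groupoid.inv_eq_inv, IsIso.comp_inv_eq, Category.id_comp] at h₂
  exact h₂

variable {𝒟 : Type u₁} [Category.{v₁} 𝒟] {𝒮 : Type u₂} [Category.{v₂} 𝒮] {p : 𝒟 ⥤ 𝒮}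
  [IsOpfibered p] {P : ObjectProperty 𝒟} [IsPushforwardStable p P]

/-- Constant diagrams over a connected and simply connected category are of descent. -/
lemma isOfFiniteDescent_constToPoint_of_simplyConnected
    (h : Nonempty (Unique (CategoryTheory.ConnectedComponents I)))
    (h' : ∀ i : I, Subsingleton (PiOne I i)) (X : 𝒮) :
    IsOfFiniteDescent p P (DiaHom.constToPoint I X) := by
  obtain ⟨u⟩ := h
  obtain ⟨i₀, -⟩ := Quotient.exists_rep (default : CategoryTheory.ConnectedComponents I)
  have hsub := subsingleton_hom_freeGroupoid I h'
  have hne (x : FreeGroupoid I) : Nonempty (x ⟶ (FreeGroupoid.of I).obj i₀) := by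
    obtain ⟨i, rfl⟩ := FreeGroupoid.of_obj_bijective.surjective x
    exact nonempty_hom_of_zigzag (zigzag_obj_of_zigzag (FreeGroupoid.of I)
      (Quotient.exact (u.instSubsingleton.elim (CategoryTheory.ConnectedComponents.mk i)
        (CategoryTheory.ConnectedComponents.mk i₀))))
  -- Every object maps to the base point and hom-sets have at most one element, so arbitrary choices
  -- of arrows are natural and contract the groupoid.
  have κ : 𝟭 (FreeGroupoid I) ⟶ (Functor.const (FreeGroupoid I)).obj ((FreeGroupoid.of I).obj i₀) :=
    { app := fun x => (hne x).some
      naturality := fun x y f => (hsub _ _).elim _ _ }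
  have h₁ : IsOfFiniteDescent p P (DiaHom.constToPoint (FreeGroupoid I) X) :=
    isOfFiniteDescent_constToPoint_of_zigzag _ (Zigzag.of_hom κ) X
  refine ((isOfFiniteDescent_freeGroupoid I X).comp h₁).of_zigzag (Zigzag.of_hom ?_)
  exact ⟨𝟙 _, by
    ext i
    exact (Category.id_comp (𝟙 X)).trans (Category.id_comp (𝟙 X)).symm⟩

end FundamentalGroupoid

end DiagramDescent

namespace DiagramDescent

open CategoryTheory.Functor DiaMod

/-! ### Vertices and edges in the semisimplex category -/

section SemiSimplex

open SemiSimplexCategory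

/-- The morphism `[0] ⟶ [n]` with image `k`. -/
def vertex (n : SemiSimplexCategory) (k : Fin (n.len + 1)) : (⦋0⦌ₛ : SemiSimplexCategory) ⟶ n :=
  homEquiv.symm (OrderEmbedding.ofStrictMono (fun _ => k) (fun a b h => by
    have ha : a.val < 1 := a.isLt
    have hb : b.val < 1 := b.isLt
    have hab : a.val < b.val := h
    omega))

lemma homEquiv_vertex (n : SemiSimplexCategory) (k : Fin (n.len + 1)) (i) :
    homEquiv (vertex n k) i = k := rfl

lemma homEquiv_comp_apply {n m l : SemiSimplexCategory} (f : n ⟶ m) (g : m ⟶ l)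
    (k : Fin (n.len + 1)) : homEquiv (f ≫ g) k = homEquiv g (homEquiv f k) := by
  rw [homEquiv_comp, RelEmbedding.trans_apply]

lemma vertex_comp {n m : SemiSimplexCategory} (k : Fin (n.len + 1)) (f : n ⟶ m) :
    vertex n k ≫ f = vertex m (homEquiv f k) := rfl

lemma hom_ext_vertex {n m : SemiSimplexCategory} {f g : n ⟶ m}
    (h : ∀ k, homEquiv f k = homEquiv g k) : f = g :=
  hom_ext (RelEmbedding.ext h)

lemma hom_zero_eq_vertex {n : SemiSimplexCategory} (f : (⦋0⦌ₛ : SemiSimplexCategory) ⟶ n) :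
    f = vertex n (homEquiv f 0) :=
  hom_ext_vertex fun k => by
    rw [homEquiv_vertex, show k = 0 from Subsingleton.elim (α := Fin 1) _ _]

lemma vertex_zero : vertex ⦋0⦌ₛ 0 = 𝟙 _ := (hom_zero_eq_vertex (𝟙 ⦋0⦌ₛ)).symm

/-- The morphism `[1] ⟶ [n]` with image `{a, b}`, for `a < b`. -/
def edge (n : SemiSimplexCategory) {a b : Fin (n.len + 1)} (h : a < b) :
    (⦋1⦌ₛ : SemiSimplexCategory) ⟶ n :=
  homEquiv.symm (OrderEmbedding.ofStrictMono (fun i : Fin 2 => ![a, b] i) (by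
    rw [Fin.strictMono_iff_lt_succ]
    intro i
    obtain rfl : i = 0 := Subsingleton.elim _ _
    exact h))

lemma homEquiv_edge_zero {n : SemiSimplexCategory} {a b : Fin (n.len + 1)} (h : a < b) :
    homEquiv (edge n h) (0 : Fin 2) = a := rfl

lemma homEquiv_edge_one {n : SemiSimplexCategory} {a b : Fin (n.len + 1)} (h : a < b) :
    homEquiv (edge n h) (1 : Fin 2) = b := rfl

lemma edge_comp {n m : SemiSimplexCategory} {a b : Fin (n.len + 1)} (h : a < b) (f : n ⟶ m)
    (h' : homEquiv f a < homEquiv f b) : edge n h ≫ f = edge m h' := by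
  refine hom_ext_vertex fun (k : Fin 2) => ?_
  fin_cases k
  · exact (homEquiv_comp_apply (edge n h) f (0 : Fin 2)).trans
      ((congrArg (homEquiv f) (homEquiv_edge_zero h)).trans (homEquiv_edge_zero h').symm)
  · exact (homEquiv_comp_apply (edge n h) f (1 : Fin 2)).trans
      ((congrArg (homEquiv f) (homEquiv_edge_one h)).trans (homEquiv_edge_one h').symm)

lemma edge_one (h : (0 : Fin (⦋1⦌ₛ.len + 1)) < 1) : edge ⦋1⦌ₛ h = 𝟙 _ := by
  refine hom_ext_vertex fun (k : Fin 2) => ?_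
  fin_cases k
  · exact homEquiv_edge_zero h
  · exact homEquiv_edge_one h

/-- The index is the omitted vertex: `coface 0 1` selects the smaller endpoint of an edge and
`coface 0 0` the larger one. -/
lemma coface_one_comp_edge {n : SemiSimplexCategory} {a b : Fin (n.len + 1)} (h : a < b) :
    coface 0 1 ≫ edge n h = vertex n a :=
  hom_zero_eq_vertex _

lemma coface_zero_comp_edge {n : SemiSimplexCategory} {a b : Fin (n.len + 1)} (h : a < b) :
    coface 0 0 ≫ edge n h = vertex n b :=
  hom_zero_eq_vertex _

/-- The morphism `[2] ⟶ [n]` with image `{a, b, c}`, for `a < b < c`. -/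
def triangle (n : SemiSimplexCategory) {a b c : Fin (n.len + 1)} (h : a < b) (h' : b < c) :
    (⦋2⦌ₛ : SemiSimplexCategory) ⟶ n :=
  homEquiv.symm (OrderEmbedding.ofStrictMono (fun i : Fin 3 => ![a, b, c] i) (by
    rw [Fin.strictMono_iff_lt_succ]
    intro i
    fin_cases i
    · exact h
    · exact h'))

lemma coface_one_zero_comp_triangle {n : SemiSimplexCategory} {a b c : Fin (n.len + 1)}
    (h : a < b) (h' : b < c) : coface 1 0 ≫ triangle n h h' = edge n h' := by
  refine hom_ext_vertex fun (k : Fin 2) => ?_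
  fin_cases k <;> rfl

lemma coface_one_one_comp_triangle {n : SemiSimplexCategory} {a b c : Fin (n.len + 1)}
    (h : a < b) (h' : b < c) : coface 1 1 ≫ triangle n h h' = edge n (h.trans h') := by
  refine hom_ext_vertex fun (k : Fin 2) => ?_
  fin_cases k <;> rfl

lemma coface_one_two_comp_triangle {n : SemiSimplexCategory} {a b c : Fin (n.len + 1)}
    (h : a < b) (h' : b < c) : coface 1 2 ≫ triangle n h h' = edge n h := by
  refine hom_ext_vertex fun (k : Fin 2) => ?_
  fin_cases k <;> rfl

end SemiSimplex

/-! ### Structure morphisms and push-forward of morphisms -/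

section PushHom

/-- This diagram chase is stated in a bare category because it is applied to fiber morphisms viewed
in `𝒟`, which match its form only after unfolding. -/
lemma comp_eq_of_comp_iso {C : Type u₁} [Category.{v₁} C] {x y z t : C} {g : x ⟶ y} {c : y ⟶ z}
    {b : x ⟶ z} {d : y ⟶ t} {u : z ⟶ t} {v : t ⟶ z} (h₁ : g ≫ c = b) (h₂ : b ≫ u = g ≫ d)
    (h₃ : u ≫ v = 𝟙 z) : g ≫ c = g ≫ d ≫ v := by
  rw [← Category.assoc, ← h₂, Category.assoc, h₃, Category.comp_id, h₁]

lemma paste_squares {C : Type u₁} [Category.{v₁} C] {x y z x' y' z' t : C} {a : x ⟶ x'}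
    {f : x' ⟶ y'} {u : x ⟶ y} {d : y ⟶ y'} {g : y' ⟶ z'} {ρ : y ⟶ z} {e : z ⟶ z'}
    (h₁ : a ≫ f = u ≫ d) (h₂ : d ≫ g = ρ ≫ e) (v : z' ⟶ t) :
    a ≫ f ≫ g ≫ v = u ≫ ρ ≫ e ≫ v := by
  rw [← Category.assoc, h₁, Category.assoc, ← Category.assoc d, h₂, Category.assoc]

lemma paste_triangle {C : Type u₁} [Category.{v₁} C] {x y x' y' z : C} {a : x ⟶ x'}
    {f : x' ⟶ y'} {u : x ⟶ y} {d : y ⟶ y'} {g : y' ⟶ z} {e : y ⟶ z}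
    (h₁ : a ≫ f = u ≫ d) (h₂ : d ≫ g = e) : a ≫ f ≫ g = u ≫ e := by
  rw [← Category.assoc, h₁, Category.assoc, h₂]

variable {𝒟 : Type u₁} [Category.{v₁} 𝒟] {𝒮 : Type u₂} [Category.{v₂} 𝒮] {p : 𝒟 ⥤ 𝒮}

lemma isIso_fiber {R : 𝒮} {a b : p.Fiber R} (φ : a ⟶ b) (h : IsIso φ.1) : IsIso φ :=
  ⟨⟨inv φ.1, isHomLift_inv φ.2⟩, Subtype.ext (IsIso.hom_inv_id φ.1),
    Subtype.ext (IsIso.inv_hom_id φ.1)⟩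

variable [IsOpfibered p]

lemma pushLift_cocart {a : 𝒟} {R S : 𝒮} (ha : p.obj a = R) (f : R ⟶ S) :
    p.IsStronglyCocartesian f (pushLift p ha f) := inferInstance

lemma pushLift_pushforward_map {R S : 𝒮} (f : R ⟶ S) {a b : p.Fiber R} (φ : a ⟶ b) :
    pushLift p a.2 f ≫ ((pushforward p f).map φ).1 = φ.1 ≫ pushLift p b.2 f :=
  haveI := φ.2
  pushLift_pushMap p a.2 f b.2 f (𝟙 R) (𝟙 S) (by simp) φ.1

lemma pushLift_pushCompIso {a : 𝒟} {R S T : 𝒮} (ha : p.obj a = R) (f : R ⟶ S) (g : S ⟶ T)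
    (h : R ⟶ T) (w : f ≫ g = h) : pushLift p ha h ≫ (pushCompIso p ha f g h w).hom =
      pushLift p ha f ≫ pushLift p (pushObj_proj p ha f) g := by
  have := cocart_comp (pushLift_cocart ha f) (pushLift_cocart (pushObj_proj p ha f) g) w
  exact IsCocartesian.fac p h (pushLift p ha h) _

/-- This removes the canonical isomorphisms `(gf)_• ≅ g_• f_•` from calculations: `d_• ρ` is
described by coCartesian lifts and the comparison `c` over `d`. -/
lemma pushLift_pushHom {R S T : 𝒮} {M : p.Fiber R} {f g : R ⟶ S}
    (ρ : (pushforward p f).obj M ⟶ (pushforward p g).obj M) (d : S ⟶ T) (a b : R ⟶ T)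
    (ha : f ≫ d = a) (hb : g ≫ d = b) {c : pushObj p M.2 g ⟶ pushObj p M.2 b}
    (hc : p.IsHomLift d c) (hc' : pushLift p M.2 g ≫ c = pushLift p M.2 b) :
    pushLift p M.2 a ≫ (pushHom p ρ d a b ha hb).1 = pushLift p M.2 f ≫ ρ.1 ≫ c := by
  have h₁ : c = pushLift p (pushObj_proj p M.2 g) d ≫ (pushComp p g d b hb M).inv.1 :=
    cocart_ext (pushLift_cocart M.2 g) hc (isHomLift_comp
      (cocart_isHomLift (pushLift_cocart _ d)) (pushComp p g d b hb M).inv.2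
      (Category.comp_id _)) (comp_eq_of_comp_iso hc' (pushLift_pushCompIso M.2 g d b hb)
        (pushCompIso p M.2 g d b hb).hom_inv_id)
  rw [h₁]
  exact paste_squares (pushLift_pushCompIso M.2 f d a ha) (pushLift_pushforward_map d ρ) _

end PushHom

/-! ### Structure morphisms of a module and coCartesian lifts. -/

section Str

variable {𝒟 : Type u₁} [Category.{v₁} 𝒟] {𝒮 : Type u₂} [Category.{v₂} 𝒮] {p : 𝒟 ⥤ 𝒮}
  [IsOpfibered p] {I : Type u₃} [Category.{v₃} I] {S : I ⥤ 𝒮}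

lemma pushLift_str (M : DiaMod p S) {i j : I} (u : i ⟶ j) :
    pushLift p (M.proj_obj i) (S.map u) ≫ (M.str u).1 = M.functor.map u :=
  IsCocartesian.fac p (S.map u) (pushLift p (M.proj_obj i) (S.map u)) (M.functor.map u)

lemma isIso_str {M : DiaMod p S} (hM : IsCocart p S M) {i j : I} (u : i ⟶ j) :
    IsIso (M.str u) :=
  isIso_fiber _ (isIso_of_cocart_of_cocart (pushLift_cocart (M.proj_obj i) _) (hM u) (M.str u).2
    (pushLift_str M u))

/-- Over `S(u)`, a morphism `φ : X ⟶ M_i` in the fiber induces `S(u)_• X ⟶ S(u)_• M_i ⟶ M_j`. -/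
lemma pushLift_pushforward_map_str {i j : I} (u : i ⟶ j) {X : p.Fiber (S.obj i)} {M : DiaMod p S}
    (φ : X ⟶ (eval p S i).obj M) :
    pushLift p X.2 (S.map u) ≫ ((pushforward p (S.map u)).map φ ≫ M.str u).1 =
      φ.1 ≫ M.functor.map u := by
  exact paste_triangle (pushLift_pushforward_map (S.map u) φ) (pushLift_str M u)

end Str

end DiagramDescent

namespace DiagramDescent

open CategoryTheory.Functor DiaMod

/-! ### The descent datum of a coCartesian module -/

section Str

lemma paste_left_cancel {C : Type u₁} [Category.{v₁} C] {x y z t w : C} {l : x ⟶ y} {c : y ⟶ z}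
    {e : x ⟶ z} {s : z ⟶ t} {m : x ⟶ t} {s' : y ⟶ w} {n : x ⟶ w} {d : w ⟶ t} (h₁ : l ≫ c = e)
    (h₂ : e ≫ s = m) (h₃ : l ≫ s' = n) (h₄ : n ≫ d = m) : l ≫ c ≫ s = l ≫ s' ≫ d := by
  rw [← Category.assoc, h₁, h₂, ← Category.assoc, h₃, h₄]

lemma paste_comp_right {C : Type u₁} [Category.{v₁} C] {x y z y' z' w t : C} {l : x ⟶ y}
    {q : y ⟶ z} {u : x ⟶ y'} {ρ : y' ⟶ z'} {c : z' ⟶ z} {s : z ⟶ t} {s' : z' ⟶ w} {d : w ⟶ t}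
    {s'' : y' ⟶ w} (h₁ : l ≫ q = u ≫ ρ ≫ c) (h₂ : c ≫ s = s' ≫ d) (h₃ : ρ ≫ s' = s'') :
    l ≫ q ≫ s = (u ≫ s'') ≫ d := by
  rw [← Category.assoc, h₁, Category.assoc, Category.assoc, h₂, ← Category.assoc ρ, h₃,
    Category.assoc]

lemma comp_right_eq {C : Type u₁} [Category.{v₁} C] {x y z : C} {l : x ⟶ y} {s s' : y ⟶ z}
    {m m' : x ⟶ z} (h : s = s') (h₁ : l ≫ s = m) (h₂ : l ≫ s' = m') : m = m' := by
  rw [← h₁, h, h₂]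

variable {𝒟 : Type u₁} [Category.{v₁} 𝒟] {𝒮 : Type u₂} [Category.{v₂} 𝒮] {p : 𝒟 ⥤ 𝒮}
  [IsOpfibered p] {I : Type u₃} [Category.{v₃} I] {S : I ⥤ 𝒮}

/-- If `ρ` intertwines two structure morphisms of `M`, then its push-forward along `d` intertwines
those of the composites with `d`. Applied to the three faces of `[2]`, this gives the cocycle
identity of a module. -/
lemma pushHom_str (M : DiaMod p S) {i j l : I} {u u' : i ⟶ j}
    {ρ : (pushforward p (S.map u)).obj ((eval p S i).obj M) ⟶
      (pushforward p (S.map u')).obj ((eval p S i).obj M)}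
    (hρ : ρ ≫ M.str u' = M.str u) (d : j ⟶ l) {a b : i ⟶ l} (ha : u ≫ d = a) (hb : u' ≫ d = b)
    (ha' : S.map u ≫ S.map d = S.map a) (hb' : S.map u' ≫ S.map d = S.map b) :
    pushHom p ρ (S.map d) (S.map a) (S.map b) ha' hb' ≫ M.str b = M.str a := by
  obtain ⟨c, hc, hc'⟩ := cocart_exists (pushLift_cocart (M.proj_obj i) (S.map u'))
    (cocart_isHomLift (pushLift_cocart (M.proj_obj i) (S.map b))) hb'
  have h₁ : c ≫ M.strHom b = M.strHom u' ≫ M.functor.map d :=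
    cocart_ext (pushLift_cocart (M.proj_obj i) (S.map u'))
      (isHomLift_comp hc (M.str b).2 (Category.comp_id _))
      (isHomLift_comp (M.str u').2 (M.isHomLift d) (Category.id_comp _))
      (paste_left_cancel hc' (pushLift_str M b) (pushLift_str M u')
        ((M.functor.map_comp _ _).symm.trans (congrArg M.functor.map hb)))
  refine Subtype.ext (cocart_ext (pushLift_cocart (M.proj_obj i) (S.map a))
    (pushHom p ρ (S.map d) (S.map a) (S.map b) ha' hb' ≫ M.str b).2 (M.str a).2 ?_)
  refine (paste_comp_right (pushLift_pushHom ρ (S.map d) (S.map a) (S.map b) ha' hb' hc hc') h₁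
    (congrArg Subtype.val hρ)).trans ?_
  refine (congrArg (· ≫ M.functor.map d) (pushLift_str M u)).trans ?_
  exact (M.functor.map_comp _ _).symm.trans
    ((congrArg M.functor.map ha).trans (pushLift_str M a).symm)

/-- Compatibility with a structure morphism can be checked before push-forward. -/
lemma pushforward_map_str_eq_iff {M N : DiaMod p S} {i j : I} (u : i ⟶ j)
    (h : (eval p S i).obj M ⟶ (eval p S i).obj N) (h' : (eval p S j).obj M ⟶ (eval p S j).obj N) :
    (pushforward p (S.map u)).map h ≫ N.str u = M.str u ≫ h' ↔
      h.1 ≫ N.functor.map u = M.functor.map u ≫ h'.1 := by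
  have h₁ : pushLift p (M.proj_obj i) (S.map u) ≫ (M.str u ≫ h').1 = M.functor.map u ≫ h'.1 :=
    (Category.assoc _ _ _).symm.trans (congrArg (· ≫ h'.1) (pushLift_str M u))
  refine ⟨fun H => comp_right_eq (congrArg Subtype.val H) (pushLift_pushforward_map_str u h) h₁,
    fun H => ?_⟩
  exact Subtype.ext (cocart_ext (pushLift_cocart (M.proj_obj i) (S.map u))
    ((pushforward p (S.map u)).map h ≫ N.str u).2 (M.str u ≫ h').2
    ((pushLift_pushforward_map_str u h).trans (H.trans h₁.symm)))

end Str

/-! ### The descent datum functor and its full faithfulness. -/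

section Datum

variable {𝒟 : Type u₁} [Category.{v₁} 𝒟] {𝒮 : Type u₂} [Category.{v₂} 𝒮] {p : 𝒟 ⥤ 𝒮}
  {S : SemiSimplexCategory ⥤ 𝒮}

/-- A morphism between coCartesian modules over a cosemisimplicial object is determined by
compatible components at `[0]` and `[1]`. -/
lemma exists_hom_of_coface {M N : DiaMod p S} (hM : IsCocart p S M)
    {h₀ : M.functor.obj ⦋0⦌ₛ ⟶ N.functor.obj ⦋0⦌ₛ} (hh₀ : p.IsHomLift (𝟙 (S.obj ⦋0⦌ₛ)) h₀)
    {h₁ : M.functor.obj ⦋1⦌ₛ ⟶ N.functor.obj ⦋1⦌ₛ} (hh₁ : p.IsHomLift (𝟙 (S.obj ⦋1⦌ₛ)) h₁)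
    (w : ∀ i, h₀ ≫ N.functor.map (coface 0 i) = M.functor.map (coface 0 i) ≫ h₁) :
    ∃ f : M ⟶ N, homApp f ⦋0⦌ₛ = h₀ := by
  -- The vertex `0` of `[n]` gives a coCartesian arrow out of `M_0`, so `h₀` forces the component at
  -- `[n]`.
  have H (n : SemiSimplexCategory) := cocart_exists (hM (vertex n 0))
    (isHomLift_comp hh₀ (N.isHomLift (vertex n 0)) (Category.id_comp _)) (Category.comp_id _)
  choose h hh hv using H
  -- A map `u` may send the vertex `0` to another vertex, so naturality requires compatibility at
  -- all vertices. A vertex `k > 0` is joined to `0` by an edge, where `h₁` and its two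
  -- compatibilities apply.
  have hv' (n : SemiSimplexCategory) (k : Fin (n.len + 1)) :
      M.functor.map (vertex n k) ≫ h n = h₀ ≫ N.functor.map (vertex n k) := by
    rcases (Fin.zero_le k).eq_or_lt with rfl | hk
    · exact hv n
    · have he : M.functor.map (edge n hk) ≫ h n = h₁ ≫ N.functor.map (edge n hk) := by
        refine cocart_ext (hM (coface 0 1)) (isHomLift_comp (M.isHomLift _) (hh n)
          (Category.comp_id _)) (isHomLift_comp hh₁ (N.isHomLift _) (Category.id_comp _)) ?_
        rw [← Category.assoc, ← M.functor.map_comp, coface_one_comp_edge, hv, ← Category.assoc,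
          ← w, Category.assoc, ← N.functor.map_comp, coface_one_comp_edge]
      rw [← coface_zero_comp_edge hk, M.functor.map_comp, Category.assoc, he, ← Category.assoc,
        ← w, Category.assoc, ← N.functor.map_comp]
  refine ⟨mkHom h hh fun {n m} u => ?_, ?_⟩
  · refine cocart_ext (hM (vertex n 0)) (isHomLift_comp (M.isHomLift u) (hh m)
      (Category.comp_id _)) (isHomLift_comp (hh n) (N.isHomLift u) (Category.id_comp _)) ?_
    rw [← Category.assoc, ← M.functor.map_comp, vertex_comp, hv', ← Category.assoc, hv,
      Category.assoc, ← N.functor.map_comp, vertex_comp]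
  · have h₂ := hv ⦋0⦌ₛ
    rw [vertex_zero] at h₂
    simpa using h₂

variable [IsOpfibered p]

/-- The isomorphism `(δ^0)_• M_0 ⟶ M_1 ⟵ (δ^1)_• M_0` of a coCartesian module. -/
def datumIso {M : DiaMod p S} (hM : IsCocart p S M) :
    (pushforward p (S.map (coface 0 0))).obj ((eval p S ⦋0⦌ₛ).obj M) ≅
      (pushforward p (S.map (coface 0 1))).obj ((eval p S ⦋0⦌ₛ).obj M) :=
  haveI := isIso_str hM (coface 0 0)
  haveI := isIso_str hM (coface 0 1)
  asIso (M.str (coface 0 0)) ≪≫ (asIso (M.str (coface 0 1))).symm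

lemma datumIso_hom_str {M : DiaMod p S} (hM : IsCocart p S M) :
    (datumIso hM).hom ≫ M.str (coface 0 1) = M.str (coface 0 0) := by
  simp [datumIso]

lemma datumIso_naturality {M N : DiaMod p S} (hM : IsCocart p S M) (hN : IsCocart p S N)
    {h₀ : (eval p S ⦋0⦌ₛ).obj M ⟶ (eval p S ⦋0⦌ₛ).obj N}
    (h₁ : (eval p S ⦋1⦌ₛ).obj M ⟶ (eval p S ⦋1⦌ₛ).obj N)
    (h : ∀ i, (pushforward p (S.map (coface 0 i))).map h₀ ≫ N.str (coface 0 i) =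
      M.str (coface 0 i) ≫ h₁) :
    (datumIso hM).hom ≫ (pushforward p (S.map (coface 0 1))).map h₀ =
      (pushforward p (S.map (coface 0 0))).map h₀ ≫ (datumIso hN).hom := by
  have := isIso_str hN (coface 0 1)
  rw [← cancel_mono (N.str (coface 0 1)), Category.assoc, Category.assoc, h 1,
    datumIso_hom_str, h 0, ← Category.assoc, datumIso_hom_str]

/-- The descent datum of a coCartesian module. -/
def datumOf {M : DiaMod p S} (hM : IsCocart p S M) : DescentDatum p S where
  obj := (eval p S ⦋0⦌ₛ).obj M
  iso := datumIso hM
  cocycle := by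
    have := isIso_str hM (vertexOfTwo 0)
    -- After composition with this invertible structure morphism, both sides of the cocycle
    -- condition become `M.str (vertexOfTwo 2)`.
    rw [← cancel_mono (M.str (vertexOfTwo 0)), Category.assoc,
      pushHom_str M (datumIso_hom_str hM) (coface 1 2) (coface_coface 0 2 1 rfl)
        (coface_coface 1 2 0 rfl),
      pushHom_str M (datumIso_hom_str hM) (coface 1 0) (coface_coface 0 0 2 rfl)
        (coface_coface 1 0 1 rfl),
      pushHom_str M (datumIso_hom_str hM) (coface 1 1) (coface_coface 0 1 2 rfl)
        (coface_coface 1 1 0 rfl)]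

variable (p S) in
/-- The functor sending a coCartesian module to its descent datum. -/
def datumFunctor : (IsCocart p S).FullSubcategory ⥤ DescentDatum p S where
  obj M := datumOf M.property
  map {M N} f := ⟨(eval p S ⦋0⦌ₛ).map f.hom, datumIso_naturality M.property N.property
    ((eval p S ⦋1⦌ₛ).map f.hom) fun i => (pushforward_map_str_eq_iff (coface 0 i) _ _).2
      (homApp_naturality f.hom (coface 0 i)).symm⟩
  map_id _ := rfl
  map_comp _ _ := rfl

/-- The component at `[n]` is determined by the one at `[0]` through the coCartesian arrow of the
vertex `0`. -/
lemma datumFunctor_faithful : (datumFunctor p S).Faithful where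
  map_injective {M N f g} h := by
    have h₀ : homApp f.hom ⦋0⦌ₛ = homApp g.hom ⦋0⦌ₛ :=
      congrArg (fun e => (DescentDatum.Hom.hom e).1) h
    refine InducedCategory.hom_ext (hom_ext_app fun n => ?_)
    refine cocart_ext (M.property (vertex n 0)) (homApp_isHomLift _ n) (homApp_isHomLift _ n) ?_
    rw [homApp_naturality, homApp_naturality, h₀]

/-- Compatibility with `coface 0 1` forces the component `h₁` at `[1]`; compatibility with `coface 0
0` is then precisely compatibility of `h₀` with the isomorphisms `ρ`. -/
lemma datumFunctor_full : (datumFunctor p S).Full where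
  map_surjective {M N} g := by
    have := isIso_str M.property (coface 0 1)
    let h₀ : (eval p S ⦋0⦌ₛ).obj M.obj ⟶ (eval p S ⦋0⦌ₛ).obj N.obj := g.hom
    let h₁ : (eval p S ⦋1⦌ₛ).obj M.obj ⟶ (eval p S ⦋1⦌ₛ).obj N.obj :=
      inv (M.obj.str (coface 0 1)) ≫ (pushforward p (S.map (coface 0 1))).map h₀ ≫
        N.obj.str (coface 0 1)
    have w₁ : (pushforward p (S.map (coface 0 1))).map h₀ ≫ N.obj.str (coface 0 1) =
        M.obj.str (coface 0 1) ≫ h₁ := (IsIso.hom_inv_id_assoc _ _).symm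
    have w₀ : (pushforward p (S.map (coface 0 0))).map h₀ ≫ N.obj.str (coface 0 0) =
        M.obj.str (coface 0 0) ≫ h₁ := by
      have h : (datumIso M.property).hom ≫ (pushforward p (S.map (coface 0 1))).map h₀ =
        (pushforward p (S.map (coface 0 0))).map h₀ ≫ (datumIso N.property).hom := g.w
      rw [← datumIso_hom_str N.property, ← Category.assoc, ← h, Category.assoc, w₁,
        ← Category.assoc, datumIso_hom_str]
    obtain ⟨f, hf⟩ := exists_hom_of_coface M.property h₀.2 h₁.2 (fun i => by
      refine (pushforward_map_str_eq_iff (coface 0 i) h₀ h₁).1 ?_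
      fin_cases i
      · exact w₀
      · exact w₁)
    exact ⟨ObjectProperty.homMk f, DescentDatum.Hom.ext (Subtype.ext hf)⟩

end Datum

end DiagramDescent

namespace DiagramDescent

open CategoryTheory.Functor DiaMod

/-! ### The coCartesian module of a descent datum -/

section Effective

variable {𝒟 : Type u₁} [Category.{v₁} 𝒟] {𝒮 : Type u₂} [Category.{v₂} 𝒮] {p : 𝒟 ⥤ 𝒮}
  {S : SemiSimplexCategory ⥤ 𝒮}

/-- Morphisms `l₀, l₁ : a ⟶ b` over `δ^0` and `δ^1` satisfy the cocycle condition: the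
extensions of a morphism from `a` along the edges of a triangle fit together. -/
def IsCocycle (S : SemiSimplexCategory ⥤ 𝒮) (p : 𝒟 ⥤ 𝒮) {a b : 𝒟} (l₀ l₁ : a ⟶ b) : Prop :=
  ∀ ⦃n : SemiSimplexCategory⦄ (t : ⦋2⦌ₛ ⟶ n) ⦃c : 𝒟⦄ (e₀₁ e₀₂ e₁₂ : b ⟶ c),
    p.IsHomLift (S.map (coface 1 2 ≫ t)) e₀₁ → p.IsHomLift (S.map (coface 1 1 ≫ t)) e₀₂ →
    p.IsHomLift (S.map (coface 1 0 ≫ t)) e₁₂ →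
    l₁ ≫ e₀₁ = l₁ ≫ e₀₂ → l₁ ≫ e₁₂ = l₀ ≫ e₀₁ → l₀ ≫ e₁₂ = l₀ ≫ e₀₂

lemma IsCocycle.comp_edge {a b : 𝒟} {l₀ l₁ : a ⟶ b} (H : IsCocycle S p l₀ l₁)
    {n : SemiSimplexCategory} {i j k : Fin (n.len + 1)} (hij : i < j) (hjk : j < k) {c : 𝒟}
    {e₀₁ e₀₂ e₁₂ : b ⟶ c} (h₀₁ : p.IsHomLift (S.map (edge n hij)) e₀₁)
    (h₀₂ : p.IsHomLift (S.map (edge n (hij.trans hjk))) e₀₂)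
    (h₁₂ : p.IsHomLift (S.map (edge n hjk)) e₁₂)
    (w : l₁ ≫ e₀₁ = l₁ ≫ e₀₂) (w' : l₁ ≫ e₁₂ = l₀ ≫ e₀₁) : l₀ ≫ e₁₂ = l₀ ≫ e₀₂ := by
  rw [← coface_one_two_comp_triangle hij hjk] at h₀₁
  rw [← coface_one_one_comp_triangle hij hjk] at h₀₂
  rw [← coface_one_zero_comp_triangle hij hjk] at h₁₂
  exact H (triangle n hij hjk) e₀₁ e₀₂ e₁₂ h₀₁ h₀₂ h₁₂ w w'

/-- The objects `x₀, x₁, x₂` stand for the push-forwards of `a` along the vertices of `[2]`. All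
three edge extensions factor through one arrow `g` out of `x₀`, and the condition reduces to the
single equation `q₀ ≫ q₂ = q₁`. -/
lemma isCocycle_of_comp_eq {a b x₀ x₁ x₂ : 𝒟} {l₀ l₁ : a ⟶ b} {u₀ : a ⟶ x₀} {u₁ : a ⟶ x₁}
    {u₂ : a ⟶ x₂} {c₀ : b ⟶ x₁} {c₁ c₂ : b ⟶ x₀} {q₀ : x₂ ⟶ x₁} {q₁ : x₂ ⟶ x₀} {q₂ : x₁ ⟶ x₀}
    (hl₁ : p.IsStronglyCocartesian (S.map (coface 0 1)) l₁)
    (hu₀ : p.IsStronglyCocartesian (S.map (vertexOfTwo 0)) u₀)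
    (hc₀ : p.IsHomLift (S.map (coface 1 0)) c₀) (hc₁ : p.IsHomLift (S.map (coface 1 1)) c₁)
    (hc₂ : p.IsHomLift (S.map (coface 1 2)) c₂) (hq₂ : p.IsHomLift (𝟙 (S.obj ⦋2⦌ₛ)) q₂)
    (h₀ : l₁ ≫ c₀ = u₁) (h₁ : l₁ ≫ c₁ = u₀) (h₂ : l₁ ≫ c₂ = u₀)
    (hq₀' : u₂ ≫ q₀ = l₀ ≫ c₀) (hq₁' : u₂ ≫ q₁ = l₀ ≫ c₁) (hq₂' : u₁ ≫ q₂ = l₀ ≫ c₂)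
    (hq : q₀ ≫ q₂ = q₁) : IsCocycle S p l₀ l₁ := by
  intro n t c e₀₁ e₀₂ e₁₂ h₀₁ h₀₂ h₁₂ w w'
  rw [S.map_comp] at h₀₁ h₀₂ h₁₂
  obtain ⟨g, hg, hg'⟩ := cocart_exists (g := S.map t) hu₀
    (isHomLift_comp (cocart_isHomLift hl₁) h₀₁ rfl) (by
      rw [← map_coface_coface S 1 2 0 rfl, Category.assoc])
  obtain rfl : e₀₁ = c₂ ≫ g := cocart_ext hl₁ h₀₁ (isHomLift_comp hc₂ hg rfl) (by
    rw [← Category.assoc, h₂, hg'])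
  obtain rfl : e₀₂ = c₁ ≫ g := cocart_ext hl₁ h₀₂ (isHomLift_comp hc₁ hg rfl) (by
    rw [← w, ← Category.assoc, ← Category.assoc, h₁, h₂])
  obtain rfl : e₁₂ = c₀ ≫ q₂ ≫ g :=
    cocart_ext hl₁ h₁₂ (isHomLift_comp hc₀ (isHomLift_comp hq₂ hg (Category.id_comp _)) rfl) (by
      rw [w', ← Category.assoc, ← hq₂', ← Category.assoc l₁, h₀, Category.assoc])
  rw [← Category.assoc, ← hq₀', Category.assoc, ← Category.assoc q₀, hq, ← Category.assoc, hq₁',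
    Category.assoc]

variable [IsOpfibered p]

/-- Take `M_n` to be the push-forward of `a` along the vertex `0` of `[n]`. The cocycle condition
makes the induced maps respect all vertices, and this yields functoriality. -/
lemma exists_module_of_isCocycle {a b : 𝒟} {l₀ l₁ : a ⟶ b}
    (hl₀ : p.IsStronglyCocartesian (S.map (coface 0 0)) l₀)
    (hl₁ : p.IsStronglyCocartesian (S.map (coface 0 1)) l₁) (H : IsCocycle S p l₀ l₁) :
    ∃ (M : DiaMod p S) (_ : IsCocart p S M) (θ : a ⟶ M.functor.obj ⦋0⦌ₛ)
      (θ₁ : b ⟶ M.functor.obj ⦋1⦌ₛ), IsIso θ ∧ p.IsHomLift (𝟙 (S.obj ⦋0⦌ₛ)) θ ∧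
        p.IsHomLift (𝟙 (S.obj ⦋1⦌ₛ)) θ₁ ∧ l₀ ≫ θ₁ = θ ≫ M.functor.map (coface 0 0) ∧
        l₁ ≫ θ₁ = θ ≫ M.functor.map (coface 0 1) := by
  have ha : p.obj a = S.obj ⦋0⦌ₛ := IsHomLift.domain_eq p (S.map (coface 0 0)) l₀
  have hx (n : SemiSimplexCategory) := exists_cocartesian p ha (S.map (vertex n 0))
  choose x u hu using hx
  have he (n : SemiSimplexCategory) (k : Fin (n.len + 1)) (hk : 0 < k) :
      ∃ e : b ⟶ x n, p.IsHomLift (S.map (edge n hk)) e ∧ l₁ ≫ e = u n :=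
    cocart_exists hl₁ (cocart_isHomLift (hu n)) (by
      rw [← S.map_comp, coface_one_comp_edge])
  choose e he hle using he
  -- Up to `θ`, the arrow `v n k` will be the value of `M` on the vertex `k`: it is the lift `u n`
  -- for `k = 0`, and otherwise passes through `b` along the edge from `0` to `k`.
  have hv (n : SemiSimplexCategory) (k : Fin (n.len + 1)) : ∃ v : a ⟶ x n,
      p.IsStronglyCocartesian (S.map (vertex n k)) v ∧ (k = 0 → v = u n) ∧
      ∀ hk : 0 < k, v = l₀ ≫ e n k hk := by
    rcases (Fin.zero_le k).eq_or_lt with rfl | hk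
    · exact ⟨u n, hu n, fun _ => rfl, fun h => absurd h (lt_irrefl _)⟩
    · refine ⟨l₀ ≫ e n k hk, cocart_comp hl₀ (cocart_of_comp hl₁ (hu n) (he n k hk) ?_
        (hle n k hk)) ?_, fun h => absurd hk (by simp [h]), fun _ => rfl⟩
      · rw [← S.map_comp, coface_one_comp_edge]
      · rw [← S.map_comp, coface_zero_comp_edge]
  choose v hv hv₀ hv₁ using hv
  -- An extension along the edge `i < j` that starts at `v n i` ends at `v n j`. For `i = 0` this is
  -- uniqueness of the edge extension; for `i > 0` it is the cocycle condition on the triangle `0 <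
  -- i < j`.
  have hve {n : SemiSimplexCategory} {i j : Fin (n.len + 1)} (hij : i < j) (g : b ⟶ x n)
      (hg : p.IsHomLift (S.map (edge n hij)) g) (hlg : l₁ ≫ g = v n i) : l₀ ≫ g = v n j := by
    rcases (Fin.zero_le i).eq_or_lt with rfl | hi
    · rw [hv₁ n j hij]
      refine congrArg (l₀ ≫ ·) (cocart_ext hl₁ hg (he n j hij) ?_)
      rw [hlg, hle, hv₀ n 0 rfl]
    · rw [hv₁ n j (hi.trans hij)]
      refine H.comp_edge hi hij (he n i hi) (he n j _) hg ?_ ?_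
      · rw [hle, hle]
      · rw [hlg, hv₁ n i hi]
  have hm {n m : SemiSimplexCategory} (f : n ⟶ m) : ∃ g : x n ⟶ x m,
      p.IsHomLift (S.map f) g ∧ v n 0 ≫ g = v m (SemiSimplexCategory.homEquiv f 0) :=
    cocart_exists (hv n 0) (cocart_isHomLift (hv m _)) (by rw [← S.map_comp, vertex_comp])
  choose g hg hvg using @hm
  have hvg' {n m : SemiSimplexCategory} (f : n ⟶ m) (k : Fin (n.len + 1)) :
      v n k ≫ g f = v m (SemiSimplexCategory.homEquiv f k) := by
    rcases (Fin.zero_le k).eq_or_lt with rfl | hk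
    · exact hvg f
    · have hk' := (SemiSimplexCategory.homEquiv f).strictMono hk
      rw [hv₁ n k hk, Category.assoc]
      refine hve hk' _ ?_ ?_
      · rw [← edge_comp hk f hk', S.map_comp]
        exact isHomLift_comp (he n k hk) (hg f) rfl
      · rw [← Category.assoc, hle, ← hv₀ n 0 rfl, hvg]
  have hx (n) : p.obj (x n) = S.obj n := IsHomLift.codomain_eq p (S.map (vertex n 0)) (u n)
  let M : DiaMod p S :=
    { functor :=
        { obj := x
          map := g
          map_id := fun n => by
            have hid : p.IsHomLift (S.map (𝟙 n)) (𝟙 (x n)) := by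
              rw [S.map_id]
              exact IsHomLift.id (hx n)
            refine cocart_ext (hv n 0) (hg (𝟙 n)) hid ?_
            rw [hvg, Category.comp_id]
            rfl
          map_comp := fun f f' => by
            refine cocart_ext (hv _ 0) (hg (f ≫ f'))
              (isHomLift_comp (hg f) (hg f') (S.map_comp f f').symm) ?_
            rw [hvg, ← Category.assoc, hvg, hvg', homEquiv_comp_apply] }
      isHomLift := fun f => hg f }
  have hM : IsCocart p S M := fun n m f =>
    cocart_of_comp (hv n 0) (hv m _) (hg f) (by rw [← S.map_comp, vertex_comp]) (hvg f)
  have h₀ : p.IsStronglyCocartesian (𝟙 (S.obj ⦋0⦌ₛ)) (v ⦋0⦌ₛ 0) := by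
    have := hv ⦋0⦌ₛ 0
    rwa [vertex_zero, S.map_id] at this
  have h₀₁ : (0 : Fin (⦋1⦌ₛ.len + 1)) < 1 := Nat.zero_lt_one
  -- The vertex of `[0]` and the edge `0 < 1` of `[1]` are identities, so `θ` is an isomorphism and
  -- `θ₁` is vertical.
  refine ⟨M, hM, v ⦋0⦌ₛ 0, e ⦋1⦌ₛ 1 h₀₁, isIso_of_cocart_id h₀ rfl, cocart_isHomLift h₀, ?_, ?_, ?_⟩
  · have := he ⦋1⦌ₛ 1 h₀₁
    rwa [edge_one, S.map_id] at this
  · rw [← hv₁ ⦋1⦌ₛ 1 h₀₁]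
    exact (hvg (coface 0 0)).symm
  · rw [hle, ← hv₀ ⦋1⦌ₛ 0 rfl]
    exact (hvg (coface 0 1)).symm

namespace DescentDatum

lemma isCocycle (X : DescentDatum p S) :
    IsCocycle S p (pushLift p X.obj.2 (S.map (coface 0 0)) ≫ X.iso.hom.1)
      (pushLift p X.obj.2 (S.map (coface 0 1))) := by
  have hc (i : Fin 2) (j k : Fin 3) (h : j.succAbove (i.succAbove 0) = k) :=
    cocart_exists (pushLift_cocart X.obj.2 (S.map (coface 0 i)))
      (cocart_isHomLift (pushLift_cocart X.obj.2 (S.map (vertexOfTwo k))))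
      (map_coface_coface S i j k h)
  obtain ⟨c₀, hc₀, hc₀'⟩ := hc 1 0 1 rfl
  obtain ⟨c₁, hc₁, hc₁'⟩ := hc 1 1 0 rfl
  obtain ⟨c₂, hc₂, hc₂'⟩ := hc 1 2 0 rfl
  refine isCocycle_of_comp_eq (pushLift_cocart X.obj.2 _) (pushLift_cocart X.obj.2 _) hc₀ hc₁ hc₂
    (pushHom p X.iso.hom (S.map (coface 1 2)) (S.map (vertexOfTwo 1)) (S.map (vertexOfTwo 0))
      (map_coface_coface S 0 2 1 rfl) (map_coface_coface S 1 2 0 rfl)).2 hc₀' hc₁' hc₂'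
    ((pushLift_pushHom X.iso.hom (S.map (coface 1 0)) (S.map (vertexOfTwo 2))
      (S.map (vertexOfTwo 1)) (map_coface_coface S 0 0 2 rfl) (map_coface_coface S 1 0 1 rfl)
      hc₀ hc₀').trans (Category.assoc _ _ _).symm)
    ((pushLift_pushHom X.iso.hom (S.map (coface 1 1)) (S.map (vertexOfTwo 2))
      (S.map (vertexOfTwo 0)) (map_coface_coface S 0 1 2 rfl) (map_coface_coface S 1 1 0 rfl)
      hc₁ hc₁').trans (Category.assoc _ _ _).symm)
    ((pushLift_pushHom X.iso.hom (S.map (coface 1 2)) (S.map (vertexOfTwo 1))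
      (S.map (vertexOfTwo 0)) (map_coface_coface S 0 2 1 rfl) (map_coface_coface S 1 2 0 rfl)
      hc₂ hc₂').trans (Category.assoc _ _ _).symm)
    (congrArg Subtype.val X.cocycle)

/-- An isomorphism of descent data from an isomorphism of the underlying objects. -/
def isoMk {X Y : DescentDatum p S} (f : X ⟶ Y) (h : IsIso (Hom.hom f)) : X ≅ Y where
  hom := f
  inv := ⟨inv (Hom.hom f), by
    rw [Functor.map_inv, Functor.map_inv, IsIso.comp_inv_eq, Category.assoc, IsIso.eq_inv_comp]
    exact (Hom.w f).symm⟩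
  hom_inv_id := Hom.ext (IsIso.hom_inv_id (Hom.hom f))
  inv_hom_id := Hom.ext (IsIso.inv_hom_id (Hom.hom f))

end DescentDatum

/-- The isomorphism `ρ` is absorbed into `l₀`, so that both coface lifts share the target `(δ^1)_•
M`; the constructed module then has the given datum up to `θ`. -/
lemma datumFunctor_essSurj : (datumFunctor p S).EssSurj where
  mem_essImage X := by
    have hρ : IsIso X.iso.hom.1 := ⟨X.iso.inv.1, congrArg Subtype.val X.iso.hom_inv_id,
      congrArg Subtype.val X.iso.inv_hom_id⟩
    obtain ⟨M, hM, θ, θ₁, hθ, hθ', hθ₁, h₀, h₁⟩ := exists_module_of_isCocycle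
      (cocart_comp (pushLift_cocart X.obj.2 _) (cocart_of_isIso X.iso.hom.2 hρ)
        (Category.comp_id _)) (pushLift_cocart X.obj.2 _) X.isCocycle
    let f : X.obj ⟶ (eval p S ⦋0⦌ₛ).obj M := ⟨θ, hθ'⟩
    let f₁ : (pushforward p (S.map (coface 0 1))).obj X.obj ⟶ (eval p S ⦋1⦌ₛ).obj M := ⟨θ₁, hθ₁⟩
    have hf : IsIso f := isIso_fiber f hθ
    have w₁ : (pushforward p (S.map (coface 0 1))).map f ≫ M.str (coface 0 1) = f₁ :=
      Subtype.ext (cocart_ext (pushLift_cocart X.obj.2 (S.map (coface 0 1)))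
        ((pushforward p (S.map (coface 0 1))).map f ≫ M.str (coface 0 1)).2 f₁.2
        ((pushLift_pushforward_map_str (coface 0 1) f).trans h₁.symm))
    have w₀ : (pushforward p (S.map (coface 0 0))).map f ≫ M.str (coface 0 0) =
        X.iso.hom ≫ f₁ :=
      Subtype.ext (cocart_ext (pushLift_cocart X.obj.2 (S.map (coface 0 0)))
        ((pushforward p (S.map (coface 0 0))).map f ≫ M.str (coface 0 0)).2 (X.iso.hom ≫ f₁).2
        ((pushLift_pushforward_map_str (coface 0 0) f).trans
          (h₀.symm.trans (Category.assoc _ _ _))))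
    have w : X.iso.hom ≫ (pushforward p (S.map (coface 0 1))).map f =
        (pushforward p (S.map (coface 0 0))).map f ≫ (datumIso hM).hom := by
      have := isIso_str hM (coface 0 1)
      rw [← cancel_mono (M.str (coface 0 1)), Category.assoc, Category.assoc, datumIso_hom_str,
        w₁, w₀]
    exact ⟨⟨M, hM⟩, ⟨(DescentDatum.isoMk (Y := datumOf hM) ⟨f, w⟩ hf).symm⟩⟩

end Effective

end DiagramDescent

namespace DiagramDescent

open CategoryTheory.Functor DiaMod

/-! ### Classical descent data and coCartesian modules -/

section Equivalence

variable {𝒟 : Type u₁} [Category.{v₁} 𝒟] {𝒮 : Type u₂} [Category.{v₂} 𝒮] {p : 𝒟 ⥤ 𝒮}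
  [IsOpfibered p]

lemma datumFunctor_isEquivalence (S : SemiSimplexCategory ⥤ 𝒮) :
    (datumFunctor p S).IsEquivalence where
  faithful := datumFunctor_faithful
  full := datumFunctor_full
  essSurj := datumFunctor_essSurj

/-- The equivalence `R` leaves room for both cases: restriction from cosimplicial to
cosemisimplicial objects, or the identity. -/
lemma exists_equivalence_descentDatum {C : Type u₃} [Category.{v₃} C]
    (S : SemiSimplexCategory ⥤ 𝒮) (R : C ⥤ (IsCocart p S).FullSubcategory)
    (hR : R.IsEquivalence) :
    ∃ (e : C ≌ DescentDatum p S)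
      (θ : e.functor ⋙ DescentDatum.forget p S ≅ R ⋙ (IsCocart p S).ι ⋙ eval p S ⦋0⦌ₛ),
      ∀ X : C, (e.functor.obj X).IsDatumOf (R.obj X).obj (θ.app X) := by
  have := datumFunctor_isEquivalence (p := p) S
  refine ⟨(R ⋙ datumFunctor p S).asEquivalence, Iso.refl _, fun X => ?_⟩
  have h := datumIso_hom_str (R.obj X).property
  have h₁ (i : Fin 2) : (pushforward p (S.map (coface 0 i))).map
      (𝟙 ((eval p S ⦋0⦌ₛ).obj (R.obj X).obj)) ≫ (R.obj X).obj.str (coface 0 i) =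
        (R.obj X).obj.str (coface 0 i) := by
    exact (congrArg (· ≫ _) ((pushforward p _).map_id _)).trans (Category.id_comp _)
  exact (congrArg ((datumIso (R.obj X).property).hom ≫ ·) (h₁ 1)).trans (h.trans (h₁ 0).symm)

end Equivalence

/-! ### From cosimplicial to cosemisimplicial objects -/

section Shift

open SemiSimplexCategory

/-- The simplices of `[n]`: the category of order preserving maps `[m] ⟶ [n]` and injections. -/
abbrev Simplices (n : SimplexCategory) := CostructuredArrow toSimplexCategory n

/-- The map of a simplex, as an order homomorphism. -/
def simplexMap {n : SimplexCategory} (x : Simplices n) : Fin (x.left.len + 1) →o Fin (n.len + 1) :=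
  SimplexCategory.Hom.toOrderHom x.hom

lemma simplexMap_w {n : SimplexCategory} {x y : Simplices n} (f : x ⟶ y)
    (i : Fin (x.left.len + 1)) : simplexMap y (homEquiv f.left i) = simplexMap x i :=
  congrArg (fun g => SimplexCategory.Hom.toOrderHom g i) (CostructuredArrow.w f)

/-- Constructor for simplices. -/
def simplexMk {n : SimplexCategory} {m : ℕ} (f : Fin (m + 1) →o Fin (n.len + 1)) : Simplices n :=
  CostructuredArrow.mk (Y := ⦋m⦌ₛ) (SimplexCategory.Hom.mk (a := ⦋m⦌) f)

/-- Constructor for morphisms of simplices. -/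
def simplexHomMk {n : SimplexCategory} {x y : Simplices n}
    (f : Fin (x.left.len + 1) ↪o Fin (y.left.len + 1))
    (w : ∀ i, simplexMap y (f i) = simplexMap x i) : x ⟶ y :=
  CostructuredArrow.homMk (homEquiv.symm f)
    (SimplexCategory.Hom.ext _ _ (OrderHom.ext _ _ (funext w)))

lemma simplex_hom_ext {n : SimplexCategory} {x y : Simplices n} {f g : x ⟶ y}
    (h : ∀ i, homEquiv f.left i = homEquiv g.left i) : f = g :=
  CostructuredArrow.hom_ext _ _ (hom_ext (RelEmbedding.ext h))

lemma simplex_comp_left {n : SimplexCategory} {x y z : Simplices n} (f : x ⟶ y) (g : y ⟶ z)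
    (i : Fin (x.left.len + 1)) :
    homEquiv (f ≫ g).left i = homEquiv g.left (homEquiv f.left i) :=
  homEquiv_comp_apply f.left g.left i

/-- The simplex with a new initial vertex mapped to `0`. -/
def simplexCone {n : SimplexCategory} (x : Simplices n) : Simplices n :=
  simplexMk (m := x.left.len + 1) ⟨Fin.cons 0 (simplexMap x), by
    refine Fin.monotone_iff_le_succ.2 fun i => ?_
    refine Fin.cases ?_ (fun j => ?_) i
    · exact Fin.zero_le _
    · exact (simplexMap x).monotone (Fin.castSucc_le_succ j)⟩

/-- The functoriality of `simplexCone`. -/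
def simplexConeMap {n : SimplexCategory} {x y : Simplices n} (f : x ⟶ y) :
    simplexCone x ⟶ simplexCone y :=
  simplexHomMk (OrderEmbedding.ofStrictMono (Fin.cons 0 (fun i => (homEquiv f.left i).succ)) (by
    refine Fin.strictMono_iff_lt_succ.2 fun i => ?_
    refine Fin.cases ?_ (fun j => ?_) i
    · exact Fin.succ_pos _
    · exact Fin.succ_lt_succ_iff.2 ((homEquiv f.left).strictMono (Fin.castSucc_lt_succ))))
    (Fin.cases rfl fun j => simplexMap_w f j)

/-- The functor `simplexCone`. -/
def simplexConeFunctor (n : SimplexCategory) : Simplices n ⥤ Simplices n where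
  obj := simplexCone
  map := simplexConeMap
  map_id x := simplex_hom_ext (Fin.cases rfl fun _ => rfl)
  map_comp f g := simplex_hom_ext (Fin.cases
    (by rw [simplex_comp_left]; rfl)
    (fun j => by
      rw [simplex_comp_left]
      exact congrArg Fin.succ (simplex_comp_left f g j)))

/-- The inclusion of the face opposite to the new vertex. -/
def simplexToCone {n : SimplexCategory} (x : Simplices n) : x ⟶ simplexCone x :=
  simplexHomMk (y := simplexCone x) (Fin.succOrderEmb _) fun _ => rfl

lemma homEquiv_simplexToCone {n : SimplexCategory} (x : Simplices n)
    (i : Fin (x.left.len + 1)) : homEquiv (simplexToCone x).left i = Fin.succ i := rfl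

lemma homEquiv_simplexConeMap_succ {n : SimplexCategory} {x y : Simplices n} (f : x ⟶ y)
    (i : Fin (x.left.len + 1)) :
    homEquiv (simplexConeMap f).left (Fin.succ i) = Fin.succ (homEquiv f.left i) := rfl

lemma simplexToCone_naturality {n : SimplexCategory} {x y : Simplices n} (f : x ⟶ y) :
    f ≫ simplexToCone y = simplexToCone x ≫ simplexConeMap f :=
  simplex_hom_ext fun i => by
    rw [simplex_comp_left, simplex_comp_left, homEquiv_simplexToCone, homEquiv_simplexToCone]
    exact (homEquiv_simplexConeMap_succ f i).symm

/-- The vertex `0` of `[n]`. -/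
def zeroSimplex (n : SimplexCategory) : Simplices n :=
  simplexMk (m := 0) ⟨fun _ => 0, fun _ _ _ => le_rfl⟩

/-- The inclusion of the new vertex. -/
def zeroToCone {n : SimplexCategory} (x : Simplices n) : zeroSimplex n ⟶ simplexCone x :=
  simplexHomMk (x := zeroSimplex n) (y := simplexCone x)
    (OrderEmbedding.ofStrictMono (fun _ => 0) fun a b h =>
      absurd h (by rw [Subsingleton.elim (α := Fin 1) a b]; exact lt_irrefl _)) fun _ => rfl

/-- Adding an initial vertex sent to `0` is functorial for injections. The old simplex and the new
vertex both include naturally in the cone, which connects the identity to the constant functor. -/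
lemma zigzag_simplices (n : SimplexCategory) :
    Zigzag (𝟭 (Simplices n)) ((Functor.const _).obj (zeroSimplex n)) := by
  let f : 𝟭 (Simplices n) ⟶ simplexConeFunctor n :=
    { app := simplexToCone
      naturality := fun _ _ g => simplexToCone_naturality g }
  let g : (Functor.const _).obj (zeroSimplex n) ⟶ simplexConeFunctor n :=
    { app := zeroToCone
      naturality := fun x y g => simplex_hom_ext fun i =>
        (simplex_comp_left (𝟙 _) (zeroToCone y) i).trans
          (simplex_comp_left (zeroToCone x) (simplexConeMap g) i).symm }
  exact Zigzag.of_hom_inv f g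

end Shift

/-! ### Restriction along the inclusion of injective maps is an equivalence on coCartesian modules.
-/

section Simplicial

variable {𝒟 : Type u₁} [Category.{v₁} 𝒟] {𝒮 : Type u₂} [Category.{v₂} 𝒮] {p : 𝒟 ⥤ 𝒮}
  [IsOpfibered p]

lemma isOfDescent_toSimplexCategory (S : SimplexCategory ⥤ 𝒮) :
    IsOfDescent p (DiaHom.pure SemiSimplexCategory.toSimplexCategory S) :=
  (isOfDescent_iff_isOfFiniteDescent_top p _).2 (isOfFiniteDescent_pure fun j _ =>
    isOfFiniteDescent_constToPoint_of_zigzag _ (zigzag_simplices j) _)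

/-- The restriction of coCartesian modules along a functor. -/
def restrictCocart (p : 𝒟 ⥤ 𝒮) {I : Type u₃} [Category.{v₃} I] {J : Type u₄} [Category.{v₄} J]
    (α : I ⥤ J) (T : J ⥤ 𝒮) :
    (IsCocart p T).FullSubcategory ⥤ (IsCocart p (α ⋙ T)).FullSubcategory :=
  (IsCocart p (α ⋙ T)).lift ((IsCocart p T).ι ⋙ restrict p α T) fun M _ _ f =>
    M.property (α.map f)

/-- For a morphism of pure diagram type, identities form a lifting to the strict restriction, which
is thus isomorphic to the pull-back defined by chosen lifts. -/
lemma restrictCocart_isEquivalence {I : Type u₃} [Category.{v₃} I] {J : Type u₄} [Category.{v₄} J]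
    {α : I ⥤ J} {T : J ⥤ 𝒮} (h : IsOfDescent p (DiaHom.pure α T)) :
    (restrictCocart p α T).IsEquivalence := by
  have : (pullbackCocart (p := p) (DiaHom.pure α T)).IsEquivalence := h
  obtain ⟨e⟩ := nonempty_iso_of_liftings (φ := DiaHom.pure α T)
    (F := pullbackCocart (p := p) (DiaHom.pure α T)) (G := restrictCocart p α T) (IsCocart p T).ι
    (fun M => pullbackLifting (DiaHom.pure α T) M.obj)
    (fun M =>
      { app := fun i => 𝟙 (M.obj.functor.obj (α.obj i))
        naturality := fun _ => (Category.comp_id _).trans (Category.id_comp _).symm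
        cocart := fun i => cocart_id (M.obj.proj_obj (α.obj i)) })
    (fun f i => pullbackLifting_map (DiaHom.pure α T) f.hom i)
    (fun f i => (Category.id_comp _).trans (Category.comp_id _).symm)
  exact Functor.isEquivalence_of_iso e

end Simplicial

end DiagramDescent

end

/-! ### Assembly of the six statements. -/

theorem mainTheorem3
    {𝒟 : Type u₁} [Category.{v₁} 𝒟] {𝒮 : Type u₂} [Category.{v₂} 𝒮] (p : 𝒟 ⥤ 𝒮)
    [IsBifibered p]
    [∀ X : 𝒮, Limits.HasLimitsOfSize.{w, w} (p.Fiber X)]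
    [∀ X : 𝒮, Limits.HasColimitsOfSize.{w, w} (p.Fiber X)]
    (P : ObjectProperty 𝒟) [IsPushforwardStable p P] :
    -- 1. two out of three
    (∀ {I J K : Type w} [SmallCategory I] [SmallCategory J] [SmallCategory K]
      {S : I ⥤ 𝒮} {T : J ⥤ 𝒮} {U : K ⥤ 𝒮}
      (φ : DiaHom S T) (ψ : DiaHom T U),
      ((IsOfDescent p φ → IsOfDescent p ψ → IsOfDescent p (φ.comp ψ)) ∧
        (IsOfDescent p φ → IsOfDescent p (φ.comp ψ) → IsOfDescent p ψ) ∧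
        (IsOfDescent p ψ → IsOfDescent p (φ.comp ψ) → IsOfDescent p φ)) ∧
      ((IsOfFiniteDescent p P φ → IsOfFiniteDescent p P ψ →
          IsOfFiniteDescent p P (φ.comp ψ)) ∧
        (IsOfFiniteDescent p P φ →
          IsOfFiniteDescent p P (φ.comp ψ) →
          IsOfFiniteDescent p P ψ) ∧
        (IsOfFiniteDescent p P ψ →
          IsOfFiniteDescent p P (φ.comp ψ) →
          IsOfFiniteDescent p P φ))) ∧
    -- 2. morphisms inverse to each other up to sequences of 2-morphisms
    (∀ {I J : Type w} [SmallCategory I] [SmallCategory J] {S : I ⥤ 𝒮} {T : J ⥤ 𝒮}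
      (φ : DiaHom S T) (ψ : DiaHom T S),
      Zigzag (φ.comp ψ) (DiaHom.id S) →
      Zigzag (ψ.comp φ) (DiaHom.id T) →
      (IsOfDescent p φ ∧ IsOfDescent p ψ) ∧
      (IsOfFiniteDescent p P φ ∧ IsOfFiniteDescent p P ψ)) ∧
    -- 3. descent on the slices, or on the fibers of a Grothendieck fibration
    (∀ {I J : Type w} [SmallCategory I] [SmallCategory J] {S : I ⥤ 𝒮} {T : J ⥤ 𝒮}
      (φ : DiaHom S T),
      (((∀ j : J, IsOfDescent p (φ.slice j)) → IsOfDescent p φ) ∧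
        ((∀ j : J, IsOfFiniteDescent p P (φ.slice j)) →
          IsOfFiniteDescent p P φ)) ∧
      (φ.functor.IsFibered →
        ((∀ j : J, IsOfDescent p (φ.fiber j)) → IsOfDescent p φ) ∧
        ((∀ j : J, IsOfFiniteDescent p P (φ.fiber j)) →
          IsOfFiniteDescent p P φ))) ∧
    -- 4. morphisms of pure diagram type
    (∀ {I J : Type w} [SmallCategory I] [SmallCategory J] (α : I ⥤ J) (S : J ⥤ 𝒮),
      ((∀ j k : J, IsOfDescent p
          (DiaHom.constToPoint (CostructuredArrow α j) (S.obj k))) →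
        IsOfDescent p (DiaHom.pure α S)) ∧
      ((∀ j k : J, IsOfFiniteDescent p P
          (DiaHom.constToPoint (CostructuredArrow α j) (S.obj k))) →
        IsOfFiniteDescent p P (DiaHom.pure α S))) ∧
    -- 5. constant diagrams
    (∀ (I : Type w) [SmallCategory I],
      (∀ X : 𝒮,
        IsOfDescent p (DiaHom.const (FreeGroupoid.of I) X) ∧
        IsOfFiniteDescent p P
          (DiaHom.const (FreeGroupoid.of I) X)) ∧
      (∀ b : CategoryTheory.ConnectedComponents I → I,
        (∀ ξ, CategoryTheory.ConnectedComponents.mk (b ξ) = ξ) →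
        Nonempty (FreeGroupoid I ≌
          (Σ ξ : CategoryTheory.ConnectedComponents I, SingleObj (PiOne I (b ξ))))) ∧
      (Nonempty (Unique (CategoryTheory.ConnectedComponents I)) →
        (∀ i : I, Subsingleton (PiOne I i)) →
        ∀ X : 𝒮,
          IsOfDescent p (DiaHom.constToPoint I X) ∧
          IsOfFiniteDescent p P (DiaHom.constToPoint I X))) ∧
    -- 6. classical descent data, for cosimplicial and cosemisimplicial objects
    ((∀ S : SimplexCategory ⥤ 𝒮,
      ∃ (e : (DiaMod.IsCocart p S).FullSubcategory ≌
          DescentDatum p (SemiSimplexCategory.toSimplexCategory ⋙ S))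
        (θ : e.functor ⋙
            DescentDatum.forget p (SemiSimplexCategory.toSimplexCategory ⋙ S) ≅
          (DiaMod.IsCocart p S).ι ⋙
            DiaMod.restrict p SemiSimplexCategory.toSimplexCategory S ⋙
            DiaMod.eval p (SemiSimplexCategory.toSimplexCategory ⋙ S) ⦋0⦌ₛ),
        ∀ M : (DiaMod.IsCocart p S).FullSubcategory,
          (e.functor.obj M).IsDatumOf
            ((DiaMod.restrict p SemiSimplexCategory.toSimplexCategory S).obj M.obj)
            (θ.app M)) ∧
      (∀ S : SemiSimplexCategory ⥤ 𝒮,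
        ∃ (e : (DiaMod.IsCocart p S).FullSubcategory ≌
            DescentDatum p S)
          (θ : e.functor ⋙ DescentDatum.forget p S ≅
            (DiaMod.IsCocart p S).ι ⋙ DiaMod.eval p S ⦋0⦌ₛ),
          ∀ M : (DiaMod.IsCocart p S).FullSubcategory,
            (e.functor.obj M).IsDatumOf M.obj (θ.app M))) := by
  refine ⟨fun φ ψ => ?_, fun φ ψ h h' => ?_, fun φ => ?_, fun α S => ?_, fun I _ => ?_,
    fun S => ?_, fun S => ?_⟩
  · simp only [isOfDescent_iff_isOfFiniteDescent_top]
    exact ⟨⟨fun h h' => h.comp h', fun h h' => h.of_comp_left h', fun h h' => h.of_comp_right h'⟩,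
      fun h h' => h.comp h', fun h h' => h.of_comp_left h', fun h h' => h.of_comp_right h'⟩
  · simp only [isOfDescent_iff_isOfFiniteDescent_top]
    exact ⟨isOfFiniteDescent_of_zigzag ⊤ φ ψ h h', isOfFiniteDescent_of_zigzag P φ ψ h h'⟩
  · simp only [isOfDescent_iff_isOfFiniteDescent_top]
    refine ⟨⟨fun h => ?_, fun h => ?_⟩, fun hφ => ⟨fun h => ?_, fun h => ?_⟩⟩
    · exact isOfFiniteDescent_of_hasSliceDescent fun j => hasSliceDescent_of_slice (h j)
    · exact isOfFiniteDescent_of_hasSliceDescent fun j => hasSliceDescent_of_slice (h j)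
    · exact isOfFiniteDescent_of_hasSliceDescent fun j => hasSliceDescent_of_fiber (h j)
    · exact isOfFiniteDescent_of_hasSliceDescent fun j => hasSliceDescent_of_fiber (h j)
  · simp only [isOfDescent_iff_isOfFiniteDescent_top]
    exact ⟨isOfFiniteDescent_pure, isOfFiniteDescent_pure⟩
  · simp only [isOfDescent_iff_isOfFiniteDescent_top]
    exact ⟨fun X => ⟨isOfFiniteDescent_freeGroupoid I X, isOfFiniteDescent_freeGroupoid I X⟩,
      freeGroupoid_nonempty_equivalence_sigma I,
      fun h h' X => ⟨isOfFiniteDescent_constToPoint_of_simplyConnected I h h' X,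
        isOfFiniteDescent_constToPoint_of_simplyConnected I h h' X⟩⟩
  · exact exists_equivalence_descentDatum (SemiSimplexCategory.toSimplexCategory ⋙ S)
      (restrictCocart p SemiSimplexCategory.toSimplexCategory S)
      (restrictCocart_isEquivalence (isOfDescent_toSimplexCategory S))
  · exact exists_equivalence_descentDatum S (𝟭 _) inferInstance
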